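/- **Setting.** Let $\mathcal V$ be a symmetric monoidal closed category whose underlying ordinary category is locally small, complete and cocomplete. "Category", "functor" and "natural transformation" mean $\mathcal V$-category, $\mathcal V$-functor and $\mathcal V$-natural transformation. A category is *small* if its isomorphism classes of objects form a small set. For small $\mathcal A$, $[\mathcal A^{op},\mathcal V]$ denotes the category of presheaves on $\mathcal A$. A *weight* is a functor $\phi:\mathcal K^{op}\to\mathcal V$ with $\mathcal K$ small. The limit $\{\phi,T\}$ of $T:\mathcal K^{op}\to\mathcal C$ and the colimit $\phi*S$ of $S:\mathcal K\to\mathcal C$ are defined by representations $$\mathcal C(c,\{\phi,T\})\cong[\mathcal K^{op},\mathcal V](\phi,\mathcal C(c,T-)),\qquad \mathcal C(\phi*S,c)\cong[\mathcal K^{op},\mathcal V](\phi,\mathcal C(S-,c)).$$ For a class $\Phi$ of weights, $\mathcal C$ is *$\Phi$-complete* (*$\Phi$-cocomplete*) if it has all limits $\{\phi,T\}$ (all colimits $\phi*S$) with $\phi\in\Phi$; a functor is *$\Phi$-continuous* if it preserves all limits weighted by members of $\Phi$. - $\Phi$ is *saturated* if it contains every weight $\psi$ such that every $\Phi$-complete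 category has all $\psi$-weighted limits and every $\Phi$-continuous functor between $\Phi$-complete categories preserves all $\psi$-weighted limits. - For a full subcategory $\mathcal B$ of $\mathcal C$, $\Phi\{\mathcal B\}$ is the closure of $\mathcal B$ in $\mathcal C$ under $\Phi$-colimits: the smallest full replete subcategory of $\mathcal C$ that contains $\mathcal B$ and is closed under colimits with weights in $\Phi$. For small $\mathcal A$, $\Phi(\mathcal A)$ is the closure of the representables in $[\mathcal A^{op},\mathcal V]$ under $\Phi$-colimits. - $\Phi$ is *locally small* if $\Phi(\mathcal A)$ is small for every small $\mathcal A$. - $\Phi^+$ is the class of all weights $\phi$ such that $\phi$-colimits commute in $\mathcal V$ with $\Phi$-limits; that is, for every $\psi:\mathcal K^{op}\to\mathcal V$ in $\Phi$, the functor $\{\psi,-\}=[\mathcal K^{op},\mathcal V](\psi,-):[\mathcal K^{op},\mathcal V]\to\mathcal V$ preserves $\phi$-weighted colimits. - For a small $\Phi$-cocomplete $\mathcal N$, $\Phi\text{-}\mathbf{Conts}[\mathcal N^{op},\mathcal V]$ is the full subcategory of $[\mathcal N^{op},\mathcal V]$ given by the $\Phi$-continuous functors. **Theorem.** Let $\Phi$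 be a saturated and locally small class of weights. Then the following are equivalent: (i) $\Phi\text{-}\mathbf{Conts}[\mathcal N^{op},\mathcal V]=\Phi^+(\mathcal N)$ for every small $\Phi$-cocomplete category $\mathcal N$; (ii) for every small $\mathcal A$, every presheaf $\mathcal A^{op}\to\mathcal V$ is, in $[\mathcal A^{op},\mathcal V]$, a $\Phi^+$-colimit of a diagram in $\Phi(\mathcal A)$, that is, it is isomorphic to $\phi*S$ for some weight $\phi:\mathcal L^{op}\to\mathcal V$ in $\Phi^+$ and some $S:\mathcal L\to[\mathcal A^{op},\mathcal V]$ with values in $\Phi(\mathcal A)$; (iii) for every small $\mathcal A$, $\Phi^+\{\Phi(\mathcal A)\}=[\mathcal A^{op},\mathcal V]$. -/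

import Mathlib

open CategoryTheory MonoidalCategory Opposite Limits
open scoped CategoryTheory.MonoidalClosed

universe w u u₁ u₂ u₃

set_option linter.unusedSectionVars false

noncomputable section

namespace VCat

variable (V : Type u) [Category.{w} V] [MonoidalCategory V] [SymmetricCategory V]

/-- Two objects of a `V`-category are isomorphic if they are so in its underlying ordinary
category. -/
def AreIso {C : Type u₁} [EnrichedCategory V C] (x y : C) : Prop :=
  Nonempty (ForgetEnrichment.of V x ≅ ForgetEnrichment.of V y)

/-- A `V`-category is small if its isomorphism classes of objects form a small set, where "small"
refers to the universe `w` in which the hom-sets of `V` live. -/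
class IsSmall (C : Type u₁) [EnrichedCategory V C] : Prop where
  small_isoClasses : Small.{w} (Quotient (isIsomorphicSetoid (ForgetEnrichment V C)))

instance isSmall_op (C : Type u₁) [EnrichedCategory V C] [h : IsSmall V C] : IsSmall V Cᵒᵖ where
  small_isoClasses := by
    have := h.small_isoClasses
    let f : Quotient (isIsomorphicSetoid (ForgetEnrichment V Cᵒᵖ)) →
        Quotient (isIsomorphicSetoid (ForgetEnrichment V C)) :=
      Quotient.map' (fun x => ForgetEnrichment.of V (ForgetEnrichment.to V x).unop) (by
        rintro a b ⟨e⟩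
        exact ⟨(((forgetEnrichmentOppositeEquivalence V C).functor.mapIso e).unop).symm⟩)
    refine small_of_injective (f := f) ?_
    rintro ⟨a⟩ ⟨b⟩ h
    obtain ⟨e⟩ : Nonempty _ := Quotient.exact h
    exact Quotient.sound ⟨(forgetEnrichmentOppositeEquivalence V C).inverse.mapIso e.op.symm⟩

variable {V}

section Graded

variable {C : Type u₁} [EnrichedCategory V C] {D : Type u₂} [EnrichedCategory V D]

/-- A `V`-natural family `X ⟶ D(F c, G c)`, that is, a wedge with vertex `X` for the end
`∫_c D(F c, G c)`. For `X = 𝟙_ V` this is a `V`-natural transformation `F ⟶ G`. (It is the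
graded natural transformation of Mathlib for the half-braiding of `X` given by the symmetry.) -/
@[ext]
structure GradedTrans (X : V) (F G : EnrichedFunctor V C D) where
  app : ∀ c : C, X ⟶ (F.obj c ⟶[V] G.obj c)
  naturality : ∀ c d : C,
    (β_ X (c ⟶[V] d)).hom ≫ (F.map c d ⊗ₘ app d) ≫ eComp V _ _ _ =
      (app c ⊗ₘ G.map c d) ≫ eComp V _ _ _

/-- A universal `V`-natural family exhibits its vertex `H` as the end `∫_c D(F c, G c)`, that is,
as the object `[C, D](F, G)` of `V`-natural transformations. -/
def GradedTrans.IsUniversal {H : V} {F G : EnrichedFunctor V C D} (σ : GradedTrans H F G) : Prop :=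
  ∀ (X : V) (τ : GradedTrans X F G), ∃! f : X ⟶ H, ∀ c, f ≫ σ.app c = τ.app c

/-- Restriction of a `V`-natural family along a morphism of vertices. -/
def GradedTrans.precomp {X Y : V} {F G : EnrichedFunctor V C D} (f : Y ⟶ X)
    (σ : GradedTrans X F G) : GradedTrans Y F G where
  app c := f ≫ σ.app c
  naturality c d := by
    rw [← whiskerRight_comp_tensorHom_assoc, ← whiskerLeft_comp_tensorHom_assoc,
      ← BraidedCategory.braiding_naturality_left_assoc, σ.naturality c d]

/-- The identity transformation. -/
def GradedTrans.id (F : EnrichedFunctor V C D) : GradedTrans (𝟙_ V) F F where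
  app c := eId V (F.obj c)
  naturality c d := by
    have h1 : (F.map c d ⊗ₘ eId V (F.obj d)) ≫ eComp V _ _ _ = (ρ_ _).hom ≫ F.map c d := by
      rw [MonoidalCategory.tensorHom_def, Category.assoc, ← cancel_epi (ρ_ _).inv]
      have := e_comp_id V (F.obj c) (F.obj d)
      simp
    have h2 : (eId V (F.obj c) ⊗ₘ F.map c d) ≫ eComp V _ _ _ = (λ_ _).hom ≫ F.map c d := by
      rw [MonoidalCategory.tensorHom_def', Category.assoc, ← cancel_epi (λ_ _).inv]
      simp
    rw [h1, h2]
    simp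

theorem eComp_assoc3 {W X Y Z : D} {A B E : V} (f : A ⟶ (W ⟶[V] X)) (g : B ⟶ (X ⟶[V] Y))
    (h : E ⟶ (Y ⟶[V] Z)) :
    (α_ _ _ _).hom ≫ (f ⊗ₘ ((g ⊗ₘ h) ≫ eComp V _ _ _)) ≫ eComp V _ _ _ =
      (((f ⊗ₘ g) ≫ eComp V _ _ _) ⊗ₘ h) ≫ eComp V _ _ _ := by
  rw [← tensorHom_comp_whiskerRight, ← tensorHom_comp_whiskerLeft,
    Category.assoc, Category.assoc, ← e_assoc', associator_naturality_assoc]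

/-- The composite of `V`-natural families. -/
def GradedTrans.comp {X Y : V} {F G H : EnrichedFunctor V C D} (σ : GradedTrans X F G)
    (τ : GradedTrans Y G H) : GradedTrans (X ⊗ Y) F H where
  app c := (σ.app c ⊗ₘ τ.app c) ≫ eComp V _ _ _
  naturality c d := by
    have h1 := σ.naturality c d
    have h2 := τ.naturality c d
    rw [← cancel_epi (α_ X Y _).inv]
    calc _ = (α_ X Y _).inv ≫ (β_ (X ⊗ Y) (c ⟶[V] d)).hom ≫ (α_ _ _ _).inv ≫
            (((F.map c d ⊗ₘ σ.app d) ≫ eComp V _ _ _) ⊗ₘ τ.app d) ≫ eComp V _ _ _ := by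
          rw [← eComp_assoc3]; simp
      _ = X ◁ (β_ Y _).hom ≫ (α_ _ _ _).inv ≫
            (((β_ _ _).hom ≫ (F.map c d ⊗ₘ σ.app d) ≫ eComp V _ _ _) ⊗ₘ τ.app d) ≫
              eComp V _ _ _ := by
          rw [← whiskerRight_comp_tensorHom (β_ X (c ⟶[V] d)).hom]; simp
      _ = X ◁ (β_ Y _).hom ≫ (σ.app c ⊗ₘ ((G.map c d ⊗ₘ τ.app d) ≫ eComp V _ _ _)) ≫
            eComp V _ _ _ := by
          rw [h1, ← eComp_assoc3]; simp
      _ = (σ.app c ⊗ₘ ((β_ Y _).hom ≫ (G.map c d ⊗ₘ τ.app d) ≫ eComp V _ _ _)) ≫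
            eComp V _ _ _ := by
          rw [← whiskerLeft_comp_tensorHom _ (β_ Y (c ⟶[V] d)).hom]; simp
      _ = _ := by
          rw [h2, ← eComp_assoc3]; simp

end Graded

section Existence

/- The object `[C, D](F, G)` exists when `C` is small and `V` is complete. -/

variable {C : Type u₁} [Category.{w} C] [EnrichedOrdinaryCategory V C]
  {D : Type u₂} [Category.{w} D] [EnrichedOrdinaryCategory V D]

/-- The action of a `V`-functor on the morphisms of the underlying categories. -/
def mapHom (F : EnrichedFunctor V C D) {x y : C} (f : x ⟶ y) : F.obj x ⟶ F.obj y :=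
  (eHomEquiv V).symm (eHomEquiv V f ≫ F.map x y)

theorem map_whiskerRight (F : EnrichedFunctor V C D) {x x' : C} (f : x ⟶ x') (y : C) :
    eHomWhiskerRight V f y ≫ F.map x y =
      F.map x' y ≫ eHomWhiskerRight V (mapHom F f) (F.obj y) := by
  simp only [eHomWhiskerRight, mapHom, Category.assoc, EnrichedFunctor.map_comp,
    Equiv.apply_symm_apply, MonoidalCategory.tensorHom_def', comp_whiskerRight]
  rw [leftUnitor_inv_naturality_assoc, whisker_exchange_assoc, ← whisker_exchange_assoc (F.map x x'),
    whisker_exchange_assoc (eHomEquiv V f)]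

theorem map_whiskerLeft (F : EnrichedFunctor V C D) {y y' : C} (x : C) (f : y ⟶ y') :
    eHomWhiskerLeft V x f ≫ F.map x y' =
      F.map x y ≫ eHomWhiskerLeft V (F.obj x) (mapHom F f) := by
  simp only [eHomWhiskerLeft, mapHom, Category.assoc, EnrichedFunctor.map_comp,
    Equiv.apply_symm_apply, MonoidalCategory.tensorHom_def, MonoidalCategory.whiskerLeft_comp]
  rw [rightUnitor_inv_naturality_assoc, ← whisker_exchange_assoc, whisker_exchange_assoc (F.map x y),
    ← whisker_exchange_assoc (F.map x y) (eHomEquiv V f)]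

/-- The action of a `V`-functor on the isomorphisms of the underlying categories. -/
def mapIsoOf (F : EnrichedFunctor V C D) {x y : C} (e : x ≅ y) : F.obj x ≅ F.obj y where
  hom := mapHom F e.hom
  inv := mapHom F e.inv
  hom_inv_id := by
    apply (eHomEquiv V).injective
    have h := congrArg (eHomEquiv V) e.hom_inv_id
    rw [eHomEquiv_comp] at h ⊢
    have h' := congrArg (· ≫ F.map x x) h
    simpa [mapHom] using h'
  inv_hom_id := by
    apply (eHomEquiv V).injective
    have h := congrArg (eHomEquiv V) e.inv_hom_id
    rw [eHomEquiv_comp] at h ⊢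
    have h' := congrArg (· ≫ F.map y y) h
    simpa [mapHom] using h'

/-- Conjugation of hom-objects by isomorphisms. -/
def conj {x x' y y' : D} (e : x ≅ x') (f : y ≅ y') : (x ⟶[V] y) ⟶ (x' ⟶[V] y') :=
  eHomWhiskerRight V e.inv y ≫ eHomWhiskerLeft V x' f.hom

theorem conj_symm {x x' y y' : D} (e : x ≅ x') (f : y ≅ y') :
    conj (V := V) e f ≫ conj e.symm f.symm = 𝟙 _ := by
  simp only [conj, Category.assoc, Iso.symm_hom, Iso.symm_inv]
  rw [eHom_whisker_exchange_assoc, ← eHomWhiskerRight_comp_assoc, ← eHomWhiskerLeft_comp]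
  simp

theorem conj_comp {x x' y y' z z' : D} (e : x ≅ x') (f : y ≅ y') (g : z ≅ z') :
    (conj (V := V) e f ⊗ₘ conj (V := V) f g) ≫ eComp V _ _ _ = eComp V _ _ _ ≫ conj e g := by
  rw [MonoidalCategory.tensorHom_def]
  simp only [conj, comp_whiskerRight, MonoidalCategory.whiskerLeft_comp, Category.assoc]
  rw [← eComp_eHomWhiskerLeft, eHom_whisker_cancel_assoc, ← eComp_eHomWhiskerRight_assoc]

theorem map_conj (F : EnrichedFunctor V C D) {x x' y y' : C} (e : x ≅ x') (f : y ≅ y') :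
    conj (V := V) e f ≫ F.map x' y' = F.map x y ≫ conj (mapIsoOf F e) (mapIsoOf F f) := by
  simp [conj, map_whiskerLeft, mapIsoOf, reassoc_of% (map_whiskerRight F e.inv y)]

theorem conj_of_natural {X : V} {F G : EnrichedFunctor V C D} {x y : C}
    (a : X ⟶ (F.obj x ⟶[V] G.obj x)) (b : X ⟶ (F.obj y ⟶[V] G.obj y))
    (h : (β_ X (x ⟶[V] y)).hom ≫ (F.map x y ⊗ₘ b) ≫ eComp V _ _ _ =
      (a ⊗ₘ G.map x y) ≫ eComp V _ _ _) (e : x ≅ y) :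
    a ≫ conj (mapIsoOf F e) (mapIsoOf G e) = b := by
  have h' : (ρ_ X).inv ≫ (X ◁ (eHomEquiv V e.hom)) ≫
      (β_ X (x ⟶[V] y)).hom ≫ (F.map x y ⊗ₘ b) ≫ eComp V _ _ _ =
      (ρ_ X).inv ≫ (X ◁ (eHomEquiv V e.hom)) ≫ (a ⊗ₘ G.map x y) ≫ eComp V _ _ _ := by
    rw [h]
  have h2 : b ≫ eHomWhiskerRight V (mapHom F e.hom) _ =
      a ≫ eHomWhiskerLeft V _ (mapHom G e.hom) := by
    convert h' using 1
    · rw [BraidedCategory.braiding_naturality_right_assoc]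
      simp only [eHomWhiskerRight, mapHom, MonoidalCategory.tensorHom_def', Category.assoc,
        Equiv.apply_symm_apply, comp_whiskerRight, leftUnitor_inv_naturality_assoc]
      rw [← whisker_exchange_assoc (eHomEquiv V e.hom)]
      simp
    · simp only [eHomWhiskerLeft, mapHom, MonoidalCategory.tensorHom_def, Category.assoc,
        Equiv.apply_symm_apply, MonoidalCategory.whiskerLeft_comp,
        rightUnitor_inv_naturality_assoc]
      rw [whisker_exchange_assoc a]
  have h3 := congrArg (· ≫ eHomWhiskerRight V (mapHom F e.inv) _) h2
  simp only [Category.assoc, ← eHomWhiskerRight_comp] at h3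
  rw [show mapHom F e.inv ≫ mapHom F e.hom = 𝟙 _ from (mapIsoOf F e).inv_hom_id] at h3
  simpa [conj, mapIsoOf, eHom_whisker_exchange] using h3.symm

theorem map_eq_conj (F : EnrichedFunctor V C D) {x x' y y' : C} (e : x ≅ x') (f : y ≅ y') :
    F.map x y = (conj (V := V) e f ≫ F.map x' y') ≫
      conj (mapIsoOf F e.symm) (mapIsoOf F f.symm) := by
  rw [Category.assoc, ← map_conj, reassoc_of% (conj_symm (V := V) e f)]

theorem exists_isUniversal_aux [MonoidalClosed V] [HasLimitsOfSize.{w, w} V] {ι : Type w}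
    (r : ι → C) (i : C → ι) (e : ∀ c, c ≅ r (i c)) (F G : EnrichedFunctor V C D) :
    ∃ (H : V) (σ : GradedTrans H F G), σ.IsUniversal := by
  let P : V := ∏ᶜ fun j => F.obj (r j) ⟶[V] G.obj (r j)
  let p (j : ι) : P ⟶ (F.obj (r j) ⟶[V] G.obj (r j)) := Pi.π _ j
  let Q : ι × ι → V := fun q =>
    (ihom (r q.1 ⟶[V] r q.2)).obj (F.obj (r q.1) ⟶[V] G.obj (r q.2))
  let a : P ⟶ ∏ᶜ Q := Pi.lift fun q =>
    MonoidalClosed.curry ((F.map (r q.1) (r q.2) ⊗ₘ p q.2) ≫ eComp V _ _ _)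
  let b : P ⟶ ∏ᶜ Q := Pi.lift fun q =>
    MonoidalClosed.curry ((β_ _ _).hom ≫ (p q.1 ⊗ₘ G.map (r q.1) (r q.2)) ≫ eComp V _ _ _)
  have key {X : V} (f : X ⟶ P) : f ≫ a = f ≫ b ↔ ∀ j k,
      (β_ X (r j ⟶[V] r k)).hom ≫ (F.map (r j) (r k) ⊗ₘ (f ≫ p k)) ≫ eComp V _ _ _ =
      ((f ≫ p j) ⊗ₘ G.map (r j) (r k)) ≫ eComp V _ _ _ := by
    have h1 (q : ι × ι) : (f ≫ a) ≫ Pi.π Q q = (f ≫ b) ≫ Pi.π Q q ↔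
        (β_ X (r q.1 ⟶[V] r q.2)).hom ≫ (F.map (r q.1) (r q.2) ⊗ₘ (f ≫ p q.2)) ≫ eComp V _ _ _ =
        ((f ≫ p q.1) ⊗ₘ G.map (r q.1) (r q.2)) ≫ eComp V _ _ _ := by
      simp only [a, b, Category.assoc, Limits.Pi.lift_π]
      rw [← MonoidalClosed.curry_natural_left, ← MonoidalClosed.curry_natural_left,
        MonoidalClosed.curry_injective.eq_iff, ← cancel_epi (β_ X (r q.1 ⟶[V] r q.2)).hom,
        whiskerLeft_comp_tensorHom_assoc, BraidedCategory.braiding_naturality_right_assoc,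
        SymmetricCategory.symmetry_assoc, whiskerRight_comp_tensorHom_assoc]
    constructor
    · intro h j k
      exact (h1 (j, k)).1 (by rw [h])
    · intro h
      refine Limits.Pi.hom_ext _ _ fun q => (h1 q).2 (h q.1 q.2)
  let H := equalizer a b
  let s : H ⟶ P := equalizer.ι a b
  have hs := (key s).1 (equalizer.condition a b)
  let σ : GradedTrans H F G :=
    { app c := (s ≫ p (i c)) ≫ conj (mapIsoOf F (e c).symm) (mapIsoOf G (e c).symm)
      naturality c d := by
        have h := hs (i c) (i d)
        generalize s ≫ p (i c) = x at h ⊢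
        generalize s ≫ p (i d) = y at h ⊢
        rw [map_eq_conj F (e c) (e d), map_eq_conj G (e c) (e d),
          ← tensorHom_comp_tensorHom_assoc, conj_comp, ← tensorHom_comp_tensorHom_assoc,
          conj_comp, ← whiskerRight_comp_tensorHom_assoc, ← whiskerLeft_comp_tensorHom_assoc,
          ← BraidedCategory.braiding_naturality_right_assoc, reassoc_of% h] }
  have hσ (j : ι) : σ.app (r j) = s ≫ p j :=
    conj_of_natural _ _ (hs _ _) (e (r j)).symm
  refine ⟨H, σ, fun X τ => ?_⟩
  have ht : Limits.Pi.lift (fun j => τ.app (r j)) ≫ a = Limits.Pi.lift (fun j => τ.app (r j)) ≫ b := by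
    rw [key]
    intro j k
    simpa [p] using τ.naturality (r j) (r k)
  refine ⟨equalizer.lift _ ht, fun c => ?_, fun f hf => ?_⟩
  · rw [← conj_of_natural _ _ (τ.naturality _ _) (e c).symm]
    simp [σ, s, p]
  · refine equalizer.hom_ext (Limits.Pi.hom_ext _ _ fun j => ?_)
    have := hf (r j)
    rw [hσ] at this
    simpa [s, p] using this

end Existence

section
variable {C : Type u₁} [EnrichedCategory V C] {D : Type u₂} [EnrichedCategory V D]

theorem exists_isUniversal [MonoidalClosed V] [HasLimitsOfSize.{w, w} V] [hC : IsSmall V C]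
    (F G : EnrichedFunctor V C D) :
    ∃ (H : V) (σ : GradedTrans H F G), σ.IsUniversal := by
  have := hC.small_isoClasses
  let π : ForgetEnrichment V C → Quotient (isIsomorphicSetoid (ForgetEnrichment V C)) :=
    Quotient.mk _
  have hr := fun c => Quotient.exact (Quotient.out_eq (π c)).symm
  exact exists_isUniversal_aux (C := ForgetEnrichment V C) (D := ForgetEnrichment V D) (V := V)
    (fun j => ((equivShrink.{w} _).symm j).out)
    (fun c => equivShrink.{w} _ (π c)) (fun c => by
      rw [Equiv.symm_apply_apply]; exact (hr c).some) F G

end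

section FunctorCategory
variable [MonoidalClosed V] [HasLimitsOfSize.{w, w} V]
variable {C : Type u₁} [EnrichedCategory V C] [IsSmall V C] {D : Type u₂} [EnrichedCategory V D]

/-- The object `[C, D](F, G)` of `V`-natural transformations, for a small `C`. -/
def natHom (F G : EnrichedFunctor V C D) : V := (exists_isUniversal F G).choose

/-- The universal `V`-natural family `[C, D](F, G) ⟶ D(F c, G c)`. -/
def natHomProj (F G : EnrichedFunctor V C D) : GradedTrans (natHom F G) F G :=
  (exists_isUniversal F G).choose_spec.choose

theorem natHomProj_isUniversal (F G : EnrichedFunctor V C D) : (natHomProj F G).IsUniversal :=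
  (exists_isUniversal F G).choose_spec.choose_spec

/-- The morphism into `[C, D](F, G)` that corresponds to a `V`-natural family. -/
def natHomLift {X : V} {F G : EnrichedFunctor V C D} (τ : GradedTrans X F G) : X ⟶ natHom F G :=
  (natHomProj_isUniversal F G X τ).choose

@[simp]
theorem natHomLift_app {X : V} {F G : EnrichedFunctor V C D} (τ : GradedTrans X F G) (c : C) :
    natHomLift τ ≫ (natHomProj F G).app c = τ.app c :=
  (natHomProj_isUniversal F G X τ).choose_spec.1 c

theorem natHom_ext {X : V} {F G : EnrichedFunctor V C D} {f g : X ⟶ natHom F G}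
    (h : ∀ c, f ≫ (natHomProj F G).app c = g ≫ (natHomProj F G).app c) : f = g :=
  (natHomProj_isUniversal F G X ((natHomProj F G).precomp g)).unique h (fun _ => rfl)

/-- The functor `V`-category `[C, D]`, for a small `C`. -/
instance functorCategory : EnrichedCategory V (EnrichedFunctor V C D) where
  Hom F G := natHom F G
  id F := natHomLift (GradedTrans.id F)
  comp F G H := natHomLift ((natHomProj F G).comp (natHomProj G H))
  id_comp F G := natHom_ext fun c => by
    simp only [Category.assoc, natHomLift_app, GradedTrans.comp, Category.id_comp]
    rw [whiskerRight_comp_tensorHom_assoc, natHomLift_app, MonoidalCategory.tensorHom_def']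
    simp [GradedTrans.id]
  comp_id F G := natHom_ext fun c => by
    simp only [Category.assoc, natHomLift_app, GradedTrans.comp, Category.id_comp]
    rw [whiskerLeft_comp_tensorHom_assoc, natHomLift_app, MonoidalCategory.tensorHom_def]
    simp [GradedTrans.id]
  assoc F G H K := natHom_ext fun c => by
    simp only [Category.assoc, natHomLift_app, GradedTrans.comp]
    rw [whiskerRight_comp_tensorHom_assoc, whiskerLeft_comp_tensorHom_assoc, natHomLift_app,
      natHomLift_app, ← cancel_epi (α_ _ _ _).hom, Iso.hom_inv_id_assoc]
    exact (eComp_assoc3 _ _ _).symm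

end FunctorCategory

section FullSubcategory

variable {C : Type u₁} [EnrichedCategory V C]

/-- The full subcategory of a `V`-category given by a class of objects. -/
def FullSub (P : C → Prop) : Type u₁ := {c : C // P c}

instance fullSubCategory (P : C → Prop) : EnrichedCategory V (FullSub P) where
  Hom x y := x.1 ⟶[V] y.1
  id x := eId V x.1
  comp x y z := eComp V x.1 y.1 z.1
  id_comp x y := e_id_comp V x.1 y.1
  comp_id x y := e_comp_id V x.1 y.1
  assoc x y z t := e_assoc V x.1 y.1 z.1 t.1

end FullSubcategory

section Representables

variable {C : Type u₁} [EnrichedCategory V C] {D : Type u₂} [EnrichedCategory V D]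

/-- The opposite `Cᵒᵖ ⟶ Dᵒᵖ` of a `V`-functor `C ⟶ D`. -/
def opFunctor (F : EnrichedFunctor V C D) : EnrichedFunctor V Cᵒᵖ Dᵒᵖ where
  obj x := op (F.obj x.unop)
  map x y := F.map y.unop x.unop
  map_id x := F.map_id x.unop
  map_comp x y z := by
    rw [tensorHom_eComp_op_eq, eComp_op_eq, Category.assoc]
    exact congrArg _ (F.map_comp _ _ _)

variable [MonoidalClosed V]

theorem curry_tensor_comp {A B E Y Z : V} (f : A ⊗ Y ⟶ B) (g : B ⊗ Z ⟶ E) :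
    (MonoidalClosed.curry f ⊗ₘ MonoidalClosed.curry g) ≫ MonoidalClosed.comp A B E =
      MonoidalClosed.curry ((α_ A Y Z).inv ≫ f ▷ Z ≫ g) := by
  have key {P Q : V} (f' : Y ⟶ P) (g' : Z ⟶ Q) (e₁ : A ⊗ P ⟶ B) (e₂ : B ⊗ Q ⟶ E)
      (h₁ : A ◁ f' ≫ e₁ = f) (h₂ : B ◁ g' ≫ e₂ = g) :
      A ◁ (f' ⊗ₘ g') ≫ (α_ A P Q).inv ≫ e₁ ▷ Q ≫ e₂ = (α_ A Y Z).inv ≫ f ▷ Z ≫ g := by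
    subst h₁ h₂
    rw [MonoidalCategory.tensorHom_def, MonoidalCategory.whiskerLeft_comp, Category.assoc,
      associator_inv_naturality_right_assoc, whisker_exchange_assoc,
      associator_inv_naturality_middle_assoc, comp_whiskerRight_assoc]
  rw [MonoidalClosed.comp_eq, ← MonoidalClosed.curry_natural_left]
  exact congrArg MonoidalClosed.curry
    (key _ _ _ _ (MonoidalClosed.whiskerLeft_curry_ihom_ev_app A B f)
      (MonoidalClosed.whiskerLeft_curry_ihom_ev_app B E g))

/-- The representable `V`-functor `C(a, -) : C ⟶ V`. -/
def homFrom (a : C) : EnrichedFunctor V C V where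
  obj x := a ⟶[V] x
  map x y := MonoidalClosed.curry (eComp V a x y)
  map_id x := by
    rw [← MonoidalClosed.curry_natural_left]
    refine congrArg MonoidalClosed.curry ?_
    rw [← cancel_epi (ρ_ (a ⟶[V] x)).inv, e_comp_id, Iso.inv_hom_id]
  map_comp x y z := by
    rw [← MonoidalClosed.curry_natural_left, ← e_assoc]
    exact (curry_tensor_comp _ _).symm

/-- The representable `V`-functor `C(-, a) : Cᵒᵖ ⟶ V`; on objects it is `x ↦ C(x, a)`. -/
def homTo (a : C) : EnrichedFunctor V Cᵒᵖ V := homFrom (op a)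

/-- `V`-naturality of a family of morphisms `F c ⟶ G c` of `V` between `V`-valued functors. -/
def IsVNatural (F G : EnrichedFunctor V C V) (α : ∀ c, F.obj c ⟶ G.obj c) : Prop :=
  ∀ c d : C, F.map c d ≫ (ihom (F.obj c)).map (α d) =
    G.map c d ≫ (MonoidalClosed.pre (α c)).app (G.obj d)

end Representables

section WeightedLimits

variable [MonoidalClosed V]
variable {J : Type u₁} [EnrichedCategory V J] {C : Type u₂} [EnrichedCategory V C]
  {D : Type u₃} [EnrichedCategory V D]

/-- The object `l`, with the `V`-natural counit `μ : φ ⟶ C(l, T-)`, is the limit `{φ, T}` of `T`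
weighted by `φ`: for each `a`, the family `C(a, l) ⟶ [φ j, C(a, T j)]` induced by `μ` exhibits
`C(a, l)` as the object `[J, V](φ, C(a, T-))` of `V`-natural transformations. -/
structure IsWeightedLimit (φ : EnrichedFunctor V J V) (T : EnrichedFunctor V J C) (l : C)
    (μ : ∀ j : J, φ.obj j ⟶ (l ⟶[V] T.obj j)) : Prop where
  natural : IsVNatural φ (T.comp V (homFrom l)) μ
  universal : ∀ (a : C) (X : V) (τ : GradedTrans X φ (T.comp V (homFrom a))),
    ∃! f : X ⟶ (a ⟶[V] l), ∀ j : J,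
      f ≫ MonoidalClosed.curry ((β_ _ _).hom ≫ (a ⟶[V] l) ◁ μ j ≫ eComp V a l (T.obj j)) =
        τ.app j

/-- The object `c`, with the `V`-natural unit `η : φ ⟶ C(S-, c)`, is the colimit `φ * S` of `S`
weighted by `φ`: for each `a`, the family `C(c, a) ⟶ [φ k, C(S k, a)]` induced by `η` exhibits
`C(c, a)` as the object `[Kᵒᵖ, V](φ, C(S-, a))` of `V`-natural transformations. -/
structure IsWeightedColimit {K : Type u₁} [EnrichedCategory V K] (φ : EnrichedFunctor V Kᵒᵖ V)
    (S : EnrichedFunctor V K C) (c : C)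
    (η : ∀ k : Kᵒᵖ, φ.obj k ⟶ (S.obj k.unop ⟶[V] c)) : Prop where
  natural : IsVNatural φ ((opFunctor S).comp V (homTo c)) η
  universal : ∀ (a : C) (X : V) (τ : GradedTrans X φ ((opFunctor S).comp V (homTo a))),
    ∃! f : X ⟶ (c ⟶[V] a), ∀ k : Kᵒᵖ,
      f ≫ MonoidalClosed.curry (η k ▷ (c ⟶[V] a) ≫ eComp V (S.obj k.unop) c a) = τ.app k

/-- `F` preserves the `φ`-weighted limit of `T`. -/
def PreservesWeightedLimit (F : EnrichedFunctor V C D) (φ : EnrichedFunctor V J V)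
    (T : EnrichedFunctor V J C) : Prop :=
  ∀ (l : C) (μ : ∀ j : J, φ.obj j ⟶ (l ⟶[V] T.obj j)), IsWeightedLimit φ T l μ →
    IsWeightedLimit φ (T.comp V F) (F.obj l) (fun j => μ j ≫ F.map l (T.obj j))

/-- `F` preserves the `φ`-weighted colimit of `S`. -/
def PreservesWeightedColimit {K : Type u₁} [EnrichedCategory V K] (F : EnrichedFunctor V C D)
    (φ : EnrichedFunctor V Kᵒᵖ V) (S : EnrichedFunctor V K C) : Prop :=
  ∀ (c : C) (η : ∀ k : Kᵒᵖ, φ.obj k ⟶ (S.obj k.unop ⟶[V] c)), IsWeightedColimit φ S c η →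
    IsWeightedColimit φ (S.comp V F) (F.obj c) (fun k => η k ≫ F.map (S.obj k.unop) c)

end WeightedLimits

section Classes

variable [MonoidalClosed V]

variable (V) in
/-- A class of weights: a collection of `V`-functors `Kᵒᵖ ⟶ V` with small `K`. The objects of `K`
may lie in any universe that is large enough to contain the presheaf `V`-categories. -/
def WeightClass := ∀ (K : Type (max u w)) [EnrichedCategory V K] [IsSmall V K],
  EnrichedFunctor V Kᵒᵖ V → Prop

namespace WeightClass

variable (Φ : WeightClass V)
variable {C : Type u₁} [EnrichedCategory V C] {D : Type u₂} [EnrichedCategory V D]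

variable (C) in
/-- `C` is `Φ`-complete. -/
def IsComplete : Prop :=
  ∀ (K : Type (max u w)) [EnrichedCategory V K] [IsSmall V K] (φ : EnrichedFunctor V Kᵒᵖ V),
    Φ K φ → ∀ T : EnrichedFunctor V Kᵒᵖ C, ∃ l μ, IsWeightedLimit φ T l μ

variable (C) in
/-- `C` is `Φ`-cocomplete. -/
def IsCocomplete : Prop :=
  ∀ (K : Type (max u w)) [EnrichedCategory V K] [IsSmall V K] (φ : EnrichedFunctor V Kᵒᵖ V),
    Φ K φ → ∀ S : EnrichedFunctor V K C, ∃ c η, IsWeightedColimit φ S c η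

/-- `F` is `Φ`-continuous: it preserves all `Φ`-limits. -/
def IsContinuous (F : EnrichedFunctor V C D) : Prop :=
  ∀ (K : Type (max u w)) [EnrichedCategory V K] [IsSmall V K] (φ : EnrichedFunctor V Kᵒᵖ V),
    Φ K φ → ∀ T : EnrichedFunctor V Kᵒᵖ C, PreservesWeightedLimit F φ T

/-- The saturation of `Φ`: the weight `ψ` lies in it if every `Φ`-complete category is
`ψ`-complete, and every `Φ`-continuous functor between `Φ`-complete categories is
`ψ`-continuous. -/
def saturation : WeightClass V := fun K _ _ ψ =>
  (∀ (C : Type (max u w)) [EnrichedCategory V C], Φ.IsComplete C →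
    ∀ T : EnrichedFunctor V Kᵒᵖ C, ∃ l μ, IsWeightedLimit ψ T l μ) ∧
  (∀ (C D : Type (max u w)) [EnrichedCategory V C] [EnrichedCategory V D],
    Φ.IsComplete C → Φ.IsComplete D → ∀ F : EnrichedFunctor V C D, Φ.IsContinuous F →
      ∀ T : EnrichedFunctor V Kᵒᵖ C, PreservesWeightedLimit F ψ T)

/-- `Φ` is saturated: it is equal to its saturation. -/
def IsSaturated : Prop :=
  ∀ (K : Type (max u w)) [EnrichedCategory V K] [IsSmall V K] (ψ : EnrichedFunctor V Kᵒᵖ V),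
    Φ.saturation K ψ ↔ Φ K ψ

/-- The closure `Φ{P}` of a class `P` of objects of `C` under `Φ`-colimits: the smallest replete
class of objects that contains `P` and is closed under `Φ`-colimits in `C`. -/
inductive Closure (P : C → Prop) : C → Prop
  | of {c : C} (hc : P c) : Closure P c
  | iso {c d : C} (e : AreIso V c d) (hc : Closure P c) : Closure P d
  | colimit (K : Type (max u w)) [EnrichedCategory V K] [IsSmall V K]
      (φ : EnrichedFunctor V Kᵒᵖ V) (hφ : Φ K φ) (S : EnrichedFunctor V K C)
      (hS : ∀ k, Closure P (S.obj k)) {c : C}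
      (η : ∀ k : Kᵒᵖ, φ.obj k ⟶ (S.obj k.unop ⟶[V] c)) (hc : IsWeightedColimit φ S c η) :
      Closure P c

variable [HasLimits V]

/-- `Φ(A)`, for a small `A`: the closure of the representables in the presheaf category `[Aᵒᵖ, V]`
under `Φ`-colimits. -/
def Free (A : Type (max u w)) [EnrichedCategory V A] [IsSmall V A] :
    EnrichedFunctor V Aᵒᵖ V → Prop :=
  Φ.Closure (fun F => ∃ a : A, F = homTo a)

/-- `Φ` is locally small: for each small `A`, the full subcategory `Φ(A)` of `[Aᵒᵖ, V]` is
small. -/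
def IsLocallySmall : Prop :=
  ∀ (A : Type (max u w)) [EnrichedCategory V A] [IsSmall V A], IsSmall V (FullSub (Φ.Free A))

/-- `φ`-colimits commute with `ψ`-limits in `V`: the functor `{ψ, -} = [Kᵒᵖ, V](ψ, -)` from
`[Kᵒᵖ, V]` to `V` preserves all `φ`-weighted colimits. -/
def _root_.VCat.ColimitsCommuteWithLimits {L K : Type (max u w)} [EnrichedCategory V L] [EnrichedCategory V K]
    [IsSmall V K] (φ : EnrichedFunctor V Lᵒᵖ V) (ψ : EnrichedFunctor V Kᵒᵖ V) : Prop :=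
  ∀ S : EnrichedFunctor V L (EnrichedFunctor V Kᵒᵖ V),
    PreservesWeightedColimit (homFrom (V := V) ψ) φ S

/-- The class `Φ⁺` of the `Φ`-flat weights: those `φ` such that `φ`-colimits commute with
`Φ`-limits in `V`. -/
def flat : WeightClass V := fun _ _ _ φ =>
  ∀ (K : Type (max u w)) [EnrichedCategory V K] [IsSmall V K] (ψ : EnrichedFunctor V Kᵒᵖ V),
    Φ K ψ → ColimitsCommuteWithLimits φ ψ

end WeightClass

end Classes

end VCat

end

open VCat (WeightClass IsSmall IsWeightedColimit)

noncomputable section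

namespace VCat

variable {V : Type u} [Category.{w} V] [MonoidalCategory V] [SymmetricCategory V]

/-! ### `V`-valued functors as right modules, and graded families between them. -/

section Modules

variable [MonoidalClosed V] {J : Type u₁} [EnrichedCategory V J]
  {C : Type u₂} [EnrichedCategory V C] {D : Type u₃} [EnrichedCategory V D]

/-! Three general facts carry the proof.

Iterated limits: `{χ * S, T} ≅ {χ, {S-, T}}` (`isWeightedLimit_of_iterated`). Fix a functor `F`. The
weights whose limits exist in the domain of `F` and are preserved by `F` therefore include the
representables and are closed under colimits weighted by such weights. Induction over the closure
(`hasPreserves_of_free`) shows that a saturated `Φ` contains `Φ(K)` (`IsSaturated.of_free`). Applied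
to the opposite of `{ψ, -}`, the same induction shows that every weight in `Φ⁺(N)` is flat
(`flat_of_free`).

Flat presheaves are continuous: by the co-Yoneda formula, `F ∘ Sᵒᵖ` is the `F`-weighted colimit of
`n ↦ N(S-, n)`. If `F` is flat, `ψ` lies in `Φ` and `ψ * S` exists, then `{ψ, F ∘ Sᵒᵖ} ≅ F * {ψ,
N(S-, ·)} ≅ F * N(ψ * S, ·) ≅ F (ψ * S)` (`preservesWeightedLimit_of_nerve`).

Density: if `W` is the inclusion of a full subcategory of presheaves containing the representables,
every presheaf `F` is the colimit of `W` weighted by `[Aᵒᵖ, V](W-, F)`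
(`isWeightedColimit_density`).

(i) ⇒ (ii): take `N = Φ(A)`, which is small by local smallness and `Φ`-cocomplete because it is
closed under `Φ`-colimits of presheaves. The weight `[Aᵒᵖ, V](W-, F)` is `Φ`-continuous, since `W`
preserves `Φ`-colimits. By (i) it lies in `Φ⁺(N)`, so it is flat, and density presents `F` as
required.

(ii) ⇒ (iii) is one step of the closure.

(iii) ⇒ (i): members of `Φ⁺(N)` are flat, hence continuous. Conversely, every member of `Φ⁺{Φ(N)}`
has a reflection into the `Φ`-continuous presheaves, and this reflection lies in `Φ⁺(N)`. For `ψ` in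
`Φ(N)`, saturation puts `ψ` in `Φ`, so `c = ψ * id` exists in `N`, and `[ψ, F] ≅ {ψ, F} ≅ F c ≅
[N(-, c), F]` for continuous `F`: the reflection is `N(-, c)`. For a flat colimit, the same colimit
of the reflections again lies in `Φ⁺(N)`, so it is already continuous and is the reflection. A
continuous presheaf is its own reflection, so by (iii) it lies in `Φ⁺(N)`. -/

theorem uncurry_tensor_comp {A B E Y Z : V} (f : Y ⟶ (ihom A).obj B) (g : Z ⟶ (ihom B).obj E) :
    MonoidalClosed.uncurry ((f ⊗ₘ g) ≫ eComp V A B E) =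
      (α_ A Y Z).inv ≫ MonoidalClosed.uncurry f ▷ Z ≫ MonoidalClosed.uncurry g := by
  have h := curry_tensor_comp (MonoidalClosed.uncurry f) (MonoidalClosed.uncurry g)
  rw [MonoidalClosed.curry_uncurry, MonoidalClosed.curry_uncurry] at h
  rw [← MonoidalClosed.uncurry_curry ((α_ A Y Z).inv ≫ _), ← h]
  rfl

/-- The right action `F j ⊗ J(j, k) ⟶ F k` on the values of a `V`-valued functor. -/
def act (F : EnrichedFunctor V J V) (j k : J) : F.obj j ⊗ (j ⟶[V] k) ⟶ F.obj k :=
  MonoidalClosed.uncurry (F.map j k)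

theorem act_id (F : EnrichedFunctor V J V) (j : J) :
    F.obj j ◁ eId V j ≫ act F j j = (ρ_ _).hom := by
  have h := congrArg MonoidalClosed.uncurry (F.map_id j)
  rw [MonoidalClosed.uncurry_natural_left] at h
  refine h.trans ?_
  exact MonoidalClosed.uncurry_curry _

theorem act_comp (F : EnrichedFunctor V J V) (i j k : J) :
    (α_ _ _ _).hom ≫ F.obj i ◁ eComp V i j k ≫ act F i k = act F i j ▷ _ ≫ act F j k := by
  have h := congrArg MonoidalClosed.uncurry (F.map_comp i j k)
  rw [MonoidalClosed.uncurry_natural_left, uncurry_tensor_comp] at h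
  rw [act, h, Iso.hom_inv_id_assoc]
  rfl

/-- Associativity of the action in terms of generalised elements, the form in which it is rewritten
later. -/
theorem act_act (F : EnrichedFunctor V J V) {i j k : J} {A B E : V} (x : A ⟶ F.obj i)
    (f : B ⟶ (i ⟶[V] j)) (g : E ⟶ (j ⟶[V] k)) :
    (α_ _ _ _).hom ≫ (x ⊗ₘ ((f ⊗ₘ g) ≫ eComp V _ _ _)) ≫ act F i k =
      (((x ⊗ₘ f) ≫ act F i j) ⊗ₘ g) ≫ act F j k := by
  rw [← tensorHom_comp_whiskerRight, ← tensorHom_comp_whiskerLeft,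
    Category.assoc, Category.assoc, ← act_comp, associator_naturality_assoc]

/-- A `V`-valued functor from its right action. -/
def ofAct (F : J → V) (a : ∀ j k, F j ⊗ (j ⟶[V] k) ⟶ F k)
    (h₁ : ∀ j, F j ◁ eId V j ≫ a j j = (ρ_ _).hom)
    (h₂ : ∀ i j k, (α_ _ _ _).hom ≫ F i ◁ eComp V i j k ≫ a i k = a i j ▷ _ ≫ a j k) :
    EnrichedFunctor V J V where
  obj := F
  map j k := MonoidalClosed.curry (a j k)
  map_id j := by
    rw [← MonoidalClosed.curry_natural_left, h₁]
    rfl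
  map_comp i j k := by
    refine Eq.trans ?_ (curry_tensor_comp _ _).symm
    rw [← MonoidalClosed.curry_natural_left, ← h₂, Iso.inv_hom_id_assoc]

@[simp]
theorem act_ofAct (F : J → V) (a h₁ h₂) (j k : J) : act (V := V) (ofAct F a h₁ h₂) j k = a j k :=
  MonoidalClosed.uncurry_curry _

@[simp]
theorem act_homFrom (a x y : C) : act (homFrom (V := V) a) x y = eComp V a x y :=
  MonoidalClosed.uncurry_curry _

@[simp]
theorem act_comp_functor (T : EnrichedFunctor V J C) (F : EnrichedFunctor V C V) (j k : J) :
    act (T.comp V F) j k = F.obj (T.obj j) ◁ T.map j k ≫ act F _ _ :=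
  MonoidalClosed.uncurry_natural_left _ _

/-- The `X`-graded morphisms between `V`-valued functors, as families commuting with the
actions. -/
def IsGr (X : V) (F G : EnrichedFunctor V J V) (t : ∀ j, X ⊗ F.obj j ⟶ G.obj j) : Prop :=
  ∀ j k, (α_ _ _ _).hom ≫ X ◁ act F j k ≫ t k = t j ▷ _ ≫ act G j k

/-- Uncurrying turns both composites in `V` into successive actions; precomposing with the
invertible braiding of `X` past `F c` then cancels every remaining braiding. From here on, graded
transformations can be handled as families linear over the actions. -/
theorem gradedTrans_naturality_iff {X : V} {F G : EnrichedFunctor V J V}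
    (t : ∀ j, X ⊗ F.obj j ⟶ G.obj j) (c d : J) :
    (β_ X (c ⟶[V] d)).hom ≫ (F.map c d ⊗ₘ MonoidalClosed.curry ((β_ _ _).hom ≫ t d)) ≫
        eComp V (F.obj c) (F.obj d) (G.obj d) =
      (MonoidalClosed.curry ((β_ _ _).hom ≫ t c) ⊗ₘ G.map c d) ≫
        eComp V (F.obj c) (G.obj c) (G.obj d) ↔
    (α_ _ _ _).hom ≫ X ◁ act F c d ≫ t d = t c ▷ _ ≫ act G c d := by
  rw [← MonoidalClosed.uncurry_injective.eq_iff, MonoidalClosed.uncurry_natural_left,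
    uncurry_tensor_comp, uncurry_tensor_comp]
  erw [MonoidalClosed.uncurry_curry, MonoidalClosed.uncurry_curry]
  rw [← cancel_epi ((β_ X (F.obj c)).hom ▷ (c ⟶[V] d) ≫ (α_ _ _ _).hom)]
  refine Eq.congr ?_ ?_
  · change _ ≫ _ ≫ _ ≫ act F c d ▷ X ≫ _ = _
    rw [BraidedCategory.braiding_naturality_left_assoc]
    simp only [BraidedCategory.braiding_tensor_left_hom, Category.assoc, Iso.inv_hom_id_assoc]
    rw [← MonoidalCategory.whiskerLeft_comp_assoc, SymmetricCategory.symmetry,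
      MonoidalCategory.whiskerLeft_id, Category.id_comp, Iso.hom_inv_id_assoc,
      ← comp_whiskerRight_assoc, SymmetricCategory.symmetry, id_whiskerRight, Category.id_comp]
  · change _ ≫ _ ≫ _ ≫ act G c d = _
    rw [Category.assoc, Iso.hom_inv_id_assoc, comp_whiskerRight_assoc, ← comp_whiskerRight_assoc,
      SymmetricCategory.symmetry, id_whiskerRight, Category.id_comp]

/-- Graded families from graded transformations. -/
def GradedTrans.toFam {X : V} {F G : EnrichedFunctor V J V} (τ : GradedTrans X F G) (j : J) :
    X ⊗ F.obj j ⟶ G.obj j :=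
  (β_ _ _).hom ≫ MonoidalClosed.uncurry (τ.app j)

theorem GradedTrans.curry_toFam {X : V} {F G : EnrichedFunctor V J V} (τ : GradedTrans X F G)
    (j : J) : MonoidalClosed.curry ((β_ _ _).hom ≫ τ.toFam j) = τ.app j := by
  simp [toFam]

theorem GradedTrans.isGr {X : V} {F G : EnrichedFunctor V J V} (τ : GradedTrans X F G) :
    IsGr X F G τ.toFam := fun c d => by
  rw [← gradedTrans_naturality_iff]
  simpa only [GradedTrans.curry_toFam] using τ.naturality c d

/-- Graded transformations from graded families. -/
@[simps]
def IsGr.toTrans {X : V} {F G : EnrichedFunctor V J V} {t : ∀ j, X ⊗ F.obj j ⟶ G.obj j}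
    (ht : IsGr X F G t) : GradedTrans X F G where
  app j := MonoidalClosed.curry ((β_ _ _).hom ≫ t j)
  naturality c d := (gradedTrans_naturality_iff t c d).2 (ht c d)

@[simp]
theorem IsGr.toFam_toTrans {X : V} {F G : EnrichedFunctor V J V} {t : ∀ j, X ⊗ F.obj j ⟶ G.obj j}
    (ht : IsGr X F G t) (j : J) : ht.toTrans.toFam j = t j := by
  simp [GradedTrans.toFam]

theorem isVNatural_iff (F G : EnrichedFunctor V J V) (α : ∀ c, F.obj c ⟶ G.obj c) :
    IsVNatural F G α ↔ ∀ c d, act F c d ≫ α d = α c ▷ _ ≫ act G c d := by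
  refine forall_congr' fun c => forall_congr' fun d => ?_
  rw [← MonoidalClosed.uncurry_injective.eq_iff, MonoidalClosed.uncurry_natural_right,
    MonoidalClosed.uncurry_pre_app]
  rfl

end Modules

/-! ### Weighted limits in terms of graded cones. -/

section Limits

variable [MonoidalClosed V] {J : Type u₁} [EnrichedCategory V J]
  {C : Type u₂} [EnrichedCategory V C] {D : Type u₃} [EnrichedCategory V D]

/-- `X`-graded cones `X ⊗ φ j ⟶ C(a, T j)`. -/
def IsCone (φ : EnrichedFunctor V J V) (T : EnrichedFunctor V J C) (a : C) (X : V)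
    (t : ∀ j, X ⊗ φ.obj j ⟶ (a ⟶[V] T.obj j)) : Prop :=
  ∀ j k, (α_ _ _ _).hom ≫ X ◁ act φ j k ≫ t k = (t j ⊗ₘ T.map j k) ≫ eComp V a _ _

theorem isCone_iff {φ : EnrichedFunctor V J V} {T : EnrichedFunctor V J C} {a : C} {X : V}
    {t : ∀ j, X ⊗ φ.obj j ⟶ (a ⟶[V] T.obj j)} :
    IsCone φ T a X t ↔ IsGr X φ (T.comp V (homFrom a)) t := by
  refine forall_congr' fun c => forall_congr' fun d => ?_
  rw [act_comp_functor, act_homFrom, MonoidalCategory.tensorHom_def, Category.assoc]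
  rfl

/-- Ungraded cones `φ j ⟶ C(a, T j)`. -/
def IsCone₁ (φ : EnrichedFunctor V J V) (T : EnrichedFunctor V J C) (a : C)
    (t : ∀ j, φ.obj j ⟶ (a ⟶[V] T.obj j)) : Prop :=
  ∀ j k, act φ j k ≫ t k = (t j ⊗ₘ T.map j k) ≫ eComp V a _ _

theorem isCone₁_iff {φ : EnrichedFunctor V J V} {T : EnrichedFunctor V J C} {a : C}
    {t : ∀ j, φ.obj j ⟶ (a ⟶[V] T.obj j)} :
    IsCone₁ φ T a t ↔ IsVNatural φ (T.comp V (homFrom a)) t := by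
  refine Iff.trans ?_ (isVNatural_iff φ (T.comp V (homFrom a)) t).symm
  refine forall_congr' fun c => forall_congr' fun d => ?_
  rw [act_comp_functor, act_homFrom, MonoidalCategory.tensorHom_def, Category.assoc]
  rfl

/-- The working form of the universal property, free of currying and of the braiding: graded cones
factor uniquely by plain composition with `μ`. -/
theorem isWeightedLimit_iff {φ : EnrichedFunctor V J V} {T : EnrichedFunctor V J C} {l : C}
    {μ : ∀ j, φ.obj j ⟶ (l ⟶[V] T.obj j)} :
    IsWeightedLimit φ T l μ ↔ IsCone₁ φ T l μ ∧
      ∀ (a : C) (X : V) (t : ∀ j, X ⊗ φ.obj j ⟶ (a ⟶[V] T.obj j)), IsCone φ T a X t →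
        ∃! f : X ⟶ (a ⟶[V] l), ∀ j, (f ⊗ₘ μ j) ≫ eComp V a l _ = t j := by
  have key (a : C) (X : V) (f : X ⟶ (a ⟶[V] l)) (j : J) :
      f ≫ MonoidalClosed.curry ((β_ _ _).hom ≫ (a ⟶[V] l) ◁ μ j ≫ eComp V a l (T.obj j)) =
        MonoidalClosed.curry ((β_ _ _).hom ≫ (f ⊗ₘ μ j) ≫ eComp V a l _) := by
    rw [← MonoidalClosed.curry_natural_left, BraidedCategory.braiding_naturality_right_assoc,
      MonoidalCategory.tensorHom_def, Category.assoc]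
  constructor
  · rintro ⟨h₁, h₂⟩
    refine ⟨isCone₁_iff.2 h₁, fun a X t ht => ?_⟩
    obtain ⟨f, hf, hf'⟩ := h₂ a X (isCone_iff.1 ht).toTrans
    refine ⟨f, fun j => ?_, fun g hg => hf' g fun j => ?_⟩
    · have := (key a X f j).symm.trans (hf j)
      exact (cancel_epi _).1 (MonoidalClosed.curry_injective this)
    · rw [key, hg]
      rfl
  · rintro ⟨h₁, h₂⟩
    refine ⟨isCone₁_iff.1 h₁, fun a X τ => ?_⟩
    obtain ⟨f, hf, hf'⟩ := h₂ a X τ.toFam (isCone_iff.2 τ.isGr)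
    refine ⟨f, fun j => ?_, fun g hg => hf' g fun j => ?_⟩
    · rw [key, hf]
      exact τ.curry_toFam j
    · have := ((key a X g j).symm.trans (hg j)).trans (τ.curry_toFam j).symm
      exact (cancel_epi _).1 (MonoidalClosed.curry_injective this)

/-- The braiding in the definition of a limit cancels the one in the composition of `Cᵒᵖ`. General
facts then need proof for limits only. -/
theorem isWeightedColimit_iff_op {φ : EnrichedFunctor V Jᵒᵖ V} {S : EnrichedFunctor V J C} {c : C}
    {η : ∀ j : Jᵒᵖ, φ.obj j ⟶ (S.obj j.unop ⟶[V] c)} :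
    IsWeightedColimit φ S c η ↔ IsWeightedLimit φ (opFunctor S) (op c) η := by
  have key (a : C) (j : Jᵒᵖ) : (β_ (φ.obj j) (c ⟶[V] a)).hom ≫ (c ⟶[V] a) ◁ η j ≫
      eComp V (op a) (op c) (op (S.obj j.unop)) = η j ▷ (c ⟶[V] a) ≫ eComp V (S.obj j.unop) c a := by
    rw [eComp_op_eq]
    erw [BraidedCategory.braiding_naturality_right_assoc]
    simp
  constructor
  · rintro ⟨h₁, h₂⟩
    refine ⟨h₁, fun a X τ => ?_⟩
    have := h₂ a.unop X τ
    simp only [← key] at this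
    exact this
  · rintro ⟨h₁, h₂⟩
    refine ⟨h₁, fun a X τ => ?_⟩
    simp only [← key]
    exact h₂ (op a) X τ

end Limits

end VCat

end

noncomputable section

namespace VCat

variable {V : Type u} [Category.{w} V] [MonoidalCategory V] [SymmetricCategory V]

/-! ### Composition with ungraded morphisms, and isomorphisms in a `V`-category. -/

section Composition

variable {C : Type u₂} [EnrichedCategory V C] {D : Type u₃} [EnrichedCategory V D]

theorem eId_tensor_eComp {x y : C} {X : V} (g : X ⟶ (x ⟶[V] y)) :
    (eId V x ⊗ₘ g) ≫ eComp V x x y = (λ_ _).hom ≫ g := by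
  rw [MonoidalCategory.tensorHom_def', Category.assoc, ← cancel_epi (λ_ _).inv]
  simp

theorem tensor_eId_eComp {x y : C} {X : V} (g : X ⟶ (x ⟶[V] y)) :
    (g ⊗ₘ eId V y) ≫ eComp V x y y = (ρ_ _).hom ≫ g := by
  rw [MonoidalCategory.tensorHom_def, Category.assoc, ← cancel_epi (ρ_ _).inv]
  simp

/-- Composition of a graded morphism with an ungraded one. -/
def postU {x y z : C} {X : V} (f : X ⟶ (x ⟶[V] y)) (i : 𝟙_ V ⟶ (y ⟶[V] z)) : X ⟶ (x ⟶[V] z) :=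
  (ρ_ X).inv ≫ (f ⊗ₘ i) ≫ eComp V x y z

/-- Composition of an ungraded morphism with a graded one. -/
def preU {x y z : C} {X : V} (i : 𝟙_ V ⟶ (x ⟶[V] y)) (f : X ⟶ (y ⟶[V] z)) : X ⟶ (x ⟶[V] z) :=
  (λ_ X).inv ≫ (i ⊗ₘ f) ≫ eComp V x y z

theorem postU_eId {x y : C} {X : V} (f : X ⟶ (x ⟶[V] y)) : postU f (eId V y) = f := by
  simp [postU, tensor_eId_eComp]

theorem preU_eId {x y : C} {X : V} (f : X ⟶ (x ⟶[V] y)) : preU (eId V x) f = f := by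
  simp [preU, eId_tensor_eComp]

theorem postU_eq_preU {x y z : C} (i : 𝟙_ V ⟶ (x ⟶[V] y)) (j : 𝟙_ V ⟶ (y ⟶[V] z)) :
    postU i j = preU i j := by
  simp [postU, preU, unitors_inv_equal]

theorem comp_postU {x y z : C} {X Y : V} (g : Y ⟶ X) (f : X ⟶ (x ⟶[V] y))
    (i : 𝟙_ V ⟶ (y ⟶[V] z)) : g ≫ postU f i = postU (g ≫ f) i := by
  rw [postU, postU, rightUnitor_inv_naturality_assoc, whiskerRight_comp_tensorHom_assoc]

theorem comp_preU {x y z : C} {X Y : V} (g : Y ⟶ X) (i : 𝟙_ V ⟶ (x ⟶[V] y))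
    (f : X ⟶ (y ⟶[V] z)) : g ≫ preU i f = preU i (g ≫ f) := by
  rw [preU, preU, leftUnitor_inv_naturality_assoc, whiskerLeft_comp_tensorHom_assoc]

theorem postU_tensor_eComp {x y z t : C} {X Y : V} (f : X ⟶ (x ⟶[V] y)) (i : 𝟙_ V ⟶ (y ⟶[V] z))
    (g : Y ⟶ (z ⟶[V] t)) :
    (postU f i ⊗ₘ g) ≫ eComp V _ _ _ = (f ⊗ₘ preU i g) ≫ eComp V _ _ _ := by
  have h := eComp_assoc3 f i g
  rw [postU, preU, ← whiskerRight_comp_tensorHom_assoc, ← whiskerLeft_comp_tensorHom_assoc, ← h]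
  simp

theorem preU_tensor_eComp {x y z t : C} {X Y : V} (i : 𝟙_ V ⟶ (x ⟶[V] y)) (f : X ⟶ (y ⟶[V] z))
    (g : Y ⟶ (z ⟶[V] t)) :
    (preU i f ⊗ₘ g) ≫ eComp V _ _ _ = preU i ((f ⊗ₘ g) ≫ eComp V _ _ _) := by
  have h := eComp_assoc3 i f g
  rw [preU, preU, ← whiskerRight_comp_tensorHom_assoc, ← h]
  simp

theorem tensor_postU_eComp {x y z t : C} {X Y : V} (f : X ⟶ (x ⟶[V] y)) (g : Y ⟶ (y ⟶[V] z))
    (i : 𝟙_ V ⟶ (z ⟶[V] t)) :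
    (f ⊗ₘ postU g i) ≫ eComp V _ _ _ = postU ((f ⊗ₘ g) ≫ eComp V _ _ _) i := by
  have h := eComp_assoc3 f g i
  rw [postU, postU, ← whiskerLeft_comp_tensorHom_assoc, ← h]
  simp

theorem preU_preU {x y z t : C} {X : V} (i : 𝟙_ V ⟶ (x ⟶[V] y)) (j : 𝟙_ V ⟶ (y ⟶[V] z))
    (f : X ⟶ (z ⟶[V] t)) : preU i (preU j f) = preU (preU i j) f := by
  rw [preU, ← postU_tensor_eComp, postU_eq_preU]
  rfl

theorem postU_postU {x y z t : C} {X : V} (f : X ⟶ (x ⟶[V] y)) (i : 𝟙_ V ⟶ (y ⟶[V] z))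
    (j : 𝟙_ V ⟶ (z ⟶[V] t)) : postU (postU f i) j = postU f (preU i j) := by
  rw [postU, postU_tensor_eComp]
  rfl

theorem preU_postU {x y z t : C} {X : V} (i : 𝟙_ V ⟶ (x ⟶[V] y)) (f : X ⟶ (y ⟶[V] z))
    (j : 𝟙_ V ⟶ (z ⟶[V] t)) : preU i (postU f j) = postU (preU i f) j := by
  rw [preU, tensor_postU_eComp, comp_postU]
  rfl

theorem preU_map (F : EnrichedFunctor V C D) {x y z : C} {X : V} (i : 𝟙_ V ⟶ (x ⟶[V] y))
    (f : X ⟶ (y ⟶[V] z)) : preU i f ≫ F.map x z = preU (i ≫ F.map x y) (f ≫ F.map y z) := by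
  simp [preU]

/-- Isomorphisms of a `V`-category. -/
structure EIso (x y : C) where
  hom : 𝟙_ V ⟶ (x ⟶[V] y)
  inv : 𝟙_ V ⟶ (y ⟶[V] x)
  hom_inv : preU hom inv = eId V x
  inv_hom : preU inv hom = eId V y

/-- The inverse isomorphism. -/
def EIso.symm {x y : C} (e : EIso (V := V) x y) : EIso (V := V) y x := ⟨e.inv, e.hom, e.inv_hom, e.hom_inv⟩

/-- The image of an isomorphism under a functor. -/
def EIso.map (F : EnrichedFunctor V C D) {x y : C} (e : EIso (V := V) x y) :
    EIso (V := V) (F.obj x) (F.obj y) where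
  hom := e.hom ≫ F.map _ _
  inv := e.inv ≫ F.map _ _
  hom_inv := by rw [← preU_map, e.hom_inv, F.map_id]
  inv_hom := by rw [← preU_map, e.inv_hom, F.map_id]

theorem homTo_comp_eq_preU {x y z : ForgetEnrichment V C} (f : x ⟶ y) (g : y ⟶ z) :
    ForgetEnrichment.homTo V (f ≫ g) =
      preU (ForgetEnrichment.homTo V f) (ForgetEnrichment.homTo V g) := by
  rw [ForgetEnrichment.homTo_comp, Category.assoc]
  rfl

theorem areIso_iff {x y : C} : AreIso V x y ↔ Nonempty (EIso (V := V) x y) := by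
  constructor
  · rintro ⟨e⟩
    refine ⟨⟨ForgetEnrichment.homTo V e.hom, ForgetEnrichment.homTo V e.inv, ?_, ?_⟩⟩
    · exact (homTo_comp_eq_preU e.hom e.inv).symm.trans
        ((congrArg (ForgetEnrichment.homTo V) e.hom_inv_id).trans (ForgetEnrichment.homTo_id V _))
    · exact (homTo_comp_eq_preU e.inv e.hom).symm.trans
        ((congrArg (ForgetEnrichment.homTo V) e.inv_hom_id).trans (ForgetEnrichment.homTo_id V _))
  · rintro ⟨e⟩
    refine ⟨⟨ForgetEnrichment.homOf V e.hom, ForgetEnrichment.homOf V e.inv, ?_, ?_⟩⟩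
    · exact (homTo_comp_eq_preU (ForgetEnrichment.homOf V e.hom) (ForgetEnrichment.homOf V e.inv)).trans
        (e.hom_inv.trans (ForgetEnrichment.homTo_id V (ForgetEnrichment.of V x)).symm)
    · exact (homTo_comp_eq_preU (ForgetEnrichment.homOf V e.inv) (ForgetEnrichment.homOf V e.hom)).trans
        (e.inv_hom.trans (ForgetEnrichment.homTo_id V (ForgetEnrichment.of V y)).symm)

theorem preU_op {x y z : C} (i : 𝟙_ V ⟶ (x ⟶[V] y)) (j : 𝟙_ V ⟶ (y ⟶[V] z)) :
    preU (C := Cᵒᵖ) (x := op z) (y := op y) (z := op x) j i = preU i j := by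
  rw [preU, tensorHom_eComp_op_eq, preU, leftUnitor_inv_braiding_assoc, ← unitors_inv_equal]

/-- An isomorphism of `C` as an isomorphism of the opposite. -/
def EIso.op {x y : C} (e : EIso (V := V) x y) : EIso (V := V) (Opposite.op y) (Opposite.op x) where
  hom := e.hom
  inv := e.inv
  hom_inv := (preU_op e.inv e.hom).trans e.inv_hom
  inv_hom := (preU_op e.hom e.inv).trans e.hom_inv

/-- An isomorphism of the opposite of `C` as an isomorphism of `C`. -/
def EIso.unop {x y : Cᵒᵖ} (e : EIso (V := V) x y) : EIso (V := V) y.unop x.unop where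
  hom := e.hom
  inv := e.inv
  hom_inv := (preU_op (x := y.unop) (y := x.unop) (z := y.unop) e.hom e.inv).symm.trans e.inv_hom
  inv_hom := (preU_op (x := x.unop) (y := y.unop) (z := x.unop) e.inv e.hom).symm.trans e.hom_inv

end Composition

/-! ### Uniqueness of limits, and limits weighted by representables. -/

section Limits

variable [MonoidalClosed V] {J : Type u₁} [EnrichedCategory V J]
  {C : Type u₂} [EnrichedCategory V C] {D : Type u₃} [EnrichedCategory V D]

theorem IsCone₁.isCone {φ : EnrichedFunctor V J V} {T : EnrichedFunctor V J C} {l : C}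
    {μ : ∀ j, φ.obj j ⟶ (l ⟶[V] T.obj j)} (h : IsCone₁ φ T l μ) {a : C} {X : V}
    (f : X ⟶ (a ⟶[V] l)) : IsCone φ T a X (fun j => (f ⊗ₘ μ j) ≫ eComp V _ _ _) := fun j k => by
  rw [whiskerLeft_comp_tensorHom_assoc, h j k, eComp_assoc3]

theorem IsCone₁.preU {φ : EnrichedFunctor V J V} {T : EnrichedFunctor V J C} {l : C}
    {μ : ∀ j, φ.obj j ⟶ (l ⟶[V] T.obj j)} (h : IsCone₁ φ T l μ) {a : C}
    (i : 𝟙_ V ⟶ (a ⟶[V] l)) : IsCone₁ φ T a (fun j => VCat.preU i (μ j)) := fun j k => by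
  rw [comp_preU, h j k, preU_tensor_eComp]

theorem IsCone₁.map {φ : EnrichedFunctor V J V} {T : EnrichedFunctor V J C} {l : C}
    {μ : ∀ j, φ.obj j ⟶ (l ⟶[V] T.obj j)} (h : IsCone₁ φ T l μ) (F : EnrichedFunctor V C D) :
    IsCone₁ φ (T.comp V F) (F.obj l) (fun j => μ j ≫ F.map _ _) := fun j k => by
  change act φ j k ≫ μ k ≫ F.map _ _ = ((μ j ≫ F.map _ _) ⊗ₘ (T.map j k ≫ F.map _ _)) ≫ eComp V _ _ _
  rw [reassoc_of% (h j k), F.map_comp, tensorHom_comp_tensorHom_assoc]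

theorem IsCone.of_isCone₁ {φ : EnrichedFunctor V J V} {T : EnrichedFunctor V J C} {l : C}
    {μ : ∀ j, φ.obj j ⟶ (l ⟶[V] T.obj j)} (h : IsCone₁ φ T l μ) :
    IsCone φ T l (𝟙_ V) (fun j => (λ_ _).hom ≫ μ j) := fun j k => by
  rw [leftUnitor_naturality_assoc, h j k, ← whiskerRight_comp_tensorHom]
  simp

namespace IsWeightedLimit

variable {φ : EnrichedFunctor V J V} {T : EnrichedFunctor V J C} {l : C}
    {μ : ∀ j, φ.obj j ⟶ (l ⟶[V] T.obj j)}

theorem cone (h : IsWeightedLimit φ T l μ) : IsCone₁ φ T l μ := (isWeightedLimit_iff.1 h).1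

theorem exists_lift (h : IsWeightedLimit φ T l μ) {a : C} {X : V}
    {t : ∀ j, X ⊗ φ.obj j ⟶ (a ⟶[V] T.obj j)} (ht : IsCone φ T a X t) :
    ∃ f : X ⟶ (a ⟶[V] l), ∀ j, (f ⊗ₘ μ j) ≫ eComp V a l _ = t j :=
  ((isWeightedLimit_iff.1 h).2 a X t ht).exists

theorem hom_ext (h : IsWeightedLimit φ T l μ) {a : C} {X : V} {f g : X ⟶ (a ⟶[V] l)}
    (hfg : ∀ j, (f ⊗ₘ μ j) ≫ eComp V a l _ = (g ⊗ₘ μ j) ≫ eComp V a l _) : f = g :=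
  ((isWeightedLimit_iff.1 h).2 a X _ (h.cone.isCone g)).unique hfg fun _ => rfl

theorem exists_liftU (h : IsWeightedLimit φ T l μ) {a : C}
    {ν : ∀ j, φ.obj j ⟶ (a ⟶[V] T.obj j)} (hν : IsCone₁ φ T a ν) :
    ∃ i : 𝟙_ V ⟶ (a ⟶[V] l), ∀ j, preU i (μ j) = ν j := by
  obtain ⟨f, hf⟩ := h.exists_lift (IsCone.of_isCone₁ hν)
  exact ⟨f, fun j => by rw [preU, hf, Iso.inv_hom_id_assoc]⟩

theorem hom_extU (h : IsWeightedLimit φ T l μ) {a : C} {f g : 𝟙_ V ⟶ (a ⟶[V] l)}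
    (hfg : ∀ j, preU f (μ j) = preU g (μ j)) : f = g :=
  h.hom_ext fun j => (cancel_epi (λ_ _).inv).1 (hfg j)

/-- Limits are unique up to isomorphism. -/
theorem exists_iso (h : IsWeightedLimit φ T l μ) {l' : C} {μ' : ∀ j, φ.obj j ⟶ (l' ⟶[V] T.obj j)}
    (h' : IsWeightedLimit φ T l' μ') : ∃ e : EIso (V := V) l' l, ∀ j, preU e.hom (μ j) = μ' j := by
  obtain ⟨i, hi⟩ := h.exists_liftU h'.cone
  obtain ⟨i', hi'⟩ := h'.exists_liftU h.cone
  exact ⟨⟨i, i', h'.hom_extU fun j => by rw [← preU_preU, hi', hi, preU_eId],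
    h.hom_extU fun j => by rw [← preU_preU, hi, hi', preU_eId]⟩, hi⟩

/-- Limits are closed under isomorphism of the vertex. -/
theorem of_iso (h : IsWeightedLimit φ T l μ) {l' : C} (e : EIso (V := V) l' l) :
    IsWeightedLimit φ T l' (fun j => preU e.hom (μ j)) := by
  refine isWeightedLimit_iff.2 ⟨h.cone.preU e.hom, fun a X t ht => ?_⟩
  obtain ⟨f, hf⟩ := h.exists_lift ht
  refine ⟨postU f e.inv, fun j => ?_, fun g hg => ?_⟩
  · rw [postU_tensor_eComp, preU_preU, e.inv_hom, preU_eId, hf]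
  · have : postU g e.hom = f := h.hom_ext fun j => by rw [postU_tensor_eComp, hg, hf]
    rw [← this, postU_postU, e.hom_inv, postU_eId]

theorem preserves_of (h : IsWeightedLimit φ T l μ) (F : EnrichedFunctor V C D)
    (hF : IsWeightedLimit φ (T.comp V F) (F.obj l) (fun j => μ j ≫ F.map _ _)) :
    PreservesWeightedLimit F φ T := by
  intro l' μ' h'
  obtain ⟨e, he⟩ := h.exists_iso h'
  convert hF.of_iso (e.map F) using 2 with j
  rw [← he]
  exact preU_map F e.hom (μ j)

end IsWeightedLimit

theorem eId_act_eComp (X : V) (x y : C) :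
    ((ρ_ X).inv ≫ X ◁ eId V x) ▷ (x ⟶[V] y) ≫ (α_ _ _ _).hom ≫ X ◁ eComp V x x y = 𝟙 _ := by
  rw [comp_whiskerRight, Category.assoc, associator_naturality_middle_assoc,
    triangle_assoc_comp_right_inv_assoc, ← MonoidalCategory.whiskerLeft_comp,
    ← MonoidalCategory.whiskerLeft_comp, e_id_comp, MonoidalCategory.whiskerLeft_id]

/-- Yoneda: a cone on a representable weight is recovered from its value at the identity of `j₀`. -/
theorem yoneda_fac (T : EnrichedFunctor V J C) {j₀ : J} {a : C} {X : V}
    (t : ∀ j, X ⊗ (j₀ ⟶[V] j) ⟶ (a ⟶[V] T.obj j))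
    (ht : ∀ j k, (α_ _ _ _).hom ≫ X ◁ eComp V j₀ j k ≫ t k = (t j ⊗ₘ T.map j k) ≫ eComp V a _ _)
    (k : J) : (((ρ_ X).inv ≫ X ◁ eId V j₀ ≫ t j₀) ⊗ₘ T.map j₀ k) ≫ eComp V _ _ _ = t k := by
  have h := eId_act_eComp X j₀ k
  rw [← Category.assoc, ← whiskerRight_comp_tensorHom_assoc, ← ht, ← Category.assoc,
    ← Category.assoc, Category.assoc _ _ (X ◁ _), h, Category.id_comp]

theorem yoneda_uniq (T : EnrichedFunctor V J C) {j₀ : J} {a : C} {X : V}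
    (g : X ⟶ (a ⟶[V] T.obj j₀)) :
    (ρ_ X).inv ≫ X ◁ eId V j₀ ≫ (g ⊗ₘ T.map j₀ j₀) ≫ eComp V _ _ _ = g := by
  rw [whiskerLeft_comp_tensorHom_assoc, T.map_id]
  exact postU_eId g

/-- The limit weighted by a representable. -/
theorem isWeightedLimit_homFrom (T : EnrichedFunctor V J C) (j₀ : J) :
    IsWeightedLimit (homFrom j₀) T (T.obj j₀) (fun j => T.map j₀ j) := by
  refine isWeightedLimit_iff.2 ⟨fun j k => ?_, fun a X t ht => ?_⟩
  · rw [act_homFrom]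
    exact T.map_comp _ _ _
  · refine ⟨(ρ_ X).inv ≫ X ◁ eId V j₀ ≫ t j₀, fun k => yoneda_fac T t (fun i j => ?_) k,
      fun g hg => ?_⟩
    · have h := ht i j
      rw [act_homFrom] at h
      exact h
    · rw [← hg j₀]
      exact (yoneda_uniq T g).symm

end Limits

end VCat

end

noncomputable section

namespace VCat

variable {V : Type u} [Category.{w} V] [MonoidalCategory V] [SymmetricCategory V]

theorem tensorHom_eComp_op {C : Type u₁} [EnrichedCategory V C] {x y z : C} {X Y : V}
    (f : X ⟶ (y ⟶[V] z)) (g : Y ⟶ (x ⟶[V] y)) :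
    (f ⊗ₘ g) ≫ eComp V (op z) (op y) (op x) = (β_ X Y).hom ≫ (g ⊗ₘ f) ≫ eComp V x y z :=
  tensorHom_eComp_op_eq (x := op x) (y := op y) (z := op z) V f g

theorem associator_whisker_coherence {X A H B B' v : V} (m : H ⊗ B' ⟶ B) (u : (X ⊗ A) ⊗ B ⟶ v) :
    (α_ (X ⊗ A) H B').hom ≫ (X ⊗ A) ◁ m ≫ u = (α_ X A H).hom ▷ B' ≫ (α_ X (A ⊗ H) B').hom ≫
      X ◁ ((α_ A H B').hom ≫ A ◁ m) ≫ (α_ X A B).inv ≫ u := by simp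

/-! ### Transposition with the exponent on the right. -/

section BraidedUncurry

variable [MonoidalClosed V]

/-- Uncurrying with the exponent on the right. -/
def bunc {X A B : V} (f : X ⟶ (ihom A).obj B) : X ⊗ A ⟶ B := (β_ X A).hom ≫ MonoidalClosed.uncurry f

/-- Currying with the exponent on the right. -/
def bcur {X A B : V} (f : X ⊗ A ⟶ B) : X ⟶ (ihom A).obj B := MonoidalClosed.curry ((β_ A X).hom ≫ f)

@[simp]
theorem bunc_bcur {X A B : V} (f : X ⊗ A ⟶ B) : bunc (bcur f) = f := by
  rw [bunc, bcur, MonoidalClosed.uncurry_curry, SymmetricCategory.symmetry_assoc]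

@[simp]
theorem bcur_bunc {X A B : V} (f : X ⟶ (ihom A).obj B) : bcur (bunc f) = f := by
  rw [bunc, bcur, SymmetricCategory.symmetry_assoc, MonoidalClosed.curry_uncurry]

theorem bunc_injective {X A B : V} :
    Function.Injective (bunc : (X ⟶ (ihom A).obj B) → (X ⊗ A ⟶ B)) :=
  Function.LeftInverse.injective bcur_bunc

theorem whiskerRight_bunc {X Y A B : V} (g : Y ⟶ X) (f : X ⟶ (ihom A).obj B) :
    g ▷ A ≫ bunc f = bunc (g ≫ f) := by
  rw [bunc, bunc, BraidedCategory.braiding_naturality_left_assoc,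
    MonoidalClosed.uncurry_natural_left]

theorem braiding_hexagon (X Y A : V) : (β_ (X ⊗ Y) A).hom ≫ (α_ A X Y).inv =
    (β_ X Y).hom ▷ A ≫ (α_ Y X A).hom ≫ Y ◁ (β_ X A).hom ≫ (β_ Y (A ⊗ X)).hom := by
  rw [BraidedCategory.braiding_naturality_right, BraidedCategory.braiding_tensor_left_hom,
    BraidedCategory.braiding_tensor_right_hom]
  simp only [Category.assoc, Iso.hom_inv_id, Iso.hom_inv_id_assoc, Category.comp_id]
  rw [← comp_whiskerRight_assoc, SymmetricCategory.symmetry, id_whiskerRight, Category.id_comp]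

theorem bunc_tensor_eComp {X Y A B E : V} (f : X ⟶ (ihom A).obj B) (g : Y ⟶ (ihom B).obj E) :
    bunc ((f ⊗ₘ g) ≫ eComp V A B E) =
      (β_ X Y).hom ▷ A ≫ (α_ Y X A).hom ≫ Y ◁ bunc f ≫ bunc g := by
  rw [bunc, uncurry_tensor_comp, ← Category.assoc, braiding_hexagon, bunc, bunc]
  simp only [MonoidalCategory.whiskerLeft_comp, Category.assoc]
  rw [BraidedCategory.braiding_naturality_right_assoc,
    BraidedCategory.braiding_naturality_right_assoc Y (MonoidalClosed.uncurry f),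
    BraidedCategory.braiding_naturality_right_assoc]

/-- With the grading object on the left, composition taken in the opposite order becomes evaluation
of `g` and then of `f`, with no braiding left over. This is why cocones, which live in the opposite
category, transpose cleanly. -/
theorem bunc_braiding_tensor_eComp {X Y A B E : V} (f : X ⟶ (ihom B).obj E)
    (g : Y ⟶ (ihom A).obj B) : bunc ((β_ X Y).hom ≫ (g ⊗ₘ f) ≫ eComp V A B E) =
      (α_ X Y A).hom ≫ X ◁ bunc g ≫ bunc f := by
  rw [← whiskerRight_bunc, bunc_tensor_eComp, ← comp_whiskerRight_assoc,
    SymmetricCategory.symmetry, id_whiskerRight, Category.id_comp]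

end BraidedUncurry

/-! ### Evaluation in the functor category `[J, V]`. -/

section Evaluation

variable [MonoidalClosed V] [HasLimitsOfSize.{w, w} V] {J : Type u₁} [EnrichedCategory V J]
  [IsSmall V J]

/-- The projection `[J, V](F, G) ⟶ [F j, G j]`. -/
def projF (F G : EnrichedFunctor V J V) (j : J) : (F ⟶[V] G) ⟶ (ihom (F.obj j)).obj (G.obj j) :=
  (natHomProj F G).app j

/-- Evaluation `[J, V](F, G) ⊗ F j ⟶ G j`. -/
def evF (F G : EnrichedFunctor V J V) (j : J) : (F ⟶[V] G) ⊗ F.obj j ⟶ G.obj j :=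
  bunc (projF F G j)

theorem evF_isGr (F G : EnrichedFunctor V J V) : IsGr (F ⟶[V] G) F G (evF F G) :=
  (natHomProj F G).isGr

theorem evF_ext {X : V} {F G : EnrichedFunctor V J V} {f g : X ⟶ (F ⟶[V] G)}
    (h : ∀ j, f ▷ F.obj j ≫ evF F G j = g ▷ F.obj j ≫ evF F G j) : f = g :=
  natHom_ext fun j => bunc_injective (by
    have := h j
    rw [evF, whiskerRight_bunc, whiskerRight_bunc] at this
    exact this)

theorem IsGr.exists_lift {X : V} {F G : EnrichedFunctor V J V}
    {t : ∀ j, X ⊗ F.obj j ⟶ G.obj j} (ht : IsGr X F G t) :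
    ∃ f : X ⟶ (F ⟶[V] G), ∀ j, f ▷ F.obj j ≫ evF F G j = t j := by
  refine ⟨natHomLift ht.toTrans, fun j => ?_⟩
  have := natHomLift_app ht.toTrans j
  rw [evF, whiskerRight_bunc]
  exact (congrArg bunc this).trans (ht.toFam_toTrans j)

theorem IsGr.precomp {X Y : V} {F G : EnrichedFunctor V J V}
    {t : ∀ j, X ⊗ F.obj j ⟶ G.obj j} (ht : IsGr X F G t) (f : Y ⟶ X) :
    IsGr Y F G (fun j => f ▷ _ ≫ t j) := fun j k => by
  rw [whisker_exchange_assoc, comp_whiskerRight, Category.assoc, ← ht j k,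
    associator_naturality_left_assoc]

theorem IsGr.comp {X Y : V} {F G H : EnrichedFunctor V J V} {s : ∀ j, Y ⊗ F.obj j ⟶ G.obj j}
    {t : ∀ j, X ⊗ G.obj j ⟶ H.obj j} (hs : IsGr Y F G s) (ht : IsGr X G H t) :
    IsGr (X ⊗ Y) F H (fun j => (α_ _ _ _).hom ≫ X ◁ s j ≫ t j) := fun j k => by
  have h₁ := congrArg (fun x => X ◁ x) (hs j k)
  simp only [MonoidalCategory.whiskerLeft_comp] at h₁
  simp only [comp_whiskerRight, Category.assoc]
  rw [← ht j k, associator_naturality_middle_assoc, ← reassoc_of% h₁]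
  simp

theorem whiskerRight_evF_isGr {X : V} {F G : EnrichedFunctor V J V} (f : X ⟶ (F ⟶[V] G)) :
    IsGr X F G (fun j => f ▷ _ ≫ evF F G j) := (evF_isGr F G).precomp f

theorem eId_projF (F : EnrichedFunctor V J V) (j : J) :
    eId V F ≫ projF F F j = eId V (F.obj j) := natHomLift_app _ j

theorem eComp_projF (F G H : EnrichedFunctor V J V) (j : J) :
    eComp V F G H ≫ projF F H j = (projF F G j ⊗ₘ projF G H j) ≫
      eComp V (F.obj j) (G.obj j) (H.obj j) :=
  natHomLift_app _ j

theorem eId_evF (F : EnrichedFunctor V J V) (j : J) :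
    eId V F ▷ _ ≫ evF F F j = (λ_ (F.obj j)).hom := by
  rw [evF, whiskerRight_bunc, eId_projF, bunc]
  erw [MonoidalClosed.uncurry_curry]
  simp

/-- Evaluation at an object, as a functor. -/
def evFunctor (j : J) : EnrichedFunctor V (EnrichedFunctor V J V) V where
  obj F := F.obj j
  map F G := projF F G j
  map_id F := eId_projF F j
  map_comp F G H := eComp_projF F G H j

end Evaluation

/-! ### The weight `X ⊗ φ`. -/

section Tensor

variable [MonoidalClosed V] {J : Type u₁} [EnrichedCategory V J]

/-- The functor `X ⊗ φ`. -/
def tensorL (X : V) (φ : EnrichedFunctor V J V) : EnrichedFunctor V J V :=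
  ofAct (fun j => X ⊗ φ.obj j) (fun j k => (α_ _ _ _).hom ≫ X ◁ act φ j k)
    (fun j => by
      have := act_id φ j
      rw [associator_naturality_right_assoc, ← MonoidalCategory.whiskerLeft_comp, this]
      simp)
    (fun i j k => by
      have h := congrArg (fun x => X ◁ x) (act_comp φ i j k)
      simp only [MonoidalCategory.whiskerLeft_comp] at h
      simp only [comp_whiskerRight, Category.assoc]
      rw [associator_naturality_middle_assoc, ← h]
      simp)

theorem act_tensorL (X : V) (φ : EnrichedFunctor V J V) (j k : J) :
    act (tensorL X φ) j k = (α_ X (φ.obj j) _).hom ≫ X ◁ act φ j k := act_ofAct _ _ _ _ _ _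

/-- Absorbing the grading object into the weight lets results on ungraded cones apply to graded
ones. -/
theorem isCone_iff_tensorL {C : Type u₂} [EnrichedCategory V C] {φ : EnrichedFunctor V J V}
    {T : EnrichedFunctor V J C} {a : C} {X : V} {t : ∀ j, X ⊗ φ.obj j ⟶ (a ⟶[V] T.obj j)} :
    IsCone φ T a X t ↔ IsCone₁ (tensorL X φ) T a t := by
  refine forall_congr' fun c => forall_congr' fun d => ?_
  rw [act_tensorL]
  exact Eq.congr_left (Category.assoc _ _ _).symm

end Tensor

/-! ### Colimits in `V` as universal balanced families. -/

section ColimitsInBase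

variable [MonoidalClosed V] {L : Type u₁} [EnrichedCategory V L]

/-- The left action of `L` on the values of a functor `L ⟶ V`. -/
def lactV (B : EnrichedFunctor V L V) (l l' : L) : (l ⟶[V] l') ⊗ B.obj l ⟶ B.obj l' :=
  (β_ _ _).hom ≫ act B l l'

/-- Families `χ l ⊗ B l ⟶ v` that are balanced over `L`. -/
def BalV (χ : EnrichedFunctor V Lᵒᵖ V) (B : EnrichedFunctor V L V) (v : V)
    (h : ∀ l : Lᵒᵖ, χ.obj l ⊗ B.obj l.unop ⟶ v) : Prop :=
  ∀ l l' : Lᵒᵖ, act χ l l' ▷ _ ≫ h l' =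
    (α_ _ _ _).hom ≫ χ.obj l ◁ lactV B l'.unop l.unop ≫ h l

theorem isCone₁_op_iff_balV {χ : EnrichedFunctor V Lᵒᵖ V} {B : EnrichedFunctor V L V} {v : V}
    {t : ∀ l, χ.obj l ⟶ (ihom (B.obj l.unop)).obj v} :
    IsCone₁ χ (opFunctor B) (op v) t ↔ BalV χ B v (fun l => bunc (t l)) := by
  refine forall_congr' fun l => forall_congr' fun l' => ?_
  have key := tensorHom_eComp_op (t l) (B.map l'.unop l.unop)
  refine (Eq.congr_right key).trans ?_
  refine Iff.trans (bunc_injective.eq_iff (a := act χ l l' ≫ t l')).symm ?_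
  exact Eq.congr (whiskerRight_bunc _ _).symm
    (bunc_braiding_tensor_eComp (t l) (B.map l'.unop l.unop))

/-- A universal balanced family. -/
structure IsColimV (χ : EnrichedFunctor V Lᵒᵖ V) (B : EnrichedFunctor V L V) (c : V)
    (h : ∀ l : Lᵒᵖ, χ.obj l ⊗ B.obj l.unop ⟶ c) : Prop where
  bal : BalV χ B c h
  desc : ∀ (v : V) (u : ∀ l : Lᵒᵖ, χ.obj l ⊗ B.obj l.unop ⟶ v), BalV χ B v u →
    ∃ g : c ⟶ v, ∀ l, h l ≫ g = u l
  ext : ∀ (v : V) (f g : c ⟶ v), (∀ l, h l ≫ f = h l ≫ g) → f = g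

namespace IsColimV

variable {χ : EnrichedFunctor V Lᵒᵖ V} {B : EnrichedFunctor V L V} {c : V}
    {h : ∀ l : Lᵒᵖ, χ.obj l ⊗ B.obj l.unop ⟶ c}

/-- Currying moves `X` to the target. This lemma and the next four say that tensoring with an object
preserves the universal family, because `V` is closed. -/
theorem ext_left (H : IsColimV χ B c h) {X v : V} {f g : X ⊗ c ⟶ v}
    (hfg : ∀ l, X ◁ h l ≫ f = X ◁ h l ≫ g) : f = g := by
  refine MonoidalClosed.curry_injective (H.ext _ _ _ fun l => ?_)
  rw [← MonoidalClosed.curry_natural_left, hfg, MonoidalClosed.curry_natural_left]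

theorem ext_right (H : IsColimV χ B c h) {Y v : V} {f g : c ⊗ Y ⟶ v}
    (hfg : ∀ l, h l ▷ Y ≫ f = h l ▷ Y ≫ g) : f = g := by
  refine (cancel_epi (β_ Y c).hom).1 (H.ext_left fun l => ?_)
  rw [BraidedCategory.braiding_naturality_right_assoc, hfg,
    BraidedCategory.braiding_naturality_right_assoc]

theorem ext_both (H : IsColimV χ B c h) {X Y v : V} {f g : (X ⊗ c) ⊗ Y ⟶ v}
    (hfg : ∀ l, (X ◁ h l) ▷ Y ≫ f = (X ◁ h l) ▷ Y ≫ g) : f = g := by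
  refine (cancel_epi (α_ X c Y).inv).1 ?_
  refine MonoidalClosed.curry_injective (H.ext_right fun l => ?_)
  rw [← MonoidalClosed.curry_natural_left, ← MonoidalClosed.curry_natural_left]
  rw [associator_inv_naturality_middle_assoc, hfg, associator_inv_naturality_middle_assoc]

theorem desc_left (H : IsColimV χ B c h) {X v : V} (u : ∀ l, (X ⊗ χ.obj l) ⊗ B.obj l.unop ⟶ v)
    (hu : BalV (tensorL X χ) B v u) :
    ∃ g : X ⊗ c ⟶ v, ∀ l, (α_ _ _ _).hom ≫ X ◁ h l ≫ g = u l := by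
  obtain ⟨g, hg⟩ := H.desc ((ihom X).obj v)
    (fun l => MonoidalClosed.curry ((α_ _ _ _).inv ≫ u l)) (fun l l' => by
      have := hu l l'
      rw [act_tensorL] at this
      change _ = (α_ (X ⊗ χ.obj l) _ _).hom ≫ (X ⊗ χ.obj l) ◁ _ ≫ _ at this
      rw [← MonoidalClosed.curry_natural_left, ← MonoidalClosed.curry_natural_left,
        ← MonoidalClosed.curry_natural_left]
      refine congrArg _ ?_
      rw [associator_inv_naturality_middle_assoc, ← cancel_epi (α_ X _ _).hom,
        Iso.hom_inv_id_assoc, ← cancel_epi ((α_ X _ _).hom ▷ _), ← comp_whiskerRight_assoc]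
      refine this.trans ((associator_whisker_coherence _ _).trans ?_)
      simp only [MonoidalCategory.whiskerLeft_comp, Category.assoc]
      rfl)
  refine ⟨MonoidalClosed.uncurry g, fun l => ?_⟩
  rw [← MonoidalClosed.uncurry_natural_left, hg, MonoidalClosed.uncurry_curry, Iso.hom_inv_id_assoc]

theorem desc_right (H : IsColimV χ B c h) {Y v : V} (u : ∀ l, (χ.obj l ⊗ B.obj l.unop) ⊗ Y ⟶ v)
    (hu : ∀ l l', (act χ l l' ▷ _) ▷ Y ≫ u l' =
      ((α_ _ _ _).hom ≫ χ.obj l ◁ lactV B l'.unop l.unop) ▷ Y ≫ u l) :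
    ∃ g : c ⊗ Y ⟶ v, ∀ l, h l ▷ Y ≫ g = u l := by
  obtain ⟨g, hg⟩ := H.desc ((ihom Y).obj v)
    (fun l => MonoidalClosed.curry ((β_ _ _).hom ≫ u l)) (fun l l' => by
      have := hu l l'
      rw [← Category.assoc, ← MonoidalClosed.curry_natural_left,
        ← MonoidalClosed.curry_natural_left]
      refine congrArg _ ?_
      rw [BraidedCategory.braiding_naturality_right_assoc, this,
        BraidedCategory.braiding_naturality_right_assoc]
      rfl)
  refine ⟨bunc g, fun l => ?_⟩
  rw [whiskerRight_bunc, hg]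
  exact bunc_bcur _

end IsColimV

/-- The enriched universal property specialises at `X = 𝟙_ V` to the ordinary one. Conversely the
ordinary one gives the graded one, since `X ⊗ -` is a left adjoint and so preserves the colimit. -/
theorem isWeightedColimit_iff_isColimV {χ : EnrichedFunctor V Lᵒᵖ V} {B : EnrichedFunctor V L V}
    {c : V} {η : ∀ l : Lᵒᵖ, χ.obj l ⟶ (ihom (B.obj l.unop)).obj c} :
    IsWeightedColimit χ B c η ↔ IsColimV χ B c (fun l => bunc (η l)) := by
  have key {X v : V} (f : X ⟶ (ihom c).obj v) (l : Lᵒᵖ) :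
      bunc ((f ⊗ₘ η l) ≫ eComp V (C := Vᵒᵖ) (op v) (op c) (op (B.obj l.unop))) =
        (α_ _ _ _).hom ≫ X ◁ bunc (η l) ≫ bunc f := by
    have h := tensorHom_eComp_op (C := V) (x := B.obj l.unop) (y := c) (z := v) f (η l)
    exact (congrArg bunc h).trans (bunc_braiding_tensor_eComp f (η l))
  refine isWeightedColimit_iff_op.trans (isWeightedLimit_iff.trans ?_)
  constructor
  · rintro ⟨h₁, h₂⟩
    have hb := isCone₁_op_iff_balV.1 h₁
    have h₃ (v : V) (u : ∀ l : Lᵒᵖ, χ.obj l ⊗ B.obj l.unop ⟶ v) (hu : BalV χ B v u) :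
        ∃! g : c ⟶ v, ∀ l, bunc (η l) ≫ g = u l := by
      have hu' : IsCone₁ χ (opFunctor B) (op v) (fun l => bcur (u l)) :=
        isCone₁_op_iff_balV.2
          ((congrArg (BalV χ B v) (funext fun l => bunc_bcur (u l))).mpr hu)
      have e (g : c ⟶ v) : (λ_ c).inv ≫ bunc (bcur ((λ_ c).hom ≫ g)) = g := by simp
      have e' (f : 𝟙_ V ⟶ (ihom c).obj v) : bcur ((λ_ c).hom ≫ (λ_ c).inv ≫ bunc f) = f := by simp
      have hiff (f : 𝟙_ V ⟶ (ihom c).obj v) (l) : (f ⊗ₘ η l) ≫ eComp V (C := Vᵒᵖ) (op v) (op c)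
          (op (B.obj l.unop)) = (λ_ _).hom ≫ bcur (u l) ↔
            bunc (η l) ≫ (λ_ c).inv ≫ bunc f = u l := by
        rw [← bunc_injective.eq_iff]
        refine (Eq.congr (key f l) (whiskerRight_bunc _ _).symm).trans ?_
        rw [bunc_bcur, leftUnitor_inv_naturality_assoc, ← cancel_epi ((λ_ _).hom ▷ _)]
        simp
      obtain ⟨f, hf, hf'⟩ := h₂ (op v) (𝟙_ V) _ (IsCone.of_isCone₁ hu')
      refine ⟨(λ_ c).inv ≫ bunc f, fun l => (hiff f l).1 (hf l), fun g hg => ?_⟩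
      rw [← hf' (bcur ((λ_ c).hom ≫ g)) fun l => (hiff _ l).2 (by rw [e, hg]), e]
    exact ⟨hb, fun v u hu => (h₃ v u hu).exists, fun v f g hfg => (h₃ v _ (fun l l' => by
      have := hb l l'
      dsimp only at this
      rw [reassoc_of% this])).unique hfg fun _ => rfl⟩
  · intro H
    refine ⟨isCone₁_op_iff_balV.2 H.bal, fun a X t ht => ?_⟩
    obtain ⟨g, hg⟩ := H.desc_left (fun l => bunc (t l))
      (isCone₁_op_iff_balV.1 (isCone_iff_tensorL.1 ht))
    refine ⟨bcur g, fun l => bunc_injective ?_, fun f hf => bunc_injective ?_⟩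
    · refine (key (bcur g) l).trans ?_
      rw [bunc_bcur]
      exact hg l
    · rw [bunc_bcur]
      refine H.ext_left fun l => ?_
      rw [← cancel_epi (α_ _ _ _).hom, hg, ← hf l]
      exact (key _ l).symm

end ColimitsInBase

end VCat

end

noncomputable section

namespace VCat

variable {V : Type u} [Category.{w} V] [MonoidalCategory V] [SymmetricCategory V]

/-! ### The action of ungraded morphisms on a module. -/

section UngradedAction

variable [MonoidalClosed V] {J : Type u₁} [EnrichedCategory V J]

/-- The action of an ungraded morphism. -/
def uact (F : EnrichedFunctor V J V) {x y : J} (i : 𝟙_ V ⟶ (x ⟶[V] y)) : F.obj x ⟶ F.obj y :=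
  (ρ_ _).inv ≫ F.obj x ◁ i ≫ act F x y

theorem uact_tensor_act (F : EnrichedFunctor V J V) {x y z : J} (i : 𝟙_ V ⟶ (x ⟶[V] y)) {X : V}
    (f : X ⟶ (y ⟶[V] z)) :
    (uact F i ⊗ₘ f) ≫ act F y z = F.obj x ◁ preU i f ≫ act F x z := by
  have h := act_act F (𝟙 (F.obj x)) i f
  rw [id_tensorHom, id_tensorHom] at h
  rw [uact, ← whiskerRight_comp_tensorHom_assoc, ← h, preU]
  simp

theorem comp_uact (F : EnrichedFunctor V J V) {x y : J} {A : V} (a : A ⟶ F.obj x)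
    (i : 𝟙_ V ⟶ (x ⟶[V] y)) : a ≫ uact F i = (ρ_ _).inv ≫ (a ⊗ₘ i) ≫ act F x y := by
  rw [uact, rightUnitor_inv_naturality_assoc, MonoidalCategory.tensorHom_def_assoc]

theorem tensor_act_uact (F : EnrichedFunctor V J V) {x y z : J} {A X : V} (a : A ⟶ F.obj x)
    (f : X ⟶ (x ⟶[V] y)) (i : 𝟙_ V ⟶ (y ⟶[V] z)) :
    (a ⊗ₘ f) ≫ act F x y ≫ uact F i = (a ⊗ₘ postU f i) ≫ act F x z := by
  have h := act_act F a f i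
  rw [← Category.assoc, comp_uact, ← h, postU, rightUnitor_tensor_inv, Category.assoc,
    Iso.inv_hom_id_assoc, whiskerLeft_comp_tensorHom_assoc]

theorem uact_eId (F : EnrichedFunctor V J V) (x : J) : uact F (eId V x) = 𝟙 _ := by
  rw [uact, act_id, Iso.inv_hom_id]

theorem uact_uact (F : EnrichedFunctor V J V) {x y z : J} (i : 𝟙_ V ⟶ (x ⟶[V] y))
    (j : 𝟙_ V ⟶ (y ⟶[V] z)) : uact F i ≫ uact F j = uact F (preU i j) := by
  rw [comp_uact, uact_tensor_act]
  rfl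

theorem preU_op' {x y z : J} {X : V} (i : 𝟙_ V ⟶ (y ⟶[V] z)) (f : X ⟶ (x ⟶[V] y)) :
    preU (C := Jᵒᵖ) (x := op z) (y := op y) (z := op x) i f = postU f i := by
  have h := tensorHom_eComp_op i f
  rw [preU, postU]
  refine (congrArg _ h).trans ?_
  simp

theorem postU_op' {x y z : J} {X : V} (i : 𝟙_ V ⟶ (x ⟶[V] y)) (f : X ⟶ (y ⟶[V] z)) :
    postU (C := Jᵒᵖ) (x := op z) (y := op y) (z := op x) f i = preU i f := by
  have h := tensorHom_eComp_op f i
  rw [preU, postU]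
  refine (congrArg _ h).trans ?_
  simp

end UngradedAction

/-! ### Existence of small weighted colimits in `V`. -/

section ColimitsInBase

variable [MonoidalClosed V] {L : Type u₁} [EnrichedCategory V L]

theorem tensor_lactV_unit (B : EnrichedFunctor V L V) {x y : L} {A : V} (i : 𝟙_ V ⟶ (x ⟶[V] y))
    (b : A ⟶ B.obj x) : (λ_ A).inv ≫ (i ⊗ₘ b) ≫ lactV B x y = b ≫ uact B i := by
  rw [lactV, BraidedCategory.braiding_naturality_assoc, leftUnitor_inv_braiding_assoc, comp_uact]

theorem whisker_unit_coherence {A B B' H E : V} (i : 𝟙_ V ⟶ H) (b : B ⟶ B') (m : H ⊗ B' ⟶ E) :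
    ((ρ_ A).inv ≫ A ◁ i) ▷ B ≫ (A ⊗ H) ◁ b ≫ (α_ A H B').hom ≫ A ◁ m =
      A ◁ ((λ_ B).inv ≫ (i ⊗ₘ b) ≫ m) := by
  simp [MonoidalCategory.tensorHom_def]

/-- Balancedness, evaluated at `e.inv`, cancels the two actions of `e`. Hence a balanced family is
determined by one object of each isomorphism class. -/
theorem BalV.iso {χ : EnrichedFunctor V Lᵒᵖ V} {B : EnrichedFunctor V L V} {v : V}
    {u : ∀ l : Lᵒᵖ, χ.obj l ⊗ B.obj l.unop ⟶ v} (hu : BalV χ B v u) {l r : L}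
    (e : EIso (V := V) l r) :
    (uact χ (x := op l) (y := op r) e.inv ⊗ₘ uact B e.hom) ≫ u (op r) = u (op l) := by
  have h : act χ (op l) (op r) ▷ B.obj r ≫ u (op r) =
    (α_ _ (r ⟶[V] l) _).hom ≫ _ ◁ lactV B r l ≫ u (op l) := hu (op l) (op r)
  have h₁ : (uact χ (x := op l) (y := op r) e.inv ⊗ₘ uact B e.hom) ≫ u (op r) =
      ((ρ_ _).inv ≫ χ.obj (op l) ◁ e.inv) ▷ B.obj l ≫ (χ.obj (op l) ⊗ (r ⟶[V] l)) ◁ uact B e.hom ≫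
        act χ (op l) (op r) ▷ B.obj r ≫ u (op r) := by
    rw [uact, ← Category.assoc, ← whiskerRight_comp_tensorHom_assoc,
      MonoidalCategory.tensorHom_def'_assoc]
    rfl
  have h₂ := whisker_unit_coherence (A := χ.obj (op l)) e.inv (uact B e.hom) (lactV B r l)
  rw [tensor_lactV_unit, uact_uact, e.hom_inv, uact_eId, MonoidalCategory.whiskerLeft_id] at h₂
  have h₃ := congrArg (· ≫ u (op l)) h₂
  simp only [Category.assoc, Category.id_comp] at h₃
  rw [h₁, h, h₃]

/-- Naturality of the conjugation by isomorphisms with respect to the actions. -/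
theorem conj_act {χ : EnrichedFunctor V Lᵒᵖ V} {l r l' r' : L} (e : EIso (V := V) l r)
    (e' : EIso (V := V) l' r') :
    (uact χ (x := op l) (y := op r) e.inv ⊗ₘ postU (preU e'.inv (𝟙 (l' ⟶[V] l))) e.hom) ≫
      act χ (op r) (op r') =
    act χ (op l) (op l') ≫ uact χ (x := op l') (y := op r') e'.inv := by
  have h₁ := uact_tensor_act χ (x := op l) (y := op r) (z := op r') e.inv
    (postU (C := L) (preU e'.inv (𝟙 (l' ⟶[V] l))) e.hom)
  have h₂ := tensor_act_uact χ (x := op l) (y := op l') (z := op r') (𝟙 _) (𝟙 (l' ⟶[V] l)) e'.inv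
  rw [preU_op', postU_postU, e.hom_inv, postU_eId] at h₁
  rw [postU_op'] at h₂
  refine h₁.trans ?_
  rw [← id_tensorHom]
  exact h₂.symm.trans ((congrArg (· ≫ _) (id_tensorHom_id _ _)).trans (Category.id_comp _))

theorem conj_lactV {B : EnrichedFunctor V L V} {l r l' r' : L} (e : EIso (V := V) l r)
    (e' : EIso (V := V) l' r') :
    (postU (preU e'.inv (𝟙 (l' ⟶[V] l))) e.hom ⊗ₘ uact B e'.hom) ≫ lactV B r' r =
      lactV B l' l ≫ uact B e.hom := by
  have h₂ := tensor_act_uact B (𝟙 _) (𝟙 (l' ⟶[V] l)) e.hom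
  rw [lactV, BraidedCategory.braiding_naturality_assoc, uact_tensor_act, preU_postU, preU_preU,
    e'.hom_inv, preU_eId, lactV, Category.assoc, ← id_tensorHom, ← h₂, id_tensorHom_id]
  simp

/-- The converse transport: both actions commute with conjugation by `e` and `e'`, so balancedness
between the representatives `r`, `r'` passes to `l`, `l'`. -/
theorem BalV.of_conj {χ : EnrichedFunctor V Lᵒᵖ V} {B : EnrichedFunctor V L V} {v : V}
    {l r l' r' : L} (e : EIso (V := V) l r) (e' : EIso (V := V) l' r')
    {u : χ.obj (op r) ⊗ B.obj r ⟶ v} {u' : χ.obj (op r') ⊗ B.obj r' ⟶ v}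
    (h : act χ (op r) (op r') ▷ B.obj r' ≫ u' =
      (α_ _ (r' ⟶[V] r) _).hom ≫ χ.obj (op r) ◁ lactV B r' r ≫ u) :
    act χ (op l) (op l') ▷ B.obj l' ≫
        (uact χ (x := op l') (y := op r') e'.inv ⊗ₘ uact B e'.hom) ≫ u' =
      (α_ _ (l' ⟶[V] l) _).hom ≫ χ.obj (op l) ◁ lactV B l' l ≫
        (uact χ (x := op l) (y := op r) e.inv ⊗ₘ uact B e.hom) ≫ u := by
  rw [whiskerRight_comp_tensorHom_assoc, ← conj_act e e', whiskerLeft_comp_tensorHom_assoc,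
    ← conj_lactV e e', ← tensorHom_comp_whiskerRight_assoc]
  refine (congrArg _ h).trans ?_
  rw [associator_naturality_assoc, tensorHom_comp_whiskerLeft_assoc]

/-- The colimit is the usual coequalizer of coproducts. Smallness bounds only the isomorphism
classes of `L`, so the coproducts run over chosen representatives and the family is extended to all
objects by conjugation. -/
theorem exists_isColimV [HasColimits V] [hL : IsSmall V L] (χ : EnrichedFunctor V Lᵒᵖ V)
    (B : EnrichedFunctor V L V) : ∃ c h, IsColimV χ B c h := by
  have := hL.small_isoClasses
  let π : ForgetEnrichment V L → Quotient (isIsomorphicSetoid (ForgetEnrichment V L)) :=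
    Quotient.mk _
  let ι := Shrink.{w} (Quotient (isIsomorphicSetoid (ForgetEnrichment V L)))
  let r (j : ι) : L := ForgetEnrichment.to V ((equivShrink.{w} _).symm j).out
  let i (l : L) : ι := equivShrink.{w} _ (π (ForgetEnrichment.of V l))
  have hi : Function.Surjective i := fun j => ⟨r j, by
    simp only [i, r, ForgetEnrichment.of_to]
    rw [show π _ = _ from Quotient.out_eq _, Equiv.apply_symm_apply]⟩
  have he (l : L) : Nonempty (EIso (V := V) l (r (i l))) := by
    refine areIso_iff.1 ?_
    simp only [i, r, Equiv.symm_apply_apply]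
    exact Quotient.exact (Quotient.out_eq (π l)).symm
  have e (l : L) : EIso (V := V) l (r (i l)) := (he l).some
  clear_value r i
  let P : ι → V := fun j => χ.obj (op (r j)) ⊗ B.obj (r j)
  let Q : ι × ι → V := fun p => (χ.obj (op (r p.1)) ⊗ (r p.2 ⟶[V] r p.1)) ⊗ B.obj (r p.2)
  let a : ∐ Q ⟶ ∐ P := Sigma.desc fun p => act χ (op (r p.1)) (op (r p.2)) ▷ _ ≫ Sigma.ι P p.2
  let b : ∐ Q ⟶ ∐ P := Sigma.desc fun p =>
    (α_ _ _ _).hom ≫ _ ◁ lactV B (r p.2) (r p.1) ≫ Sigma.ι P p.1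
  have key {v : V} (f : ∐ P ⟶ v) : a ≫ f = b ≫ f ↔ ∀ j k,
      act χ (op (r j)) (op (r k)) ▷ B.obj (r k) ≫ Sigma.ι P k ≫ f =
        (α_ _ _ _).hom ≫ χ.obj (op (r j)) ◁ lactV B (r k) (r j) ≫ Sigma.ι P j ≫ f := by
    have h₁ (p : ι × ι) : Sigma.ι Q p ≫ a ≫ f = Sigma.ι Q p ≫ b ≫ f ↔
        act χ (op (r p.1)) (op (r p.2)) ▷ B.obj (r p.2) ≫ Sigma.ι P p.2 ≫ f =
          (α_ _ _ _).hom ≫ χ.obj (op (r p.1)) ◁ lactV B (r p.2) (r p.1) ≫ Sigma.ι P p.1 ≫ f := by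
      simp only [a, b, colimit.ι_desc_assoc, Cofan.mk_pt, Cofan.mk_ι_app, Category.assoc, Q]
    exact ⟨fun h j k => (h₁ (j, k)).1 (by rw [h]),
      fun h => Sigma.hom_ext _ _ fun p => (h₁ p).2 (h p.1 p.2)⟩
  let q := coequalizer.π a b
  have hq := (key q).1 (coequalizer.condition a b)
  refine ⟨coequalizer a b, fun l => (uact χ (x := l) (y := op (r (i l.unop))) (e l.unop).inv ⊗ₘ
    uact B (e l.unop).hom) ≫ Sigma.ι P (i l.unop) ≫ q,
    fun l l' => BalV.of_conj (e l.unop) (e l'.unop) (hq _ _), fun v u hu => ?_,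
    fun v f g hfg => ?_⟩
  · have ht : a ≫ Sigma.desc (fun j => u (op (r j))) = b ≫ Sigma.desc (fun j => u (op (r j))) := by
      rw [key]
      intro j k
      have := hu (op (r j)) (op (r k))
      simpa [P] using this
    refine ⟨coequalizer.desc _ ht, fun l => ?_⟩
    have := hu.iso (e l.unop)
    simpa [q, P] using this
  · refine coequalizer.hom_ext (Sigma.hom_ext _ _ fun j => ?_)
    obtain ⟨l, rfl⟩ := hi j
    -- Precomposing with the inverse conjugation strips the isomorphism from the family and leaves
    -- the coproduct inclusion at the representative.
    have h := congrArg (fun x => (uact χ (x := op (r (i l))) (y := op l) (e l).hom ⊗ₘ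
      uact B (e l).inv) ≫ x) (hfg (op l))
    have hχ : uact χ (x := op (r (i l))) (y := op l) (e l).hom ≫
        uact χ (x := op l) (y := op (r (i l))) (e l).inv = 𝟙 _ := by
      rw [uact_uact, preU_op, (e l).inv_hom]
      exact uact_eId χ _
    have hB : uact B (e l).inv ≫ uact B (e l).hom = 𝟙 _ := by
      rw [uact_uact, (e l).inv_hom, uact_eId]
    simp only [Category.assoc, tensorHom_comp_tensorHom_assoc, hB] at h
    erw [hχ] at h
    simpa [q, P] using h

end ColimitsInBase

end VCat

end

noncomputable section

namespace VCat

variable {V : Type u} [Category.{w} V] [MonoidalCategory V] [SymmetricCategory V]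

/-! ### Diagram chases for the construction of colimits of presheaves. -/

section Coherence

theorem coherence_gr_desc {X A B B' C C' G G' H : V} {hj : A ⊗ B ⟶ C} {hk : A ⊗ B' ⟶ C'}
    {s : B ⊗ H ⟶ B'} {c : C ⊗ H ⟶ C'} {g : G ⊗ H ⟶ G'} {gj : X ⊗ C ⟶ G} {gk : X ⊗ C' ⟶ G'}
    {tj : (X ⊗ A) ⊗ B ⟶ G} {tk : (X ⊗ A) ⊗ B' ⟶ G'}
    (h₁ : (α_ _ _ _).hom ≫ (X ⊗ A) ◁ s ≫ tk = tj ▷ H ≫ g)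
    (h₂ : (α_ _ _ _).hom ≫ A ◁ s ≫ hk = hj ▷ H ≫ c)
    (hgj : (α_ _ _ _).hom ≫ X ◁ hj ≫ gj = tj) (hgk : (α_ _ _ _).hom ≫ X ◁ hk ≫ gk = tk) :
    (X ◁ hj) ▷ H ≫ (α_ _ _ _).hom ≫ X ◁ c ≫ gk = (X ◁ hj) ▷ H ≫ gj ▷ H ≫ g := by
  have h₂' := congrArg (fun x => X ◁ x) h₂
  simp only [MonoidalCategory.whiskerLeft_comp] at h₂'
  rw [← cancel_epi ((α_ X A B).hom ▷ H), associator_naturality_middle_assoc, ← reassoc_of% h₂',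
    ← comp_whiskerRight_assoc, ← comp_whiskerRight_assoc, Category.assoc, hgj, ← h₁, ← hgk]
  simp

theorem coherence_bal_act {A A' M B B' D D' H C : V} {a : A ⊗ M ⟶ A'} {mj : M ⊗ B' ⟶ B}
    {mk : M ⊗ D' ⟶ D} {s : B ⊗ H ⟶ D} {s' : B' ⊗ H ⟶ D'} {hk : A ⊗ D ⟶ C} {hk' : A' ⊗ D' ⟶ C}
    (hb : a ▷ D' ≫ hk' = (α_ _ _ _).hom ≫ A ◁ mk ≫ hk)
    (hgr : (α_ _ _ _).hom ≫ M ◁ s' ≫ mk = mj ▷ H ≫ s) :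
    (a ▷ B') ▷ H ≫ (α_ _ _ _).hom ≫ A' ◁ s' ≫ hk' =
      ((α_ _ _ _).hom ≫ A ◁ mj) ▷ H ≫ (α_ _ _ _).hom ≫ A ◁ s ≫ hk := by
  have h₂' := congrArg (fun x => A ◁ x) hgr
  simp only [MonoidalCategory.whiskerLeft_comp] at h₂'
  rw [associator_naturality_left_assoc, ← whisker_exchange_assoc, hb, comp_whiskerRight_assoc,
    associator_naturality_middle_assoc, ← reassoc_of% h₂']
  simp

theorem coherence_act_id {A B C H : V} {h : A ⊗ B ⟶ C} {m : C ⊗ H ⟶ C} {s : B ⊗ H ⟶ B}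
    {e : 𝟙_ V ⟶ H} (hm : h ▷ H ≫ m = (α_ _ _ _).hom ≫ A ◁ s ≫ h)
    (he : B ◁ e ≫ s = (ρ_ _).hom) : h ▷ _ ≫ C ◁ e ≫ m = h ▷ _ ≫ (ρ_ _).hom := by
  have h₂' := congrArg (fun x => A ◁ x) he
  simp only [MonoidalCategory.whiskerLeft_comp] at h₂'
  rw [← whisker_exchange_assoc, hm, associator_naturality_right_assoc, reassoc_of% h₂']
  simp

theorem coherence_act_comp {A B B' B'' C C' C'' H H' H'' : V} {h : A ⊗ B ⟶ C} {h' : A ⊗ B' ⟶ C'}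
    {h'' : A ⊗ B'' ⟶ C''} {s : B ⊗ H ⟶ B'} {s' : B' ⊗ H' ⟶ B''} {s'' : B ⊗ H'' ⟶ B''}
    {m : C ⊗ H ⟶ C'} {m' : C' ⊗ H' ⟶ C''} {m'' : C ⊗ H'' ⟶ C''} {κ : H ⊗ H' ⟶ H''}
    (hm : h ▷ H ≫ m = (α_ _ _ _).hom ≫ A ◁ s ≫ h')
    (hm' : h' ▷ H' ≫ m' = (α_ _ _ _).hom ≫ A ◁ s' ≫ h'')
    (hm'' : h ▷ H'' ≫ m'' = (α_ _ _ _).hom ≫ A ◁ s'' ≫ h'')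
    (hs : (α_ _ _ _).hom ≫ B ◁ κ ≫ s'' = s ▷ H' ≫ s') :
    h ▷ (H ⊗ H') ≫ (α_ _ _ _).inv ≫ (α_ _ _ _).hom ≫ C ◁ κ ≫ m'' =
      h ▷ (H ⊗ H') ≫ (α_ _ _ _).inv ≫ m ▷ H' ≫ m' := by
  have h₁ := congrArg (fun x => A ◁ x) hs
  simp only [MonoidalCategory.whiskerLeft_comp] at h₁
  have h₂ := congrArg (fun x => x ▷ H') hm
  simp only [comp_whiskerRight] at h₂
  rw [Iso.inv_hom_id_assoc, ← whisker_exchange_assoc, hm'', associator_inv_naturality_left_assoc,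
    reassoc_of% h₂, hm', associator_naturality_middle_assoc, ← reassoc_of% h₁]
  simp

end Coherence

/-! ### Colimits in functor categories. -/

section ColimitsOfPresheaves

variable [MonoidalClosed V] [HasLimitsOfSize.{w, w} V] {L : Type u₁} [EnrichedCategory V L]
  {J : Type u₂} [EnrichedCategory V J] [IsSmall V J]

/-- Composition in `[J, V]` is computed by its projections, so evaluating a composite is evaluating
twice. -/
theorem braiding_tensor_eComp_evF {X Y : V} {F G H : EnrichedFunctor V J V} (f : X ⟶ (G ⟶[V] H))
    (g : Y ⟶ (F ⟶[V] G)) (j : J) :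
    ((β_ X Y).hom ≫ (g ⊗ₘ f) ≫ eComp V F G H) ▷ F.obj j ≫ evF F H j =
      (α_ X Y _).hom ≫ X ◁ (g ▷ _ ≫ evF F G j) ≫ f ▷ _ ≫ evF G H j := by
  simp only [evF, whiskerRight_bunc]
  rw [← bunc_braiding_tensor_eComp, Category.assoc, Category.assoc, eComp_projF,
    tensorHom_comp_tensorHom_assoc]

/-- The left action of `L` on the values of a functor `L ⟶ [J, V]`. -/
def lact (S : EnrichedFunctor V L (EnrichedFunctor V J V)) (l l' : L) (j : J) :
    (l ⟶[V] l') ⊗ (S.obj l).obj j ⟶ (S.obj l').obj j :=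
  S.map l l' ▷ _ ≫ evF _ _ j

theorem lact_isGr (S : EnrichedFunctor V L (EnrichedFunctor V J V)) (l l' : L) :
    IsGr (l ⟶[V] l') (S.obj l) (S.obj l') (lact S l l') := whiskerRight_evF_isGr _

theorem lactV_comp_evFunctor (S : EnrichedFunctor V L (EnrichedFunctor V J V)) (l l' : L) (j : J) :
    lactV (S.comp V (evFunctor j)) l l' = lact S l l' j := by
  rw [lact, evF, whiskerRight_bunc]
  rfl

/-- Families `χ l ⊗ S l j ⟶ G j` that are balanced over `L`. -/
def BalF (χ : EnrichedFunctor V Lᵒᵖ V) (S : EnrichedFunctor V L (EnrichedFunctor V J V))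
    (G : EnrichedFunctor V J V) (u : ∀ (l : Lᵒᵖ) (j : J), χ.obj l ⊗ (S.obj l.unop).obj j ⟶ G.obj j) :
    Prop :=
  ∀ (l l' : Lᵒᵖ) (j : J), act χ l l' ▷ _ ≫ u l' j =
    (α_ _ _ _).hom ≫ χ.obj l ◁ lact S l'.unop l.unop j ≫ u l j

theorem balF_iff_balV {χ : EnrichedFunctor V Lᵒᵖ V}
    {S : EnrichedFunctor V L (EnrichedFunctor V J V)} {G : EnrichedFunctor V J V}
    {u : ∀ (l : Lᵒᵖ) (j : J), χ.obj l ⊗ (S.obj l.unop).obj j ⟶ G.obj j} :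
    BalF χ S G u ↔ ∀ j, BalV χ (S.comp V (evFunctor j)) (G.obj j) (fun l => u l j) := by
  have (j : J) : BalV χ (S.comp V (evFunctor j)) (G.obj j) (fun l => u l j) ↔
      ∀ (l l' : Lᵒᵖ), act χ l l' ▷ _ ≫ u l' j =
        (α_ _ _ _).hom ≫ χ.obj l ◁ lact S l'.unop l.unop j ≫ u l j := by
    simp only [BalV, lactV_comp_evFunctor]
    rfl
  simp only [this]
  exact ⟨fun h j l l' => h l l' j, fun h l l' j => h j l l'⟩

theorem isCone₁_op_iff_balF {χ : EnrichedFunctor V Lᵒᵖ V}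
    {S : EnrichedFunctor V L (EnrichedFunctor V J V)} {G : EnrichedFunctor V J V}
    {t : ∀ l, χ.obj l ⟶ (S.obj l.unop ⟶[V] G)} :
    IsCone₁ χ (opFunctor S) (op G) t ↔ BalF χ S G (fun l j => t l ▷ _ ≫ evF _ _ j) := by
  refine forall_congr' fun l => forall_congr' fun l' => ?_
  have key := tensorHom_eComp_op (t l) (S.map l'.unop l.unop)
  refine (Eq.congr_right key).trans ?_
  have h₁ (j : J) := comp_whiskerRight_assoc (act χ l l') (t l') ((S.obj l'.unop).obj j)
    (evF (S.obj l'.unop) G j)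
  have h₂ (j : J) := braiding_tensor_eComp_evF (t l) (S.map l'.unop l.unop) j
  constructor
  · intro h j
    have h' := congrArg (fun x => x ▷ (S.obj l'.unop).obj j ≫ evF (S.obj l'.unop) G j) h
    exact ((h₁ j).symm.trans h').trans (h₂ j)
  · intro h
    refine evF_ext fun j => (h₁ j).trans ((h j).trans (h₂ j).symm)

theorem exists_isCone₁_of_balF {χ : EnrichedFunctor V Lᵒᵖ V}
    {S : EnrichedFunctor V L (EnrichedFunctor V J V)} {G : EnrichedFunctor V J V}
    {u : ∀ (l : Lᵒᵖ) (j : J), χ.obj l ⊗ (S.obj l.unop).obj j ⟶ G.obj j}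
    (h₁ : ∀ l, IsGr (χ.obj l) (S.obj l.unop) G (u l)) (h₂ : BalF χ S G u) :
    ∃ t : ∀ l, χ.obj l ⟶ (S.obj l.unop ⟶[V] G), IsCone₁ χ (opFunctor S) (op G) t ∧
      ∀ l j, t l ▷ _ ≫ evF _ _ j = u l j := by
  choose t ht using fun l => (h₁ l).exists_lift
  refine ⟨t, isCone₁_op_iff_balF.2 ?_, ht⟩
  simp only [ht]
  exact h₂

/-- The balanced family of a cocone. -/
def fam {χ : EnrichedFunctor V Lᵒᵖ V} {S : EnrichedFunctor V L (EnrichedFunctor V J V)}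
    {c : EnrichedFunctor V J V} (η : ∀ l : Lᵒᵖ, χ.obj l ⟶ (S.obj l.unop ⟶[V] c)) (l : Lᵒᵖ) (j : J) :
    χ.obj l ⊗ (S.obj l.unop).obj j ⟶ c.obj j := η l ▷ _ ≫ evF _ _ j

theorem fam_isGr {χ : EnrichedFunctor V Lᵒᵖ V} {S : EnrichedFunctor V L (EnrichedFunctor V J V)}
    {c : EnrichedFunctor V J V} (η : ∀ l : Lᵒᵖ, χ.obj l ⟶ (S.obj l.unop ⟶[V] c)) (l : Lᵒᵖ) :
    IsGr (χ.obj l) (S.obj l.unop) c (fam η l) := whiskerRight_evF_isGr _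

theorem tensor_eComp_op_evF {χ : EnrichedFunctor V Lᵒᵖ V}
    {S : EnrichedFunctor V L (EnrichedFunctor V J V)} {c G : EnrichedFunctor V J V}
    (η : ∀ l : Lᵒᵖ, χ.obj l ⟶ (S.obj l.unop ⟶[V] c)) {X : V} (f : X ⟶ (c ⟶[V] G)) (l : Lᵒᵖ) (j : J) :
    ((f ⊗ₘ η l) ≫ eComp V (op G) (op c) (op (S.obj l.unop))) ▷ (S.obj l.unop).obj j ≫
        evF (S.obj l.unop) G j =
      (α_ _ _ _).hom ≫ X ◁ fam η l j ≫ f ▷ _ ≫ evF c G j := by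
  have h := tensorHom_eComp_op f (η l)
  exact (congrArg (fun x => x ▷ (S.obj l.unop).obj j ≫ evF (S.obj l.unop) G j) h).trans
    (braiding_tensor_eComp_evF f (η l) j)

namespace IsWeightedColimit

variable {χ : EnrichedFunctor V Lᵒᵖ V} {S : EnrichedFunctor V L (EnrichedFunctor V J V)}
    {c : EnrichedFunctor V J V} {η : ∀ l : Lᵒᵖ, χ.obj l ⟶ (S.obj l.unop ⟶[V] c)}

theorem fam_balF (h : IsWeightedColimit χ S c η) : BalF χ S c (fam η) :=
  isCone₁_op_iff_balF.1 (isWeightedColimit_iff_op.1 h).cone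

theorem exists_desc (h : IsWeightedColimit χ S c η) {G : EnrichedFunctor V J V} {X : V}
    {u : ∀ (l : Lᵒᵖ) (j : J), (X ⊗ χ.obj l) ⊗ (S.obj l.unop).obj j ⟶ G.obj j}
    (hu : ∀ l, IsGr (X ⊗ χ.obj l) (S.obj l.unop) G (u l)) (hu' : BalF (tensorL X χ) S G u) :
    ∃ g : ∀ j, X ⊗ c.obj j ⟶ G.obj j, IsGr X c G g ∧
      ∀ l j, (α_ _ _ _).hom ≫ X ◁ fam η l j ≫ g j = u l j := by
  obtain ⟨t, ht, ht'⟩ := exists_isCone₁_of_balF (χ := tensorL X χ) hu hu'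
  obtain ⟨f, hf⟩ := (isWeightedColimit_iff_op.1 h).exists_lift (isCone_iff_tensorL.2 ht)
  refine ⟨fun j => f ▷ _ ≫ evF c G j, whiskerRight_evF_isGr f, fun l j => ?_⟩
  rw [← ht' l j]
  refine (tensor_eComp_op_evF η f l j).symm.trans ?_
  exact congrArg (fun x => x ▷ (S.obj l.unop).obj j ≫ evF (S.obj l.unop) G j) (hf l)

theorem hom_ext (h : IsWeightedColimit χ S c η) {G : EnrichedFunctor V J V} {X : V}
    {g g' : ∀ j, X ⊗ c.obj j ⟶ G.obj j} (hg : IsGr X c G g) (hg' : IsGr X c G g')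
    (hgg' : ∀ l j, X ◁ fam η l j ≫ g j = X ◁ fam η l j ≫ g' j) (j : J) : g j = g' j := by
  obtain ⟨f, hf⟩ := hg.exists_lift
  obtain ⟨f', hf'⟩ := hg'.exists_lift
  have : f = f' := (isWeightedColimit_iff_op.1 h).hom_ext (a := op G) fun l => evF_ext fun j => by
    refine (tensor_eComp_op_evF η f l j).trans (Eq.trans ?_ (tensor_eComp_op_evF η f' l j).symm)
    rw [hf, hf', hgg']
  rw [← hf, ← hf', this]

end IsWeightedColimit

/-- Colimits in functor categories are computed pointwise. -/
theorem isWeightedColimit_of_pointwise {χ : EnrichedFunctor V Lᵒᵖ V}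
    {S : EnrichedFunctor V L (EnrichedFunctor V J V)} {c : EnrichedFunctor V J V}
    {η : ∀ l : Lᵒᵖ, χ.obj l ⟶ (S.obj l.unop ⟶[V] c)}
    (H : ∀ j, IsColimV χ (S.comp V (evFunctor j)) (c.obj j) (fun l => fam η l j)) :
    IsWeightedColimit χ S c η := by
  refine isWeightedColimit_iff_op.2 (isWeightedLimit_iff.2
    ⟨isCone₁_op_iff_balF.2 (balF_iff_balV.2 fun j => (H j).bal), fun a X t ht => ?_⟩)
  have hb := isCone₁_op_iff_balF.1 (isCone_iff_tensorL.1 ht)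
  choose g hg using fun j => (H j).desc_left (fun l => t l ▷ _ ≫ evF (S.obj l.unop) a.unop j)
    (balF_iff_balV.1 hb j)
  -- Linearity of the pointwise descents is tested on the colimit family, where it is linearity of
  -- the given cocone.
  have hgr : IsGr X c a.unop g := fun j k => (H j).ext_both fun l =>
    coherence_gr_desc (whiskerRight_evF_isGr (t l) j k) (fam_isGr η l j k) (hg j l) (hg k l)
  obtain ⟨f, hf⟩ := hgr.exists_lift
  refine ⟨f, fun l => evF_ext fun j => ?_, fun f' hf' => evF_ext fun j => ?_⟩
  · refine (tensor_eComp_op_evF η f l j).trans ?_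
    rw [hf]
    exact hg j l
  · rw [hf]
    refine (H j).ext_left fun l => ?_
    rw [← cancel_epi (α_ _ _ _).hom]
    refine (tensor_eComp_op_evF η f' l j).symm.trans (Eq.trans ?_ (hg j l).symm)
    exact congrArg (fun x => x ▷ (S.obj l.unop).obj j ≫ evF (S.obj l.unop) a.unop j) (hf' l)

/-- Functor categories have small colimits. -/
theorem exists_isWeightedColimit [HasColimits V] [IsSmall V L] (χ : EnrichedFunctor V Lᵒᵖ V)
    (S : EnrichedFunctor V L (EnrichedFunctor V J V)) : ∃ c η, IsWeightedColimit χ S c η := by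
  choose c h H using fun j => exists_isColimV χ (S.comp V (evFunctor j))
  have hb (j : J) (l l' : Lᵒᵖ) : act χ l l' ▷ _ ≫ h j l' =
        (α_ _ _ _).hom ≫ χ.obj l ◁ lact S l'.unop l.unop j ≫ h j l := by
    have := (H j).bal l l'
    rw [lactV_comp_evFunctor] at this
    exact this
  -- The action on the pointwise colimits is induced by the actions of the `S l`, using that `- ⊗
  -- J(j, k)` preserves the colimit; the module laws are inherited in the same way.
  have hex (j k : J) : ∃ g : c j ⊗ (j ⟶[V] k) ⟶ c k, ∀ l, h j l ▷ _ ≫ g =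
      (α_ _ _ _).hom ≫ χ.obj l ◁ act (S.obj l.unop) j k ≫ h k l := by
    refine (H j).desc_right _ fun l l' => ?_
    rw [lactV_comp_evFunctor]
    exact coherence_bal_act (hb k l l') (lact_isGr S l'.unop l.unop j k)
  choose m hm using hex
  let C : EnrichedFunctor V J V := ofAct c m
    (fun j => (H j).ext_right fun l => coherence_act_id (hm j j l) (act_id (S.obj l.unop) j))
    (fun i j k => (cancel_epi (α_ _ _ _).inv).1 ((H i).ext_right fun l =>
      coherence_act_comp (hm i j l) (hm j k l) (hm i k l) (act_comp (S.obj l.unop) i j k)))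
  have hgr (l : Lᵒᵖ) : IsGr (χ.obj l) (S.obj l.unop) C (fun j => h j l) := fun j k => by
    rw [act_ofAct]
    exact (hm j k l).symm
  obtain ⟨η, hη, hη'⟩ := exists_isCone₁_of_balF hgr (fun l l' j => hb j l l')
  refine ⟨C, η, isWeightedColimit_of_pointwise fun j => ?_⟩
  have : (fun l => fam η l j) = h j := funext fun l => hη' l j
  rw [this]
  exact H j

end ColimitsOfPresheaves

end VCat

end

noncomputable section

namespace VCat

variable {V : Type u} [Category.{w} V] [MonoidalCategory V] [SymmetricCategory V]

/-! ### Iterated limits: `{χ * S, T}` as `{χ, {S-, T}}`. -/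

section IteratedLimits

variable [MonoidalClosed V] [HasLimitsOfSize.{w, w} V] {L : Type u₁} [EnrichedCategory V L]
  {J : Type u₂} [EnrichedCategory V J] [IsSmall V J] {C : Type u₃} [EnrichedCategory V C]

theorem eId_lact (S : EnrichedFunctor V L (EnrichedFunctor V J V)) (l : L) (j : J) :
    eId V l ▷ _ ≫ lact S l l j = (λ_ _).hom := by
  rw [lact, ← comp_whiskerRight_assoc, S.map_id, eId_evF]

theorem eComp_lact (S : EnrichedFunctor V L (EnrichedFunctor V J V)) (x y z : L) (j : J) :
    ((β_ (y ⟶[V] x) (z ⟶[V] y)).hom ≫ eComp V z y x) ▷ _ ≫ lact S z x j =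
      (α_ _ _ _).hom ≫ (y ⟶[V] x) ◁ lact S z y j ≫ lact S y x j := by
  have h := braiding_tensor_eComp_evF (S.map y x) (S.map z y) j
  rw [← S.map_comp, ← Category.assoc, comp_whiskerRight, Category.assoc] at h
  exact h

/-- The functor `Lᵒᵖ ⟶ C` formed by limits `{S l, T}`. -/
theorem exists_limFunctor {S : EnrichedFunctor V L (EnrichedFunctor V J V)}
    {T : EnrichedFunctor V J C} {lam : L → C}
    {μ : ∀ l j, (S.obj l).obj j ⟶ (lam l ⟶[V] T.obj j)}
    (hμ : ∀ l, IsWeightedLimit (S.obj l) T (lam l) (μ l)) :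
    ∃ m : ∀ l l' : L, (l ⟶[V] l') ⟶ (lam l' ⟶[V] lam l),
      (∀ l l' j, (m l l' ⊗ₘ μ l j) ≫ eComp V _ _ _ = lact S l l' j ≫ μ l' j) ∧
      (∀ l, eId V l ≫ m l l = eId V (lam l)) ∧
      ∀ x y z : L, ((β_ (y ⟶[V] x) (z ⟶[V] y)).hom ≫ eComp V z y x) ≫ m z x =
        (m y x ⊗ₘ m z y) ≫ eComp V _ _ _ := by
  -- A limit is contravariant in its weight: `m` comes from restricting the cone at `l'` along the
  -- action `S l ⟶ S l'`.
  have hm (l l' : L) : ∃ m : (l ⟶[V] l') ⟶ (lam l' ⟶[V] lam l),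
      ∀ j, (m ⊗ₘ μ l j) ≫ eComp V _ _ _ = lact S l l' j ≫ μ l' j :=
    (hμ l).exists_lift fun j k => by
      have h₁ := lact_isGr S l l' j k
      rw [← Category.assoc, ← whiskerRight_comp_tensorHom_assoc, ← (hμ l').cone j k, Category.assoc]
      exact (reassoc_of% h₁) _
  choose m hm using hm
  refine ⟨m, hm, fun l => (hμ l).hom_ext fun j => ?_, fun x y z => (hμ z).hom_ext fun j => ?_⟩
  · have := eId_lact S l j
    rw [← whiskerRight_comp_tensorHom_assoc, hm, reassoc_of% this, eId_tensor_eComp]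
  · have := eComp_lact S x y z j
    rw [← whiskerRight_comp_tensorHom_assoc, hm, reassoc_of% this, ← eComp_assoc3, hm,
      ← whiskerLeft_comp_tensorHom_assoc, hm]

/-- The functor `Lᵒᵖ ⟶ C` formed by limits `{S l, T}`. -/
def limFunctor {S : EnrichedFunctor V L (EnrichedFunctor V J V)}
    {T : EnrichedFunctor V J C} {lam : L → C}
    {μ : ∀ l j, (S.obj l).obj j ⟶ (lam l ⟶[V] T.obj j)}
    (hμ : ∀ l, IsWeightedLimit (S.obj l) T (lam l) (μ l)) : EnrichedFunctor V Lᵒᵖ C where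
  obj l := lam l.unop
  map l l' := (exists_limFunctor hμ).choose l'.unop l.unop
  map_id l := (exists_limFunctor hμ).choose_spec.2.1 l.unop
  map_comp x y z := (exists_limFunctor hμ).choose_spec.2.2 x.unop y.unop z.unop

/-- The compatibility of a family of cones with the functor formed by the vertices. -/
def IsLimFamily (S : EnrichedFunctor V L (EnrichedFunctor V J V)) (T : EnrichedFunctor V J C)
    (Λ : EnrichedFunctor V Lᵒᵖ C) (μ : ∀ l j, (S.obj l).obj j ⟶ (Λ.obj (op l) ⟶[V] T.obj j)) :
    Prop :=
  ∀ l l' j, (Λ.map (op l') (op l) ⊗ₘ μ l j) ≫ eComp V _ _ _ = lact S l l' j ≫ μ l' j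

theorem limFunctor_isLimFamily {S : EnrichedFunctor V L (EnrichedFunctor V J V)}
    {T : EnrichedFunctor V J C} {lam : L → C}
    {μ : ∀ l j, (S.obj l).obj j ⟶ (lam l ⟶[V] T.obj j)}
    (hμ : ∀ l, IsWeightedLimit (S.obj l) T (lam l) (μ l)) : IsLimFamily S T (limFunctor hμ) μ :=
  (exists_limFunctor hμ).choose_spec.1

theorem IsLimFamily.map {D : Type*} [EnrichedCategory V D]
    {S : EnrichedFunctor V L (EnrichedFunctor V J V)} {T : EnrichedFunctor V J C}
    {Λ : EnrichedFunctor V Lᵒᵖ C} {μ : ∀ l j, (S.obj l).obj j ⟶ (Λ.obj (op l) ⟶[V] T.obj j)}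
    (h : IsLimFamily S T Λ μ) (F : EnrichedFunctor V C D) :
    IsLimFamily S (T.comp V F) (Λ.comp V F) (fun l j => μ l j ≫ F.map _ _) := fun l l' j => by
  change ((Λ.map _ _ ≫ F.map _ _) ⊗ₘ (μ l j ≫ F.map _ _)) ≫ eComp V _ _ _ = _ ≫ _ ≫ F.map _ _
  rw [← tensorHom_comp_tensorHom_assoc, ← F.map_comp, reassoc_of% (h l l' j)]

theorem coherence_bal_comp {X A M A' B B' E v : V} {a : A ⊗ M ⟶ A'} {m : M ⊗ B' ⟶ B}
    {h : A ⊗ B ⟶ E} {h' : A' ⊗ B' ⟶ E} (t : X ⊗ E ⟶ v)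
    (hb : a ▷ B' ≫ h' = (α_ _ _ _).hom ≫ A ◁ m ≫ h) :
    ((α_ X A M).hom ≫ X ◁ a) ▷ B' ≫ (α_ _ _ _).hom ≫ X ◁ h' ≫ t =
      (α_ (X ⊗ A) M B').hom ≫ (X ⊗ A) ◁ m ≫ (α_ _ _ _).hom ≫ X ◁ h ≫ t := by
  have h₁ := congrArg (fun x => X ◁ x) hb
  simp only [MonoidalCategory.whiskerLeft_comp] at h₁
  rw [comp_whiskerRight_assoc, associator_naturality_middle_assoc, reassoc_of% h₁]
  simp

/-- The limit of `T` weighted by the colimit `χ * S` is the limit, weighted by `χ`, of the limits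
`{S l, T}`. -/
theorem isWeightedLimit_of_iterated {χ : EnrichedFunctor V Lᵒᵖ V}
    {S : EnrichedFunctor V L (EnrichedFunctor V J V)} {φ : EnrichedFunctor V J V}
    {η : ∀ l : Lᵒᵖ, χ.obj l ⟶ (S.obj l.unop ⟶[V] φ)} (hφ : IsWeightedColimit χ S φ η)
    {T : EnrichedFunctor V J C} {Λ : EnrichedFunctor V Lᵒᵖ C}
    {μ : ∀ l j, (S.obj l).obj j ⟶ (Λ.obj (op l) ⟶[V] T.obj j)}
    (hμ : ∀ l, IsWeightedLimit (S.obj l) T (Λ.obj (op l)) (μ l)) (hΛ : IsLimFamily S T Λ μ)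
    {p : C} {κ : ∀ l, χ.obj l ⟶ (p ⟶[V] Λ.obj l)} (hκ : IsWeightedLimit χ Λ p κ)
    {ν : ∀ j, φ.obj j ⟶ (p ⟶[V] T.obj j)} (hν : IsCone₁ φ T p ν)
    (hνκ : ∀ l j, fam η l j ≫ ν j = (κ l ⊗ₘ μ l.unop j) ≫ eComp V _ _ _) :
    IsWeightedLimit φ T p ν := by
  have hfac {a : C} {X : V} (f : X ⟶ (a ⟶[V] p)) (l : Lᵒᵖ) (j : J) :
      (α_ _ _ _).hom ≫ X ◁ fam η l j ≫ (f ⊗ₘ ν j) ≫ eComp V _ _ _ =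
        (((f ⊗ₘ κ l) ≫ eComp V _ _ _) ⊗ₘ μ l.unop j) ≫ eComp V _ _ _ := by
    rw [whiskerLeft_comp_tensorHom_assoc, hνκ, eComp_assoc3]
  refine isWeightedLimit_iff.2 ⟨hν, fun a X t ht => ?_⟩
  -- Restricting the `φ`-cone `t` along the colimit family gives an `S l`-cone, which factors
  -- through `{S l, T}` as `s l`; these factors form a `χ`-cone on `Λ`.
  have hs (l : Lᵒᵖ) := (hμ l.unop).exists_lift
    (isCone_iff.2 ((fam_isGr η l).comp (isCone_iff.1 ht)))
  choose s hs using hs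
  have hsc : IsCone χ Λ a X s := fun l l' => (hμ l'.unop).hom_ext fun j => by
    have h₁ := coherence_bal_comp (X := X) (t j) (hφ.fam_balF l l' j)
    have h₂ : (Λ.map l l' ⊗ₘ μ l'.unop j) ≫ eComp V _ _ _ = _ := hΛ l'.unop l.unop j
    have h₃ := whiskerRight_comp_tensorHom_assoc ((α_ X (χ.obj l) _).hom ≫ X ◁ act χ l l') (s l')
      (μ l'.unop j) (eComp V _ _ _)
    rw [hs] at h₃
    rw [← Category.assoc]
    refine h₃.symm.trans (h₁.trans ?_)
    rw [← eComp_assoc3]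
    refine Eq.trans ?_ (congrArg (fun x => (α_ _ _ _).hom ≫ (s l ⊗ₘ x) ≫ eComp V _ _ _) h₂).symm
    rw [← whiskerLeft_comp_tensorHom_assoc, hs]
    rfl
  obtain ⟨f, hf⟩ := hκ.exists_lift hsc
  -- Factoring `t` through `ν` and factoring `s` through `κ` are the same condition, one direction
  -- by the limits `{S l, T}` and the other by the colimit `φ`.
  have key (g : X ⟶ (a ⟶[V] p)) : (∀ j, (g ⊗ₘ ν j) ≫ eComp V _ _ _ = t j) ↔
      ∀ l, (g ⊗ₘ κ l) ≫ eComp V _ _ _ = s l := by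
    constructor
    · intro hg l
      refine (hμ l.unop).hom_ext fun j => ?_
      rw [hs]
      refine (hfac g l j).symm.trans ?_
      rw [hg]
      rfl
    · intro hg j
      refine hφ.hom_ext (isCone_iff.1 (hν.isCone g)) (isCone_iff.1 ht) (fun l j => ?_) j
      rw [← cancel_epi (α_ _ _ _).hom]
      refine (hfac g l j).trans ?_
      rw [hg, hs]
  exact ⟨f, (key f).2 hf, fun g hg => hκ.hom_ext fun l => by rw [hf, (key g).1 hg]⟩

theorem coherence_bal_unit {A M A' B B' E : V} {a : A ⊗ M ⟶ A'} {m : M ⊗ B' ⟶ B}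
    {h : A ⊗ B ⟶ E} {h' : A' ⊗ B' ⟶ E} (hb : a ▷ B' ≫ h' = (α_ _ _ _).hom ≫ A ◁ m ≫ h) :
    ((α_ (𝟙_ V) A M).hom ≫ 𝟙_ V ◁ a) ▷ B' ≫ (λ_ _).hom ▷ _ ≫ h' =
      (α_ (𝟙_ V ⊗ A) M B').hom ≫ (𝟙_ V ⊗ A) ◁ m ≫ (λ_ _).hom ▷ _ ≫ h := by
  have e : ((α_ (𝟙_ V) A M).hom ≫ 𝟙_ V ◁ a) ≫ (λ_ _).hom = (λ_ _).hom ▷ _ ≫ a := by simp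
  rw [← comp_whiskerRight_assoc, e, comp_whiskerRight_assoc, hb, whisker_exchange_assoc,
    associator_naturality_left_assoc]

theorem IsWeightedColimit.exists_descU {χ : EnrichedFunctor V Lᵒᵖ V}
    {S : EnrichedFunctor V L (EnrichedFunctor V J V)} {c : EnrichedFunctor V J V}
    {η : ∀ l : Lᵒᵖ, χ.obj l ⟶ (S.obj l.unop ⟶[V] c)} (h : IsWeightedColimit χ S c η)
    {G : EnrichedFunctor V J V} {u : ∀ (l : Lᵒᵖ) (j : J), χ.obj l ⊗ (S.obj l.unop).obj j ⟶ G.obj j}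
    (hu : ∀ l, IsGr (χ.obj l) (S.obj l.unop) G (u l)) (hu' : BalF χ S G u) :
    ∃ g : ∀ j, c.obj j ⟶ G.obj j, (∀ j k, act c j k ≫ g k = g j ▷ _ ≫ act G j k) ∧
      ∀ l j, fam η l j ≫ g j = u l j := by
  obtain ⟨g, hg, hg'⟩ := h.exists_desc (X := 𝟙_ V) (u := fun l j => (λ_ _).hom ▷ _ ≫ u l j)
    (fun l => (hu l).precomp _) (fun l l' j => by
      rw [act_tensorL]
      exact coherence_bal_unit (hu' l l' j))
  refine ⟨fun j => (λ_ _).inv ≫ g j, fun j k => ?_, fun l j => ?_⟩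
  · have h₁ := hg j k
    rw [leftUnitor_inv_naturality_assoc, comp_whiskerRight_assoc, ← h₁]
    simp
  · have h₁ := hg' l j
    rw [leftUnitor_inv_naturality_assoc, ← cancel_epi ((λ_ _).hom ▷ _), ← h₁]
    simp

theorem exists_isCone₁_of_iterated {χ : EnrichedFunctor V Lᵒᵖ V}
    {S : EnrichedFunctor V L (EnrichedFunctor V J V)} {φ : EnrichedFunctor V J V}
    {η : ∀ l : Lᵒᵖ, χ.obj l ⟶ (S.obj l.unop ⟶[V] φ)} (hφ : IsWeightedColimit χ S φ η)
    {T : EnrichedFunctor V J C} {Λ : EnrichedFunctor V Lᵒᵖ C}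
    {μ : ∀ l j, (S.obj l).obj j ⟶ (Λ.obj (op l) ⟶[V] T.obj j)}
    (hμ : ∀ l, IsCone₁ (S.obj l) T (Λ.obj (op l)) (μ l)) (hΛ : IsLimFamily S T Λ μ)
    {p : C} {κ : ∀ l, χ.obj l ⟶ (p ⟶[V] Λ.obj l)} (hκ : IsCone₁ χ Λ p κ) :
    ∃ ν : ∀ j, φ.obj j ⟶ (p ⟶[V] T.obj j), IsCone₁ φ T p ν ∧
      ∀ l j, fam η l j ≫ ν j = (κ l ⊗ₘ μ l.unop j) ≫ eComp V _ _ _ := by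
  obtain ⟨ν, hν, hν'⟩ := hφ.exists_descU (G := T.comp V (homFrom p))
    (u := fun l j => (κ l ⊗ₘ μ l.unop j) ≫ eComp V _ _ _)
    (fun l => isCone_iff.1 ((hμ l.unop).isCone (κ l))) (fun l l' j => by
      have h₂ : (Λ.map l l' ⊗ₘ μ l'.unop j) ≫ eComp V _ _ _ = _ := hΛ l'.unop l.unop j
      have h₃ := whiskerRight_comp_tensorHom_assoc (act χ l l') (κ l') (μ l'.unop j) (eComp V _ _ _)
      refine h₃.trans ?_
      rw [hκ l l', ← eComp_assoc3]
      refine (congrArg (fun x => (α_ _ _ _).hom ≫ (κ l ⊗ₘ x) ≫ eComp V _ _ _) h₂).trans ?_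
      exact congrArg _ (whiskerLeft_comp_tensorHom_assoc _ _ _ _).symm)
  exact ⟨ν, isCone₁_iff.2 ((isVNatural_iff _ (T.comp V (homFrom p)) _).2 hν), hν'⟩

end IteratedLimits

/-! ### Weights whose limits exist and are preserved by a given functor. -/

section Good

variable [MonoidalClosed V] {J : Type u₂} [EnrichedCategory V J]
  {C : Type u₁} [EnrichedCategory V C] {D : Type u₃} [EnrichedCategory V D]

/-- `C` has all `φ`-weighted limits and `F` preserves them. -/
def HasPreserves (F : EnrichedFunctor V C D) (φ : EnrichedFunctor V J V) : Prop :=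
  ∀ T : EnrichedFunctor V J C, ∃ p ν, IsWeightedLimit φ T p ν ∧
    IsWeightedLimit φ (T.comp V F) (F.obj p) (fun j => ν j ≫ F.map _ _)

theorem hasPreserves_iff {F : EnrichedFunctor V C D} {φ : EnrichedFunctor V J V} :
    HasPreserves F φ ↔ ∀ T : EnrichedFunctor V J C, (∃ p ν, IsWeightedLimit φ T p ν) ∧
      PreservesWeightedLimit F φ T :=
  ⟨fun h T => let ⟨p, ν, hν, hν'⟩ := h T; ⟨⟨p, ν, hν⟩, hν.preserves_of F hν'⟩,
    fun h T => let ⟨⟨p, ν, hν⟩, h'⟩ := h T; ⟨p, ν, hν, h' p ν hν⟩⟩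

theorem hasPreserves_homFrom (F : EnrichedFunctor V C D) (j₀ : J) :
    HasPreserves F (homFrom j₀) := fun T =>
  ⟨_, _, isWeightedLimit_homFrom T j₀, isWeightedLimit_homFrom (T.comp V F) j₀⟩

theorem tensor_eComp_map (F : EnrichedFunctor V C D) {A B : V} {x y z : C}
    (f : A ⟶ (x ⟶[V] y)) (g : B ⟶ (y ⟶[V] z)) : ((f ⊗ₘ g) ≫ eComp V x y z) ≫ F.map x z =
      ((f ≫ F.map x y) ⊗ₘ (g ≫ F.map y z)) ≫ eComp V _ _ _ := by
  rw [Category.assoc, F.map_comp, tensorHom_comp_tensorHom_assoc]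

variable [HasLimitsOfSize.{w, w} V] [IsSmall V J]

/-- The iterated-limit formula is applied twice to the same data, in `C` and after `F` in `D`; the
cone it produces in `C` is sent by `F` to the one in `D`. -/
theorem HasPreserves.colimit {F : EnrichedFunctor V C D} {L : Type*} [EnrichedCategory V L]
    {χ : EnrichedFunctor V Lᵒᵖ V}
    {S : EnrichedFunctor V L (EnrichedFunctor V J V)} {φ : EnrichedFunctor V J V}
    {η : ∀ l : Lᵒᵖ, χ.obj l ⟶ (S.obj l.unop ⟶[V] φ)} (hφ : IsWeightedColimit χ S φ η)
    (hχ : HasPreserves F χ) (hS : ∀ l, HasPreserves F (S.obj l)) : HasPreserves F φ := by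
  intro T
  choose lam μ hμ hμ' using fun l => hS l T
  let Λ := limFunctor hμ
  have hΛ : IsLimFamily S T Λ μ := limFunctor_isLimFamily hμ
  obtain ⟨p, κ, hκ, hκ'⟩ := hχ Λ
  obtain ⟨ν, hν, hνκ⟩ := exists_isCone₁_of_iterated (Λ := Λ) hφ (fun l => (hμ l).cone) hΛ hκ.cone
  refine ⟨p, ν, isWeightedLimit_of_iterated (Λ := Λ) hφ hμ hΛ hκ hν hνκ,
    isWeightedLimit_of_iterated hφ (Λ := Λ.comp V F) hμ' (hΛ.map F) hκ' (hν.map F) fun l j => ?_⟩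
  exact (Category.assoc _ _ _).symm.trans
    ((congrArg (· ≫ F.map _ _) (hνκ l j)).trans (tensor_eComp_map F _ _))

/-- The components of an ungraded transformation. -/
def uev {φ ψ : EnrichedFunctor V J V} (i : 𝟙_ V ⟶ (φ ⟶[V] ψ)) (j : J) : φ.obj j ⟶ ψ.obj j :=
  (λ_ _).inv ≫ i ▷ _ ≫ evF φ ψ j

theorem uev_natural {φ ψ : EnrichedFunctor V J V} (i : 𝟙_ V ⟶ (φ ⟶[V] ψ)) (j k : J) :
    act φ j k ≫ uev i k = uev i j ▷ _ ≫ act ψ j k := by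
  have h := whiskerRight_evF_isGr i j k
  rw [uev, uev, leftUnitor_inv_naturality_assoc, comp_whiskerRight_assoc, ← h]
  simp

theorem uev_eId (φ : EnrichedFunctor V J V) (j : J) : uev (eId V φ) j = 𝟙 _ := by
  rw [uev, eId_evF, Iso.inv_hom_id]

theorem uev_preU {φ ψ χ : EnrichedFunctor V J V} (i : 𝟙_ V ⟶ (φ ⟶[V] ψ))
    (i' : 𝟙_ V ⟶ (ψ ⟶[V] χ)) (j : J) : uev (preU i i') j = uev i j ≫ uev i' j := by
  have h := braiding_tensor_eComp_evF i' i j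
  have e : preU i i' = (λ_ _).inv ≫ (β_ _ _).hom ≫ (i ⊗ₘ i') ≫ eComp V φ ψ χ := by
    rw [leftUnitor_inv_braiding_assoc, ← unitors_inv_equal]
    rfl
  rw [uev, e, comp_whiskerRight_assoc, h]
  simp [uev]

theorem isWeightedLimit_of_weight_iso {φ ψ : EnrichedFunctor V J V} (e : EIso (V := V) φ ψ)
    {T : EnrichedFunctor V J C} {p : C} {ν : ∀ j, φ.obj j ⟶ (p ⟶[V] T.obj j)}
    (h : IsWeightedLimit φ T p ν) : IsWeightedLimit ψ T p (fun j => uev e.inv j ≫ ν j) := by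
  have h₁ (j : J) : uev e.hom j ≫ uev e.inv j = 𝟙 _ := by
    rw [← uev_preU, e.hom_inv, uev_eId]
  have h₂ (j : J) : uev e.inv j ≫ uev e.hom j = 𝟙 _ := by
    rw [← uev_preU, e.inv_hom, uev_eId]
  refine isWeightedLimit_iff.2 ⟨fun j k => ?_, fun a X t ht => ?_⟩
  · rw [reassoc_of% (uev_natural e.inv j k), h.cone j k, whiskerRight_comp_tensorHom_assoc]
  · have ht' : IsCone φ T a X (fun j => X ◁ uev e.hom j ≫ t j) := fun j k => by
      rw [← whiskerRight_comp_tensorHom_assoc, ← ht j k, ← MonoidalCategory.whiskerLeft_comp_assoc,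
        uev_natural]
      simp
    obtain ⟨f, hf⟩ := h.exists_lift ht'
    refine ⟨f, fun j => ?_, fun g hg => h.hom_ext fun j => ?_⟩
    · rw [← whiskerLeft_comp_tensorHom_assoc, hf, ← MonoidalCategory.whiskerLeft_comp_assoc, h₂]
      simp
    · rw [hf, ← hg, ← whiskerLeft_comp_tensorHom_assoc, ← MonoidalCategory.whiskerLeft_comp_assoc,
        h₁]
      simp

theorem HasPreserves.iso {F : EnrichedFunctor V C D} {φ ψ : EnrichedFunctor V J V}
    (e : EIso (V := V) φ ψ) (h : HasPreserves F φ) : HasPreserves F ψ := fun T => by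
  obtain ⟨p, ν, hν, hν'⟩ := h T
  refine ⟨p, _, isWeightedLimit_of_weight_iso e hν, ?_⟩
  convert isWeightedLimit_of_weight_iso e hν' using 2
  exact Category.assoc _ _ _

end Good

/-! ### Induction over the closure of the representables. -/

section Closure

variable [MonoidalClosed V] [HasLimits V] {C : Type u₁} [EnrichedCategory V C]
  {D : Type u₃} [EnrichedCategory V D]

/-- Weights in the closure of the representables under `Ψ`-colimits behave like those in `Ψ`. -/
theorem hasPreserves_of_free (Ψ : WeightClass V) (F : EnrichedFunctor V C D)
    (hF : ∀ (K : Type (max u w)) [EnrichedCategory V K] [IsSmall V K]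
      (φ : EnrichedFunctor V Kᵒᵖ V), Ψ K φ → HasPreserves F φ)
    (N : Type (max u w)) [EnrichedCategory V N] [IsSmall V N] {φ : EnrichedFunctor V Nᵒᵖ V}
    (hφ : Ψ.Free N φ) : HasPreserves F φ := by
  induction hφ with
  | of h =>
    obtain ⟨a, rfl⟩ := h
    exact hasPreserves_homFrom F (op a)
  | iso e _ ih => exact ih.iso (areIso_iff.1 e).some
  | colimit K χ hχ S _ η hη ih => exact HasPreserves.colimit hη (hF K χ hχ) ih

end Closure

end VCat

end

noncomputable section

namespace VCat

variable {V : Type u} [Category.{w} V] [MonoidalCategory V] [SymmetricCategory V]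

/-! ### Limits in `V`, and preservation of limits by representables. -/

section LimitsInBase

variable [MonoidalClosed V] {J : Type u₁} [EnrichedCategory V J] {C : Type u₂}
  [EnrichedCategory V C]

theorem coherence_gr_uncurry {A X B B' H E E' : V} {s : B ⊗ H ⟶ B'} {t : A ⊗ X ⊗ B ⟶ E}
    {t' : A ⊗ X ⊗ B' ⟶ E'} {s' : E ⊗ H ⟶ E'}
    (h : A ◁ ((α_ X B H).hom ≫ X ◁ s) ≫ t' = (α_ _ _ _).inv ≫ t ▷ H ≫ s') :
    (α_ (A ⊗ X) B H).hom ≫ (A ⊗ X) ◁ s ≫ (α_ A X B').hom ≫ t' =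
      ((α_ A X B).hom ≫ t) ▷ H ≫ s' := by
  rw [comp_whiskerRight_assoc, ← cancel_epi ((α_ A X B).inv ▷ H), ← cancel_epi (α_ _ _ _).inv]
  simp only [inv_hom_whiskerRight_assoc]
  rw [← h]
  simp

theorem isGr_curry_iff {φ T : EnrichedFunctor V J V} {l : V} {u : ∀ j, l ⊗ φ.obj j ⟶ T.obj j} :
    IsGr l φ T u ↔ IsCone₁ φ T l (fun j => MonoidalClosed.curry (u j)) := by
  refine forall_congr' fun j => forall_congr' fun k => ?_
  rw [← (MonoidalClosed.uncurry_injective (A := l)).eq_iff]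
  have h := uncurry_tensor_comp (MonoidalClosed.curry (u j)) (T.map j k)
  rw [MonoidalClosed.uncurry_curry] at h
  refine Iff.trans ?_ (Eq.congr_right h).symm
  rw [MonoidalClosed.uncurry_natural_left, MonoidalClosed.uncurry_curry,
    ← cancel_epi (α_ _ _ _).hom, Iso.hom_inv_id_assoc]
  rfl

/-- The universal property of a limit in the base category, in terms of graded families. -/
theorem isWeightedLimit_of_gr {φ T : EnrichedFunctor V J V} {l : V}
    {u : ∀ j, l ⊗ φ.obj j ⟶ T.obj j} (hu : IsGr l φ T u)
    (H : ∀ (X : V) (t : ∀ j, X ⊗ φ.obj j ⟶ T.obj j), IsGr X φ T t →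
      ∃! f : X ⟶ l, ∀ j, f ▷ _ ≫ u j = t j) :
    IsWeightedLimit φ T l (fun j => MonoidalClosed.curry (u j)) := by
  refine isWeightedLimit_iff.2 ⟨isGr_curry_iff.1 hu, fun a X t ht => ?_⟩
  -- An `X`-graded morphism from `a` to `l` in `V` is a morphism `a ⊗ X ⟶ l`, so the hypothesis at
  -- the grading object `a ⊗ X` gives the property tested at `a`.
  have key (f : a ⊗ X ⟶ l) (j : J) : (MonoidalClosed.curry f ⊗ₘ MonoidalClosed.curry (u j)) ≫
      eComp V a l (T.obj j) = t j ↔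
        f ▷ _ ≫ u j = (α_ _ _ _).hom ≫ MonoidalClosed.uncurry (t j) := by
    rw [← (MonoidalClosed.uncurry_injective (A := a)).eq_iff]
    refine (Eq.congr_left (uncurry_tensor_comp _ _)).trans ?_
    rw [MonoidalClosed.uncurry_curry, MonoidalClosed.uncurry_curry, ← cancel_epi (α_ _ _ _).hom,
      Iso.hom_inv_id_assoc]
  have hgr : IsGr (a ⊗ X) φ T (fun j => (α_ _ _ _).hom ≫ MonoidalClosed.uncurry (t j)) := by
    intro j k
    have h := congrArg MonoidalClosed.uncurry (ht j k)
    have h' := h.trans (uncurry_tensor_comp (t j) (T.map j k))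
    rw [← Category.assoc, MonoidalClosed.uncurry_natural_left] at h'
    exact coherence_gr_uncurry h'
  obtain ⟨f, hf, hf'⟩ := H _ _ hgr
  refine ⟨MonoidalClosed.curry f, fun j => (key f j).2 (hf j), fun g hg => ?_⟩
  rw [← hf' (MonoidalClosed.uncurry g) fun j => (key _ j).1 (by
    rw [MonoidalClosed.curry_uncurry]; exact hg j), MonoidalClosed.curry_uncurry]

theorem IsWeightedLimit.exists_unique_gr {φ T : EnrichedFunctor V J V} {l : V}
    {u : ∀ j, l ⊗ φ.obj j ⟶ T.obj j}
    (h : IsWeightedLimit φ T l (fun j => MonoidalClosed.curry (u j))) {X : V}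
    {t : ∀ j, X ⊗ φ.obj j ⟶ T.obj j} (ht : IsGr X φ T t) :
    ∃! f : X ⟶ l, ∀ j, f ▷ _ ≫ u j = t j := by
  have ht' := IsCone.of_isCone₁ (isGr_curry_iff.1 ht)
  have key (f : 𝟙_ V ⟶ (ihom X).obj l) (j : J) : (f ⊗ₘ MonoidalClosed.curry (u j)) ≫
      eComp V X l (T.obj j) = (λ_ _).hom ≫ MonoidalClosed.curry (t j) ↔
        ((ρ_ _).inv ≫ MonoidalClosed.uncurry f) ▷ _ ≫ u j = t j := by
    rw [← (MonoidalClosed.uncurry_injective (A := X)).eq_iff]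
    refine (Eq.congr_left (uncurry_tensor_comp _ _)).trans ?_
    rw [MonoidalClosed.uncurry_curry, MonoidalClosed.uncurry_natural_left,
      MonoidalClosed.uncurry_curry, ← cancel_epi ((ρ_ X).inv ▷ _ ≫ (α_ _ _ _).hom)]
    simp
  obtain ⟨f, hf, hf'⟩ := (isWeightedLimit_iff.1 h).2 X (𝟙_ V) _ ht'
  refine ⟨(ρ_ _).inv ≫ MonoidalClosed.uncurry f, fun j => (key f j).1 (hf j), fun g hg => ?_⟩
  rw [← hf' (MonoidalClosed.curry ((ρ_ _).hom ≫ g)) fun j => (key _ j).2 (by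
    rw [MonoidalClosed.uncurry_curry, Iso.inv_hom_id_assoc, hg]), MonoidalClosed.uncurry_curry,
    Iso.inv_hom_id_assoc]

/-- Representable functors preserve limits. -/
theorem preservesWeightedLimit_of_homFrom (a : C) (φ : EnrichedFunctor V J V)
    (T : EnrichedFunctor V J C) : PreservesWeightedLimit (homFrom (V := V) a) φ T := by
  intro l μ h
  have hc : IsCone φ T a (a ⟶[V] l) (fun j => (a ⟶[V] l) ◁ μ j ≫ eComp V _ _ _) := by
    have := h.cone.isCone (𝟙 (a ⟶[V] l))
    simpa only [id_tensorHom] using this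
  have := isWeightedLimit_of_gr (T := T.comp V (homFrom a)) (l := (a ⟶[V] l))
    (u := fun j => (a ⟶[V] l) ◁ μ j ≫ eComp V _ _ _) (isCone_iff.1 hc) fun X t ht => by
      obtain ⟨f, hf, hf'⟩ := (isWeightedLimit_iff.1 h).2 a X t (isCone_iff.2 ht)
      refine ⟨f, fun j => ?_, fun g hg => hf' g fun j => ?_⟩
      · refine Eq.trans ?_ (hf j)
        rw [MonoidalCategory.tensorHom_def, Category.assoc]
        rfl
      · refine Eq.trans ?_ (hg j)
        rw [MonoidalCategory.tensorHom_def, Category.assoc]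
        rfl
  have e : (fun j => μ j ≫ (homFrom (V := V) a).map l (T.obj j)) =
      fun j => MonoidalClosed.curry ((a ⟶[V] l) ◁ μ j ≫ eComp V _ _ _) := funext fun j =>
    (MonoidalClosed.curry_natural_left _ _).symm
  exact (congrArg (IsWeightedLimit φ (T.comp V (homFrom a)) (a ⟶[V] l)) e).mpr this

end LimitsInBase

/-! ### Saturated classes and flat weights are closed under the free construction. -/

section Classes

variable [MonoidalClosed V] [HasLimits V]

/-- The functor `K ⟶ C` given by a functor between the opposites. -/
def unopFunctor {K : Type u₁} [EnrichedCategory V K] {C : Type u₂} [EnrichedCategory V C]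
    (T : EnrichedFunctor V Kᵒᵖ Cᵒᵖ) : EnrichedFunctor V K C where
  obj k := (T.obj (op k)).unop
  map k k' := T.map (op k') (op k)
  map_id k := T.map_id (op k)
  map_comp x y z := by
    have h := T.map_comp (op z) (op y) (op x)
    rw [tensorHom_eComp_op_eq, eComp_op_eq, Category.assoc] at h
    exact (cancel_epi (β_ _ _).hom).1 h

/-- Dualises the induction over the closure, so that it also yields statements about existence and
preservation of colimits. -/
theorem hasPreserves_opFunctor_iff {K : Type u₁} [EnrichedCategory V K] {C : Type u₂}
    [EnrichedCategory V C] {D : Type u₃} [EnrichedCategory V D] {F : EnrichedFunctor V C D}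
    {φ : EnrichedFunctor V Kᵒᵖ V} :
    HasPreserves (opFunctor F) φ ↔ ∀ S : EnrichedFunctor V K C,
      (∃ c η, IsWeightedColimit φ S c η) ∧ PreservesWeightedColimit F φ S := by
  rw [hasPreserves_iff]
  constructor
  · intro h S
    obtain ⟨⟨p, ν, hν⟩, hp⟩ := h (opFunctor S)
    refine ⟨⟨p.unop, ν, isWeightedColimit_iff_op.2 hν⟩, fun c η hη => ?_⟩
    exact isWeightedColimit_iff_op.2 (hp (op c) η (isWeightedColimit_iff_op.1 hη))
  · intro h T
    obtain ⟨⟨p, ν, hν⟩, hp⟩ := h (unopFunctor T)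
    refine ⟨⟨op p, ν, isWeightedColimit_iff_op.1 hν⟩, fun c η hη => ?_⟩
    exact isWeightedColimit_iff_op.1 (hp c.unop η (isWeightedColimit_iff_op.2 hη))

/-- Composition with the identity functor inserts identities into the hom-morphisms; the proof only
removes these. -/
theorem preservesWeightedLimit_id {J : Type u₁} [EnrichedCategory V J] {C : Type u₂}
    [EnrichedCategory V C] (φ : EnrichedFunctor V J V) (T : EnrichedFunctor V J C) :
    PreservesWeightedLimit (EnrichedFunctor.id V C) φ T := by
  intro l μ h
  refine isWeightedLimit_iff.2 ⟨h.cone.map _, fun a X t ht => ?_⟩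
  have hT (j k : J) : (T.comp V (EnrichedFunctor.id V C)).map j k = T.map j k :=
    Category.comp_id (T.map j k)
  have hμ (j : J) : μ j ≫ (EnrichedFunctor.id V C).map l (T.obj j) = μ j := Category.comp_id (μ j)
  obtain ⟨f, hf, hf'⟩ := (isWeightedLimit_iff.1 h).2 a X t fun j k =>
    (ht j k).trans (congrArg (fun x => (t j ⊗ₘ x) ≫ eComp V a (T.obj j) (T.obj k)) (hT j k))
  have e (g : X ⟶ (a ⟶[V] l)) (j : J) := congrArg (fun x => (g ⊗ₘ x) ≫ eComp V a l (T.obj j)) (hμ j)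
  exact ⟨f, fun j => (e f j).trans (hf j), fun g hg => hf' g fun j => (e g j).symm.trans (hg j)⟩

namespace WeightClass

/-- A saturated class of weights contains the closure of the representables. -/
theorem IsSaturated.of_free {Φ : WeightClass V} (hsat : Φ.IsSaturated) {K : Type (max u w)}
    [EnrichedCategory V K] [IsSmall V K] {ψ : EnrichedFunctor V Kᵒᵖ V} (hψ : Φ.Free K ψ) :
    Φ K ψ := by
  refine (hsat K ψ).1 ⟨fun C _ hC T => ?_, fun C D _ _ hC hD F hF T => ?_⟩
  -- Taking the identity as the preserved functor isolates the existence half of the induction.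
  · exact ((hasPreserves_iff.1 (hasPreserves_of_free Φ (EnrichedFunctor.id V C)
      (fun K _ _ φ hφ => hasPreserves_iff.2 fun T => ⟨hC K φ hφ T, preservesWeightedLimit_id φ T⟩)
      K hψ)) T).1
  · exact ((hasPreserves_iff.1 (hasPreserves_of_free Φ F
      (fun K _ _ φ hφ => hasPreserves_iff.2 fun T => ⟨hC K φ hφ T, hF K φ hφ T⟩) K hψ)) T).2

/-- The class of flat weights contains the closure of the representables under its colimits. -/
theorem flat_of_free [HasColimits V] {Φ : WeightClass V} {N : Type (max u w)}
    [EnrichedCategory V N] [IsSmall V N] {φ : EnrichedFunctor V Nᵒᵖ V} (hφ : Φ.flat.Free N φ) :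
    Φ.flat N φ := fun K _ _ ψ hψ S =>
  -- The induction runs on the opposite of `{ψ, -}`. Presheaf categories have all small colimits, so
  -- only preservation is at stake, and that is the definition of flatness.
  (hasPreserves_opFunctor_iff.1 (hasPreserves_of_free Φ.flat (opFunctor (homFrom (V := V) ψ))
    (fun _ _ _ χ hχ => hasPreserves_opFunctor_iff.2 fun S =>
      ⟨exists_isWeightedColimit χ S, hχ K ψ hψ S⟩) N hφ) S).2

end WeightClass

end Classes

end VCat

end

noncomputable section

namespace VCat

variable {V : Type u} [Category.{w} V] [MonoidalCategory V] [SymmetricCategory V]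

/-! ### The nerve of a functor and the co-Yoneda formula. -/

section Nerve

variable [MonoidalClosed V] [HasLimitsOfSize.{w, w} V] {M : Type u₁} [EnrichedCategory V M]
  [IsSmall V M] {E : Type u₂} [EnrichedCategory V E]

theorem isGr_eComp {J : Type u₁} [EnrichedCategory V J] (T : EnrichedFunctor V J E) (a b : E) :
    IsGr (a ⟶[V] b) (T.comp V (homFrom b)) (T.comp V (homFrom a))
      (fun j => eComp V a b (T.obj j)) := fun j k => by
  have h : (α_ _ _ _).hom ≫ (a ⟶[V] b) ◁ ((b ⟶[V] T.obj j) ◁ T.map j k ≫ eComp V _ _ _) ≫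
      eComp V _ _ _ = eComp V a b (T.obj j) ▷ _ ≫ (a ⟶[V] T.obj j) ◁ T.map j k ≫
        eComp V _ _ _ := by
    rw [← whisker_exchange_assoc, ← e_assoc']
    simp
  rw [act_comp_functor, act_comp_functor, act_homFrom, act_homFrom]
  exact h

theorem isGr_act {J : Type u₁} [EnrichedCategory V J] (T : EnrichedFunctor V J E)
    (F : EnrichedFunctor V E V) (e : E) :
    IsGr (F.obj e) (T.comp V (homFrom e)) (T.comp V F) (fun j => act F e (T.obj j)) :=
    fun j k => by
  have h : (α_ _ _ _).hom ≫ F.obj e ◁ ((e ⟶[V] T.obj j) ◁ T.map j k ≫ eComp V _ _ _) ≫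
      act F e (T.obj k) = act F e (T.obj j) ▷ _ ≫ F.obj (T.obj j) ◁ T.map j k ≫ act F _ _ := by
    rw [← whisker_exchange_assoc, ← act_comp]
    simp
  rw [act_comp_functor, act_comp_functor, act_homFrom]
  exact h

theorem nerve_isGr (W : EnrichedFunctor V M E) (e e' : E) :
    IsGr (e ⟶[V] e') ((opFunctor W).comp V (homTo e)) ((opFunctor W).comp V (homTo e'))
      (fun m => eComp V (op e') (op e) (op (W.obj m.unop))) :=
  isGr_eComp (opFunctor W) (op e') (op e)

/-- The trick of every Yoneda argument here: evaluate a balancing equation at a unit element `i` of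
`K`. -/
theorem unit_of_balanced {A H S K B v : V} {a : A ⊗ H ⟶ S} {t : S ⊗ K ⟶ v} {c : H ⊗ K ⟶ B}
    {t' : A ⊗ B ⟶ v} {i : 𝟙_ V ⟶ K} {b : H ⟶ B} (h : a ▷ K ≫ t = (α_ _ _ _).hom ≫ A ◁ c ≫ t')
    (hc : (ρ_ H).inv ≫ H ◁ i ≫ c = b) : a ≫ (ρ_ S).inv ≫ S ◁ i ≫ t = A ◁ b ≫ t' := by
  rw [rightUnitor_inv_naturality_assoc, ← whisker_exchange_assoc, h, ← hc]
  simp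

/-- The functor `E ⟶ [Mᵒᵖ, V]` sending `e` to `E(W -, e)`. -/
def nerve (W : EnrichedFunctor V M E) : EnrichedFunctor V E (EnrichedFunctor V Mᵒᵖ V) where
  obj e := (opFunctor W).comp V (homTo e)
  map e e' := (nerve_isGr W e e').exists_lift.choose
  map_id e := evF_ext fun j => by
    rw [comp_whiskerRight_assoc, (nerve_isGr W e e).exists_lift.choose_spec, eId_evF]
    have := e_id_comp V (op e) (op (W.obj j.unop))
    exact (cancel_epi (λ_ _).inv).1 (this.trans (Iso.inv_hom_id _).symm)
  map_comp e e' e'' := evF_ext fun j => by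
    have h := braiding_tensor_eComp_evF (nerve_isGr W e' e'').exists_lift.choose
      (nerve_isGr W e e').exists_lift.choose j
    rw [(nerve_isGr W e e').exists_lift.choose_spec,
      (nerve_isGr W e' e'').exists_lift.choose_spec] at h
    rw [comp_whiskerRight_assoc, (nerve_isGr W e e'').exists_lift.choose_spec,
      ← cancel_epi ((β_ (e' ⟶[V] e'') (e ⟶[V] e')).hom ▷ _)]
    refine ((comp_whiskerRight_assoc _ _ _ _).symm.trans ?_).trans
      ((comp_whiskerRight_assoc _ _ _ _).symm.trans h).symm
    have e₁ : (β_ (e' ⟶[V] e'') (e ⟶[V] e')).hom ≫ eComp V e e' e'' =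
      eComp V (op e'') (op e') (op e) := (eComp_op_eq V (op e) (op e') (op e'')).symm
    exact (congrArg (fun x => x ▷ (W.obj j.unop ⟶[V] e) ≫
      eComp V (op e'') (op e) (op (W.obj j.unop))) e₁).trans
      (e_assoc' V (op e'') (op e') (op e) (op (W.obj j.unop))).symm

theorem lact_nerve (W : EnrichedFunctor V M E) (e e' : E) (m : Mᵒᵖ) :
    lact (nerve W) e e' m = eComp V (op e') (op e) (op (W.obj m.unop)) :=
  (nerve_isGr W e e').exists_lift.choose_spec m

/-- Co-Yoneda at one object: the action is universal among balanced families, and a family descends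
by its value at the identity of `W m`. -/
theorem isColimV_nerve (F : EnrichedFunctor V Eᵒᵖ V) (W : EnrichedFunctor V M E) (m : Mᵒᵖ) :
    IsColimV F ((nerve W).comp V (evFunctor m)) (F.obj (op (W.obj m.unop)))
      (fun e => act F e (op (W.obj m.unop))) := by
  have hb : BalV F ((nerve W).comp V (evFunctor m)) (F.obj (op (W.obj m.unop)))
      (fun e => act F e (op (W.obj m.unop))) := fun e e' => by
    rw [lactV_comp_evFunctor, lact_nerve]
    exact (act_comp F e e' (op (W.obj m.unop))).symm
  refine ⟨hb, fun v t ht => ?_, fun v f g hfg => ?_⟩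
  · refine ⟨(ρ_ _).inv ≫ F.obj _ ◁ eId V (op (W.obj m.unop)) ≫ t (op (W.obj m.unop)), fun e => ?_⟩
    have h := ht e (op (W.obj m.unop))
    rw [lactV_comp_evFunctor, lact_nerve] at h
    have h' : act F e (op (W.obj m.unop)) ▷ _ ≫ t (op (W.obj m.unop)) =
      (α_ _ _ _).hom ≫ F.obj e ◁ eComp V e (op (W.obj m.unop)) (op (W.obj m.unop)) ≫ t e := h
    refine (unit_of_balanced h' (e_comp_id V e (op (W.obj m.unop)))).trans ?_
    exact (congrArg (· ≫ t e) (MonoidalCategory.whiskerLeft_id _ _)).trans (Category.id_comp _)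
  · have h₁ := act_id F (op (W.obj m.unop))
    have h₂ (k : F.obj (op (W.obj m.unop)) ⟶ v) : (ρ_ _).inv ≫ F.obj _ ◁ eId V (op (W.obj m.unop)) ≫
        act F (op (W.obj m.unop)) (op (W.obj m.unop)) ≫ k = k := by
      rw [reassoc_of% h₁, Iso.inv_hom_id_assoc]
    refine (h₂ f).symm.trans (Eq.trans ?_ (h₂ g))
    exact congrArg (fun x => (ρ_ _).inv ≫ F.obj _ ◁ eId V (op (W.obj m.unop)) ≫ x) (hfg _)

/-- The composite of a presheaf `F` with `W` is the colimit, weighted by `F`, of the nerve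
of `W`. -/
theorem exists_isWeightedColimit_nerve (F : EnrichedFunctor V Eᵒᵖ V) (W : EnrichedFunctor V M E) :
    ∃ η, (∀ e m, fam η e m = act F e (op (W.obj m.unop))) ∧
      IsWeightedColimit F (nerve W) ((opFunctor W).comp V F) η := by
  have hgr (e : Eᵒᵖ) : IsGr (F.obj e) ((nerve W).obj e.unop) ((opFunctor W).comp V F)
      (fun m => act F e (op (W.obj m.unop))) := isGr_act (opFunctor W) F e
  choose η hη using fun e => (hgr e).exists_lift
  refine ⟨η, hη, isWeightedColimit_of_pointwise fun m => ?_⟩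
  have : (fun e => fam η e m) = fun e => act F e (op (W.obj m.unop)) := funext fun e => hη e m
  rw [this]
  exact isColimV_nerve F W m

theorem lactV_comp_homFrom_evF {J : Type*} [EnrichedCategory V J] [IsSmall V J]
    {L : Type*} [EnrichedCategory V L] (S : EnrichedFunctor V L (EnrichedFunctor V J V))
    (ψ : EnrichedFunctor V J V) (l l' : L) (j : J) :
    lactV (S.comp V (homFrom ψ)) l l' ▷ _ ≫ evF ψ (S.obj l') j =
      (α_ _ _ _).hom ≫ (l ⟶[V] l') ◁ evF ψ (S.obj l) j ≫ lact S l l' j := by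
  have h := braiding_tensor_eComp_evF (S.map l l') (𝟙 (ψ ⟶[V] S.obj l)) j
  rw [id_whiskerRight, Category.id_comp, id_tensorHom] at h
  rw [lactV, act_comp_functor, act_homFrom]
  exact h

end Nerve

end VCat

end

noncomputable section

namespace VCat

variable {V : Type u} [Category.{w} V] [MonoidalCategory V] [SymmetricCategory V]

/-! ### Flat presheaves are continuous. -/

section Continuity

variable [MonoidalClosed V] [HasLimitsOfSize.{w, w} V] {K : Type u₁} [EnrichedCategory V K]
  [IsSmall V K] {N : Type u₂} [EnrichedCategory V N]

theorem whisker_act_fac {A B H P X Z : V} {r : P ⟶ H} {m : B ⟶ X} {c : H ⊗ X ⟶ Z} {e : P ⊗ B ⟶ Z}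
    {C D : V} {a : A ⊗ H ⟶ C} {a' : C ⊗ X ⟶ D} {a'' : A ⊗ Z ⟶ D}
    (hr : (r ⊗ₘ m) ≫ c = e) (ha : (α_ _ _ _).hom ≫ A ◁ c ≫ a'' = a ▷ X ≫ a') :
    (A ◁ r ≫ a) ▷ B ≫ C ◁ m ≫ a' = (α_ _ _ _).hom ≫ A ◁ e ≫ a'' := by
  rw [← hr, ← whisker_exchange_assoc, comp_whiskerRight_assoc, ← ha,
    MonoidalCategory.tensorHom_def']
  simp

theorem balanced_comp {A A' M R R' B B' E : V} {a : A ⊗ M ⟶ A'} {k : M ⊗ R' ⟶ R} {x : A ⊗ R ⟶ E}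
    {x' : A' ⊗ R' ⟶ E} {l : M ⊗ B' ⟶ B} {r : B ⟶ R} {r' : B' ⟶ R'}
    (ha : (α_ _ _ _).hom ≫ A ◁ k ≫ x = a ▷ R' ≫ x') (hl : l ≫ r = M ◁ r' ≫ k) :
    a ▷ B' ≫ A' ◁ r' ≫ x' = (α_ _ _ _).hom ≫ A ◁ l ≫ A ◁ r ≫ x := by
  rw [← MonoidalCategory.whiskerLeft_comp_assoc, hl, ← whisker_exchange_assoc, ← ha]
  simp

theorem whisker_unit_fac {A S B X E E' : V} {s : 𝟙_ V ⟶ S} {e : S ⊗ B ⟶ X} {m : B ⟶ X}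
    {h : A ⊗ S ⟶ E} {a : A ⊗ X ⟶ E'} {v : E ⊗ B ⟶ E'}
    (hs : s ▷ B ≫ e = (λ_ _).hom ≫ m) (hh : h ▷ B ≫ v = (α_ _ _ _).hom ≫ A ◁ e ≫ a) :
    A ◁ m ≫ a = ((ρ_ _).inv ≫ A ◁ s ≫ h) ▷ B ≫ v := by
  have h₁ := congrArg (fun x => A ◁ x) hs
  simp only [MonoidalCategory.whiskerLeft_comp] at h₁
  rw [comp_whiskerRight_assoc, comp_whiskerRight_assoc, hh, associator_naturality_middle_assoc,
    reassoc_of% h₁]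
  simp

/-- If `{ψ, -}` preserves the colimit that presents `F ∘ Sᵒᵖ` then `F` preserves the `ψ`-weighted
limit of `Sᵒᵖ`. -/
theorem preservesWeightedLimit_of_nerve {F : EnrichedFunctor V Nᵒᵖ V}
    {ψ : EnrichedFunctor V Kᵒᵖ V} {S : EnrichedFunctor V K N}
    (hF : PreservesWeightedColimit (homFrom (V := V) ψ) F (nerve S)) :
    PreservesWeightedLimit F ψ (opFunctor S) := by
  intro c μ hμ
  obtain ⟨η, hη, hcol⟩ := exists_isWeightedColimit_nerve F S
  let T := opFunctor S
  let G := T.comp V F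
  let B : EnrichedFunctor V N V := (nerve S).comp V (homFrom ψ)
  let h (n : Nᵒᵖ) : F.obj n ⊗ B.obj n.unop ⟶ (ψ ⟶[V] G) :=
    bunc (η n ≫ (homFrom (V := V) ψ).map _ _)
  have H : IsColimV F B (ψ ⟶[V] G) h := isWeightedColimit_iff_isColimV.1 (hF _ _ hcol)
  have hh (n : Nᵒᵖ) (j : Kᵒᵖ) : h n ▷ _ ≫ evF ψ G j =
      (α_ _ _ _).hom ≫ F.obj n ◁ evF ψ ((nerve S).obj n.unop) j ≫ act F n (T.obj j) := by
    have e : h n = (β_ _ _).hom ≫ (𝟙 _ ⊗ₘ η n) ≫ eComp V _ _ _ := by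
      rw [id_tensorHom]
      exact congrArg ((β_ _ _).hom ≫ ·) ((MonoidalClosed.uncurry_natural_left _ _).trans
        (congrArg (_ ◁ η n ≫ ·) (MonoidalClosed.uncurry_curry _)))
    have h₁ := braiding_tensor_eComp_evF (η n) (𝟙 (ψ ⟶[V] (nerve S).obj n.unop)) j
    rw [← e, id_whiskerRight, Category.id_comp] at h₁
    exact h₁.trans (congrArg (fun x => (α_ _ _ _).hom ≫ F.obj n ◁ evF ψ ((nerve S).obj n.unop) j ≫ x)
      (hη n j))
  -- the comparison with the hom-objects of `N`
  have hr (n : Nᵒᵖ) : ∃ r : B.obj n.unop ⟶ (n ⟶[V] c),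
      ∀ j, (r ⊗ₘ μ j) ≫ eComp V n c (T.obj j) = evF ψ ((nerve S).obj n.unop) j :=
    hμ.exists_lift (isCone_iff.2 (evF_isGr ψ ((nerve S).obj n.unop)))
  choose r hr using hr
  have hrB (n n' : Nᵒᵖ) : lactV B n'.unop n.unop ≫ r n =
      (n ⟶[V] n') ◁ r n' ≫ eComp V n n' c := hμ.hom_ext fun j => by
    have h₁ := lactV_comp_homFrom_evF (nerve S) ψ n'.unop n.unop j
    rw [lact_nerve] at h₁
    have h₂ := whiskerRight_comp_tensorHom_assoc (lactV B n'.unop n.unop) (r n) (μ j)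
      (eComp V n c (T.obj j))
    refine h₂.symm.trans ?_
    rw [hr]
    refine h₁.trans ?_
    have h₃ := eComp_assoc3 (𝟙 (n ⟶[V] n')) (r n') (μ j)
    rw [id_tensorHom, id_tensorHom, hr] at h₃
    exact h₃
  let u (j : Kᵒᵖ) : F.obj c ⊗ ψ.obj j ⟶ G.obj j := F.obj c ◁ μ j ≫ act F c (T.obj j)
  have hu : (fun j => μ j ≫ F.map c (T.obj j)) = fun j => MonoidalClosed.curry (u j) :=
    funext fun j => (MonoidalClosed.curry_uncurry _).symm.trans
      (congrArg MonoidalClosed.curry (MonoidalClosed.uncurry_natural_left _ _))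
  have hugr : IsGr (F.obj c) ψ G u := isGr_curry_iff.2 (hu ▸ hμ.cone.map F)
  let h' (n : Nᵒᵖ) : F.obj n ⊗ B.obj n.unop ⟶ F.obj c := F.obj n ◁ r n ≫ act F n c
  have hh' (n : Nᵒᵖ) (j : Kᵒᵖ) : h' n ▷ _ ≫ u j =
      (α_ _ _ _).hom ≫ F.obj n ◁ evF ψ ((nerve S).obj n.unop) j ≫ act F n (T.obj j) :=
    whisker_act_fac (hr n j) (act_comp F n c (T.obj j))
  -- `ζ : [ψ, F ∘ Sᵒᵖ] ⟶ F c` exists because flatness makes the source a colimit; `θ` is the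
  -- canonical comparison in the other direction. They are mutually inverse.
  obtain ⟨ζ, hζ⟩ := H.desc (F.obj c) h' fun n n' =>
    balanced_comp (act_comp F n n' c) (hrB n n')
  obtain ⟨θ, hθ⟩ := hugr.exists_lift
  have hζu (j : Kᵒᵖ) : ζ ▷ _ ≫ u j = evF ψ G j := H.ext_right fun n => by
    rw [← comp_whiskerRight_assoc, hζ, hh', hh]
  have hθζ : θ ≫ ζ = 𝟙 _ := by
    -- The universal cone as an element `s` of `B c`: `r` sends it to the identity of `c`, and `θ`
    -- is the colimit inclusion at `c` evaluated at `s`.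
    obtain ⟨s, hs⟩ : ∃ s : 𝟙_ V ⟶ B.obj c.unop, ∀ j,
        s ▷ _ ≫ evF ψ ((nerve S).obj c.unop) j = (λ_ _).hom ≫ μ j :=
      (isCone_iff.1 (IsCone.of_isCone₁ hμ.cone)).exists_lift
    have hsr : s ≫ r c = eId V c := hμ.hom_ext fun j => by
      rw [eId_tensor_eComp]
      exact (whiskerRight_comp_tensorHom_assoc s (r c) (μ j) _).symm.trans
        ((congrArg (s ▷ _ ≫ ·) (hr c j)).trans (hs j))
    have hθ' : θ = (ρ_ _).inv ≫ F.obj c ◁ s ≫ h c := evF_ext fun j =>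
      (hθ j).trans (whisker_unit_fac (hs j) (hh c j))
    have h₁ := act_id F c
    rw [hθ', Category.assoc, Category.assoc, hζ, ← MonoidalCategory.whiskerLeft_comp_assoc, hsr, h₁,
      Iso.inv_hom_id]
  refine (congrArg (IsWeightedLimit ψ G (F.obj c)) hu).mpr ?_
  refine isWeightedLimit_of_gr hugr fun X t ht => ?_
  obtain ⟨f, hf⟩ := ht.exists_lift
  refine ⟨f ≫ ζ, fun j => ?_, fun g hg => ?_⟩
  · rw [comp_whiskerRight_assoc, hζu, hf]
  · have : g ≫ θ = f := evF_ext fun j => by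
      rw [comp_whiskerRight_assoc, hθ, hf, hg]
    rw [← this, Category.assoc, hθζ, Category.comp_id]

end Continuity

/-- Flat weights are continuous. -/
theorem WeightClass.flat.isContinuous [MonoidalClosed V] [HasLimits V] {Φ : WeightClass V} {N : Type (max u w)}
    [EnrichedCategory V N] [IsSmall V N] {F : EnrichedFunctor V Nᵒᵖ V} (hF : Φ.flat N F) :
    Φ.IsContinuous F := fun _ _ _ ψ hψ T =>
  preservesWeightedLimit_of_nerve (S := unopFunctor T) (hF _ ψ hψ _)

end VCat

end

noncomputable section

namespace VCat

variable {V : Type u} [Category.{w} V] [MonoidalCategory V] [SymmetricCategory V]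

/-! ### The Yoneda lemma and density. -/

section Yoneda

variable [MonoidalClosed V] [HasLimitsOfSize.{w, w} V] {J : Type u₁} [EnrichedCategory V J]
  [IsSmall V J]

theorem exists_yoneda_lift (G : EnrichedFunctor V J V) {j : J} {X : V} (b : X ⟶ G.obj j) :
    ∃ f : X ⟶ (homFrom j ⟶[V] G), ∀ k, f ▷ (j ⟶[V] k) ≫ evF (homFrom j) G k = b ▷ _ ≫ act G j k := by
  have hgr : IsGr X (homFrom (V := V) j) G (fun k => b ▷ (j ⟶[V] k) ≫ act G j k) := fun k k' => by
    rw [act_homFrom]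
    have h := act_comp G j k k'
    have : (α_ _ _ _).hom ≫ X ◁ eComp V j k k' ≫ b ▷ (j ⟶[V] k') ≫ act G j k' =
        (b ▷ (j ⟶[V] k) ≫ act G j k) ▷ _ ≫ act G k k' := by
      rw [comp_whiskerRight_assoc, ← h, whisker_exchange_assoc, associator_naturality_left_assoc]
    exact this
  exact hgr.exists_lift

theorem eq_of_unit_action {X H K G G' : V} {i : 𝟙_ V ⟶ H} {c : H ⊗ K ⟶ K} {t : X ⊗ H ⟶ G}
    {t' : X ⊗ K ⟶ G'} {a : G ⊗ K ⟶ G'} (hi : i ▷ K ≫ c = (λ_ _).hom)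
    (ht : (α_ _ _ _).hom ≫ X ◁ c ≫ t' = t ▷ K ≫ a) :
    t' = ((ρ_ X).inv ≫ X ◁ i ≫ t) ▷ K ≫ a := by
  have h₁ := congrArg (fun x => X ◁ x) hi
  simp only [MonoidalCategory.whiskerLeft_comp] at h₁
  rw [comp_whiskerRight_assoc, comp_whiskerRight_assoc, ← ht, associator_naturality_middle_assoc,
    reassoc_of% h₁]
  simp

/-- Uniqueness in the Yoneda lemma: linearity recovers `f` from its value at the identity of `j`. -/
theorem eval_yoneda {G : EnrichedFunctor V J V} {j : J} {X : V} (f : X ⟶ (homFrom j ⟶[V] G)) (k : J) :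
    f ▷ (j ⟶[V] k) ≫ evF (homFrom j) G k =
      ((ρ_ X).inv ≫ X ◁ eId V j ≫ f ▷ (j ⟶[V] j) ≫ evF (homFrom j) G j) ▷ _ ≫ act G j k := by
  have h := whiskerRight_evF_isGr f j k
  rw [act_homFrom] at h
  have h' : (α_ _ _ _).hom ≫ X ◁ eComp V j j k ≫ f ▷ (j ⟶[V] k) ≫ evF (homFrom j) G k =
    (f ▷ (j ⟶[V] j) ≫ evF (homFrom j) G j) ▷ _ ≫ act G j k := h
  have h₂ : eId V j ▷ (j ⟶[V] k) ≫ eComp V j j k = (λ_ _).hom := by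
    rw [← cancel_epi (λ_ _).inv, e_id_comp, Iso.inv_hom_id]
  exact eq_of_unit_action h₂ h'

/-- The element `x` of `R j` exhibits `R` as representable by `j`. -/
def IsRep (R : EnrichedFunctor V J V) (j : J) (x : 𝟙_ V ⟶ R.obj j) : Prop :=
  ∀ (G : EnrichedFunctor V J V) (X : V) (b : X ⟶ G.obj j),
    ∃! f : X ⟶ (R ⟶[V] G), (ρ_ X).inv ≫ X ◁ x ≫ f ▷ _ ≫ evF R G j = b

theorem isRep_homFrom (j : J) : IsRep (homFrom (V := V) j) j (eId V j) := fun G X b => by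
  obtain ⟨f, hf⟩ := exists_yoneda_lift G b
  refine ⟨f, ?_, fun g hg => evF_ext fun k => ?_⟩
  · have h := act_id G j
    refine (congrArg (fun x => (ρ_ X).inv ≫ X ◁ eId V j ≫ x) (hf j)).trans ?_
    rw [whisker_exchange_assoc, h]
    simp
  · refine (eval_yoneda g k).trans (Eq.trans ?_ (hf k).symm)
    exact congrArg (fun x => x ▷ (j ⟶[V] k) ≫ act G j k) hg

theorem preU_evF {F G H : EnrichedFunctor V J V} {X : V} (i : 𝟙_ V ⟶ (F ⟶[V] G))
    (g : X ⟶ (G ⟶[V] H)) (j : J) :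
    preU i g ▷ _ ≫ evF F H j = X ◁ uev i j ≫ g ▷ _ ≫ evF G H j := by
  have h := braiding_tensor_eComp_evF g i j
  have e : preU i g = (ρ_ _).inv ≫ (β_ _ _).hom ≫ (i ⊗ₘ g) ≫ eComp V F G H := by
    rw [rightUnitor_inv_braiding_assoc]
    rfl
  rw [e, comp_whiskerRight_assoc, h, uev]
  simp

variable {M : Type u₂} [EnrichedCategory V M]

theorem id_tensorHom_of_comp_eq {P Q R S v : V} {y : Q ⟶ R} {w : R ⟶ S} {z : Q ⟶ S}
    (h : y ≫ w = z) (e : P ⊗ S ⟶ v) : (𝟙 P ⊗ₘ z) ≫ e = P ◁ y ≫ P ◁ w ≫ e := by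
  rw [← h]
  simp

theorem balanced_of_factor {P P₀ Q R B C v : V} {k : P ⊗ Q ⟶ P₀} {y : Q ⟶ R} {a : P ⊗ R ⟶ P₀}
    {l : R ⊗ B ⟶ C} {s : Q ⊗ B ⟶ C} {t₀ : P₀ ⊗ B ⟶ v} {t : P ⊗ C ⟶ v} (hk : k = P ◁ y ≫ a)
    (ha : a ▷ B ≫ t₀ = (α_ _ _ _).hom ≫ P ◁ l ≫ t) (hl : y ▷ B ≫ l = s) :
    k ▷ B ≫ t₀ = (α_ _ _ _).hom ≫ P ◁ s ≫ t := by
  rw [hk, comp_whiskerRight_assoc, ha, ← hl]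
  simp

/-- A full subcategory of `[J, V]` that contains the representables is dense. -/
theorem isWeightedColimit_density (W : EnrichedFunctor V M (EnrichedFunctor V J V))
    (hW : ∀ m m', IsIso (W.map m m')) (hJ : ∀ j, ∃ m x, IsRep (W.obj m) j x)
    (F : EnrichedFunctor V J V) :
    IsWeightedColimit ((opFunctor W).comp V (homTo F)) W F (fun m => 𝟙 (W.obj m.unop ⟶[V] F)) := by
  have hact (m m' : Mᵒᵖ) : act ((opFunctor W).comp V (homTo F)) m m' =
      (W.obj m.unop ⟶[V] F) ◁ (opFunctor W).map m m' ≫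
        eComp V (op F) (op (W.obj m.unop)) (op (W.obj m'.unop)) :=
    (act_comp_functor _ _ _ _).trans (congrArg _ (act_homFrom _ _ _))
  have hcone : IsCone₁ ((opFunctor W).comp V (homTo F)) (opFunctor W) (op F)
      (fun m => 𝟙 (W.obj m.unop ⟶[V] F)) := fun m m' =>
    (Category.comp_id _).trans ((hact m m').trans (congrArg (· ≫ eComp V (op F) (op (W.obj m.unop))
      (op (W.obj m'.unop))) (id_tensorHom _ _).symm))
  have hb := isCone₁_op_iff_balF.1 hcone
  have hfam (m : Mᵒᵖ) {j : J} : 𝟙 (W.obj m.unop ⟶[V] F) ▷ (W.obj m.unop).obj j ≫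
      evF (W.obj m.unop) F j = evF (W.obj m.unop) F j := by
    rw [id_whiskerRight, Category.id_comp]
  refine isWeightedColimit_of_pointwise fun j => ⟨balF_iff_balV.1 hb j, ?_, ?_⟩
  all_goals
    obtain ⟨m₀, x, hx⟩ := hJ j
    -- `y` is the Yoneda map `F j ⟶ [W m₀, F]`, where `W m₀` represents evaluation at `j`.
    obtain ⟨y, hy, -⟩ := hx F _ (𝟙 (F.obj j))
  · intro v t ht
    -- The descent reads an element of `F j` as a map `W m₀ ⟶ F` and applies `t` at `m₀` to it and
    -- the universal element `x`.
    refine ⟨y ≫ (ρ_ _).inv ≫ (W.obj m₀ ⟶[V] F) ◁ x ≫ t (op m₀), fun m => ?_⟩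
    obtain ⟨z, hz, -⟩ := hx (W.obj m.unop) _ (𝟙 _)
    -- `k` precomposes a map `W m ⟶ F` with the map `W m₀ ⟶ W m` that `z` attaches to an element of
    -- `W m` at `j`. Full faithfulness of `W` brings that map back to `M`, where `t` is balanced.
    let k : (W.obj m.unop ⟶[V] F) ⊗ (W.obj m.unop).obj j ⟶ (W.obj m₀ ⟶[V] F) :=
      (β_ _ _).hom ≫ (z ⊗ₘ 𝟙 _) ≫ eComp V (W.obj m₀) (W.obj m.unop) F
    have hk₁ : k ▷ _ ≫ evF (W.obj m₀) F j = (α_ _ _ _).hom ≫ (W.obj m.unop ⟶[V] F) ◁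
        (z ▷ _ ≫ evF (W.obj m₀) (W.obj m.unop) j) ≫ evF (W.obj m.unop) F j := by
      have h := braiding_tensor_eComp_evF (𝟙 (W.obj m.unop ⟶[V] F)) z j
      rw [id_whiskerRight, Category.id_comp] at h
      exact h
    have hk₂ : k = (W.obj m.unop ⟶[V] F) ◁ (z ≫ inv (W.map m₀ m.unop)) ≫
        act ((opFunctor W).comp V (homTo F)) m (op m₀) := by
      have h₁ : (z ≫ inv (W.map m₀ m.unop)) ≫ (opFunctor W).map m (op m₀) = z := by
        refine (Category.assoc _ _ _).trans ?_
        exact (congrArg (z ≫ ·) (IsIso.inv_hom_id (W.map m₀ m.unop))).trans (Category.comp_id z)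
      exact (tensorHom_eComp_op _ _).symm.trans ((id_tensorHom_of_comp_eq h₁ _).trans
        (congrArg (_ ◁ _ ≫ ·) (hact m (op m₀)).symm))
    have hk₃ : k ▷ (W.obj m₀).obj j ≫ t (op m₀) = (α_ _ _ _).hom ≫ (W.obj m.unop ⟶[V] F) ◁
        (z ▷ _ ≫ evF (W.obj m₀) (W.obj m.unop) j) ≫ t m := by
      have h₁ := ht m (op m₀)
      rw [lactV_comp_evFunctor] at h₁
      have h₂ : (z ≫ inv (W.map m₀ m.unop)) ▷ _ ≫ lact W m₀ m.unop j =
          z ▷ _ ≫ evF (W.obj m₀) (W.obj m.unop) j := by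
        rw [lact, ← comp_whiskerRight_assoc, Category.assoc, IsIso.inv_hom_id, Category.comp_id]
      exact balanced_of_factor hk₂ h₁ h₂
    have hk : evF (W.obj m.unop) F j ≫ y = k := (hx F _ (evF (W.obj m.unop) F j)).unique
      (by
        rw [comp_whiskerRight_assoc, whisker_exchange_assoc, ← rightUnitor_inv_naturality_assoc,
          hy, Category.comp_id])
      (by
        have := unit_of_balanced hk₁ hz
        rw [rightUnitor_inv_naturality_assoc, ← whisker_exchange_assoc] at this
        rw [this, MonoidalCategory.whiskerLeft_id, Category.id_comp])
    have h₄ := unit_of_balanced hk₃ hz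
    rw [← hk, MonoidalCategory.whiskerLeft_id] at h₄
    refine (congrArg (· ≫ y ≫ (ρ_ _).inv ≫ (W.obj m₀ ⟶[V] F) ◁ x ≫ t (op m₀)) (hfam m)).trans ?_
    exact (Category.assoc _ _ _).symm.trans (h₄.trans (Category.id_comp _))
  · intro v f g hfg
    have h : evF (W.obj m₀) F j ≫ f = evF (W.obj m₀) F j ≫ g :=
      (congrArg (· ≫ f) (hfam (op m₀))).symm.trans
        ((hfg (op m₀)).trans (congrArg (· ≫ g) (hfam (op m₀))))
    rw [← Category.id_comp f, ← hy, ← Category.id_comp g, ← hy]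
    simp only [Category.assoc, h]

end Yoneda

end VCat

end

noncomputable section

namespace VCat

variable {V : Type u} [Category.{w} V] [MonoidalCategory V] [SymmetricCategory V]

/-! ### Coreflections and their behaviour under limits. -/

section Coreflections

variable {D : Type u₂} [EnrichedCategory V D]

/-- `i : G' ⟶ G` is a coreflection of `G` into the class `P` of objects. -/
structure IsCoreflection (P : D → Prop) (G G' : D) (i : 𝟙_ V ⟶ (G' ⟶[V] G)) : Prop where
  mem : P G'
  exists_unique : ∀ F, P F → ∀ (X : V) (f : X ⟶ (F ⟶[V] G)), ∃! g : X ⟶ (F ⟶[V] G'), postU g i = f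

variable {P : D → Prop}

theorem eId_postU {x y : D} (i : 𝟙_ V ⟶ (x ⟶[V] y)) : postU (eId V x) i = i := by
  rw [postU_eq_preU, preU_eId]

theorem preU_eId_right {x y : D} (i : 𝟙_ V ⟶ (x ⟶[V] y)) : preU i (eId V y) = i := by
  rw [← postU_eq_preU, postU_eId]

/-- Coreflection is functorial. -/
theorem exists_coreflection_functor {J : Type u₁} [EnrichedCategory V J] (T : EnrichedFunctor V J D)
    {G : J → D} {i : ∀ j, 𝟙_ V ⟶ (G j ⟶[V] T.obj j)}
    (hi : ∀ j, IsCoreflection P (T.obj j) (G j) (i j)) :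
    ∃ (T' : EnrichedFunctor V J D) (i' : ∀ j, 𝟙_ V ⟶ (T'.obj j ⟶[V] T.obj j)),
      (∀ j, T'.obj j = G j) ∧ (∀ j, IsCoreflection P (T.obj j) (T'.obj j) (i' j)) ∧
      ∀ j k, postU (T'.map j k) (i' k) = preU (i' j) (T.map j k) := by
  choose m hm hm' using fun j k => (hi k).exists_unique _ (hi j).mem _ (preU (i j) (T.map j k))
  refine ⟨⟨G, m, fun j => ?_, fun j k l => ?_⟩, i, fun _ => rfl, hi, hm⟩
  · refine ((hi j).exists_unique _ (hi j).mem _ (i j)).unique ?_ (eId_postU _)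
    rw [← comp_postU, hm, comp_preU, T.map_id, preU_eId_right]
  · refine ((hi l).exists_unique _ (hi j).mem _ _).unique rfl ?_
    rw [← tensor_postU_eComp, hm, ← comp_postU, hm, comp_preU, T.map_comp, ← preU_tensor_eComp,
      ← hm j k, postU_tensor_eComp]

theorem IsCoreflection.of_iso {G G₁ G' : D} {i : 𝟙_ V ⟶ (G' ⟶[V] G)} (h : IsCoreflection P G G' i)
    (e : EIso (V := V) G G₁) : IsCoreflection P G₁ G' (preU i e.hom) := by
  refine ⟨h.mem, fun F hF X f => ?_⟩
  obtain ⟨g, hg, hg'⟩ := h.exists_unique F hF X (postU f e.inv)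
  refine ⟨g, ?_, fun k hk => hg' k ?_⟩
  · change postU g (preU i e.hom) = f
    rw [← postU_postU, hg, postU_postU, e.inv_hom, postU_eId]
  · change postU k i = _
    rw [← hk, ← postU_postU, postU_postU (postU k i), e.hom_inv, postU_eId]

/-- If `G` is itself in the class, its identity lifts through `i` and provides the inverse. -/
theorem IsCoreflection.exists_eIso {G G' : D} {i : 𝟙_ V ⟶ (G' ⟶[V] G)}
    (h : IsCoreflection P G G' i) (hG : P G) : Nonempty (EIso (V := V) G' G) := by
  obtain ⟨g, hg, -⟩ := h.exists_unique G hG _ (eId V G)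
  refine ⟨⟨i, g, (h.exists_unique G' h.mem _ i).unique ?_ (eId_postU i), ?_⟩⟩
  · rw [← preU_postU, hg, preU_eId_right]
  · rw [← postU_eq_preU, hg]

variable [MonoidalClosed V]

/-- A limit of objects with coreflections has a coreflection, if the limit of the coreflections
lies in the class. -/
theorem IsWeightedLimit.exists_isCoreflection {J : Type u₁} [EnrichedCategory V J]
    {φ : EnrichedFunctor V J V} {T T' : EnrichedFunctor V J D}
    {i : ∀ j, 𝟙_ V ⟶ (T'.obj j ⟶[V] T.obj j)}
    (hi : ∀ j, IsCoreflection P (T.obj j) (T'.obj j) (i j))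
    (hT' : ∀ j k, postU (T'.map j k) (i k) = preU (i j) (T.map j k))
    {l : D} {μ : ∀ j, φ.obj j ⟶ (l ⟶[V] T.obj j)} (h : IsWeightedLimit φ T l μ)
    {l' : D} {μ' : ∀ j, φ.obj j ⟶ (l' ⟶[V] T'.obj j)} (h' : IsWeightedLimit φ T' l' μ')
    (hl' : P l') : ∃ i : 𝟙_ V ⟶ (l' ⟶[V] l), IsCoreflection P l l' i := by
  obtain ⟨i₀, hi₀⟩ := h.exists_liftU (a := l') (ν := fun j => postU (μ' j) (i j)) fun j k => by
    rw [comp_postU, h'.cone j k, ← tensor_postU_eComp, hT', postU_tensor_eComp]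
  refine ⟨i₀, hl', fun F hF X f => ?_⟩
  -- A map from `F` in the class to `l` gives a cone on `T` with vertex `F`; each component lifts
  -- uniquely to `T'`, so the cone does too.
  choose g hg hg' using fun j =>
    (hi j).exists_unique F hF (X ⊗ φ.obj j) ((f ⊗ₘ μ j) ≫ eComp V _ _ _)
  have hgc : IsCone φ T' F X g := fun j k => by
    refine ((hi k).exists_unique F hF _ _).unique ?_ rfl
    rw [← tensor_postU_eComp, hT', ← postU_tensor_eComp, hg, ← comp_postU, ← comp_postU, hg]
    exact h.cone.isCone f j k
  have key (k : X ⟶ (F ⟶[V] l')) (j : J) : (postU k i₀ ⊗ₘ μ j) ≫ eComp V _ _ _ =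
      postU ((k ⊗ₘ μ' j) ≫ eComp V _ _ _) (i j) := by
    rw [postU_tensor_eComp, hi₀, tensor_postU_eComp]
  obtain ⟨k, hk⟩ := h'.exists_lift hgc
  refine ⟨k, h.hom_ext fun j => ?_, fun k' hk' => h'.hom_ext fun j => ?_⟩
  · rw [key, hk, hg]
  · rw [hk]
    refine hg' j _ ?_
    change postU _ _ = _
    rw [← key]
    exact congrArg (fun x => (x ⊗ₘ μ j) ≫ eComp V _ _ _) hk'

end Coreflections

/-! ### Composition and reflection of limits. -/

section Reflect

variable [MonoidalClosed V] {J : Type u₁} [EnrichedCategory V J] {C : Type u₂}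
  [EnrichedCategory V C] {D : Type u₃} [EnrichedCategory V D]

/-- Absorbs the non-definitional associativity and unit laws of composite functors, which agree on
objects. -/
theorem IsWeightedLimit.of_map_eq {φ : EnrichedFunctor V J V} {T : EnrichedFunctor V J C} {l : C}
    {μ : ∀ j, φ.obj j ⟶ (l ⟶[V] T.obj j)} (h : IsWeightedLimit φ T l μ)
    {m : ∀ j k : J, (j ⟶[V] k) ⟶ (T.obj j ⟶[V] T.obj k)} {h₁ h₂} (hm : ∀ j k, m j k = T.map j k) :
    IsWeightedLimit φ ⟨T.obj, m, h₁, h₂⟩ l μ := by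
  obtain rfl : m = T.map := funext fun j => funext fun k => hm j k
  exact h

theorem PreservesWeightedLimit.comp {E : Type*} [EnrichedCategory V E] {F : EnrichedFunctor V C D}
    {G : EnrichedFunctor V D E} {φ : EnrichedFunctor V J V} {T : EnrichedFunctor V J C}
    (hF : PreservesWeightedLimit F φ T) (hG : PreservesWeightedLimit G φ (T.comp V F)) :
    PreservesWeightedLimit (F.comp V G) φ T := fun l μ h => by
  have h₁ := hG _ _ (hF l μ h)
  have h₂ : IsWeightedLimit φ (T.comp V (F.comp V G)) (G.obj (F.obj l))
      (fun j => (μ j ≫ F.map l (T.obj j)) ≫ G.map _ _) :=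
    h₁.of_map_eq (m := (T.comp V (F.comp V G)).map) fun j k => (Category.assoc _ _ _).symm
  have e : (fun j => (μ j ≫ F.map l (T.obj j)) ≫ G.map _ _) =
      fun j => μ j ≫ (F.comp V G).map l (T.obj j) := funext fun j => Category.assoc _ _ _
  exact (congrArg (IsWeightedLimit φ (T.comp V (F.comp V G)) (G.obj (F.obj l))) e).mp h₂

/-- Fully faithful functors reflect limits. -/
theorem IsWeightedLimit.reflect {F : EnrichedFunctor V C D} (hF : ∀ x y, IsIso (F.map x y))
    {φ : EnrichedFunctor V J V} {T : EnrichedFunctor V J C} {l : C}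
    {μ : ∀ j, φ.obj j ⟶ (l ⟶[V] T.obj j)}
    (h : IsWeightedLimit φ (T.comp V F) (F.obj l) (fun j => μ j ≫ F.map _ _)) :
    IsWeightedLimit φ T l μ := by
  have key {A X : V} {x y z : C} (f : A ⟶ (x ⟶[V] y)) (g : X ⟶ (y ⟶[V] z)) (k) :
      k = (f ⊗ₘ g) ≫ eComp V _ _ _ ↔
        k ≫ F.map _ _ = ((f ≫ F.map _ _) ⊗ₘ (g ≫ F.map _ _)) ≫ eComp V _ _ _ := by
    rw [← tensor_eComp_map, cancel_mono]
  refine isWeightedLimit_iff.2 ⟨fun j k => (key _ _ _).2 ?_, fun a X t ht => ?_⟩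
  · exact (Category.assoc _ _ _).trans (h.cone j k)
  · obtain ⟨f, hf, hf'⟩ := (isWeightedLimit_iff.1 h).2 (F.obj a) X (fun j => t j ≫ F.map _ _)
      fun j k => by
        have := (key _ _ _).1 (ht j k)
        rw [Category.assoc, Category.assoc] at this
        exact this
    refine ⟨f ≫ inv (F.map a l), fun j => ((key _ _ _).2 ?_).symm, fun g hg => ?_⟩
    · rw [Category.assoc, IsIso.inv_hom_id, Category.comp_id]
      exact (hf j).symm
    · rw [← hf' (g ≫ F.map a l) fun j => ((key _ _ _).1 (hg j).symm).symm, Category.assoc,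
        IsIso.hom_inv_id, Category.comp_id]

variable (V) in
/-- The inclusion of a full subcategory. -/
def inclusion (P : C → Prop) : EnrichedFunctor V (FullSub P) C where
  obj x := x.1
  map x y := 𝟙 (x.1 ⟶[V] y.1)
  map_id _ := Category.comp_id _
  map_comp x y z := (Category.comp_id _).trans ((congrArg (· ≫ eComp V x.1 y.1 z.1)
    (id_tensorHom_id _ _)).trans (Category.id_comp _)).symm

end Reflect

end VCat

end

noncomputable section

namespace VCat

variable {V : Type u} [Category.{w} V] [MonoidalCategory V] [SymmetricCategory V]

/-! ### The reflection of a weight whose colimit exists in `N`. -/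

section Representables

variable [MonoidalClosed V] [HasLimitsOfSize.{w, w} V] {N : Type u₁} [EnrichedCategory V N]
  [IsSmall V N]

/-- If `c` is the colimit of the identity weighted by `ψ`, then the representable presheaf of `c`
is the reflection of `ψ` into any class of presheaves that preserve the corresponding limit. -/
theorem exists_isCoreflection_homTo {ψ : EnrichedFunctor V Nᵒᵖ V} {c : N}
    {η : ∀ n : Nᵒᵖ, ψ.obj n ⟶ (n.unop ⟶[V] c)}
    (h : IsWeightedColimit ψ (EnrichedFunctor.id V N) c η)
    {P : (EnrichedFunctor V Nᵒᵖ V)ᵒᵖ → Prop}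
    (hP : ∀ F, P F → PreservesWeightedLimit F.unop ψ (opFunctor (EnrichedFunctor.id V N)))
    (hc : P (op (homTo c))) :
    ∃ i : 𝟙_ V ⟶ (op (homTo c) ⟶[V] op ψ), IsCoreflection P (op ψ) (op (homTo c)) i := by
  have hlim := isWeightedColimit_iff_op.1 h
  have hcone (j k : Nᵒᵖ) : act ψ j k ≫ η k = η j ▷ _ ≫ eComp V (op c) j k := by
    refine (hlim.cone j k).trans ?_
    exact congrArg (· ≫ eComp V (op c) j k) (tensorHom_id (η j) _)
  have hgr : IsGr (𝟙_ V) ψ (homTo c) (fun n => (λ_ _).hom ≫ η n) := fun j k => by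
    have h₁ : (α_ _ _ _).hom ≫ 𝟙_ V ◁ act ψ j k ≫ (λ_ _).hom ≫ η k =
        ((λ_ _).hom ≫ η j) ▷ _ ≫ eComp V (op c) j k := by
      rw [leftUnitor_naturality_assoc, hcone]
      simp
    exact h₁.trans (congrArg (((λ_ _).hom ≫ η j) ▷ _ ≫ ·) (act_homFrom (op c) j k).symm)
  obtain ⟨i, hi⟩ := hgr.exists_lift
  have hi' (n : Nᵒᵖ) : uev i n = η n := by
    rw [uev, hi]
    exact Iso.inv_hom_id_assoc _ _
  refine ⟨i, hc, fun F hF X f => ?_⟩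
  let u (n : Nᵒᵖ) : F.unop.obj (op c) ⊗ ψ.obj n ⟶ F.unop.obj n :=
    F.unop.obj (op c) ◁ η n ≫ act F.unop (op c) n
  have hu (n : Nᵒᵖ) : η n ≫ F.unop.map (op c) n = MonoidalClosed.curry (u n) :=
    (MonoidalClosed.curry_uncurry _).symm.trans
      (congrArg MonoidalClosed.curry (MonoidalClosed.uncurry_natural_left _ _))
  have hlimF : IsWeightedLimit ψ F.unop (F.unop.obj (op c))
      (fun n => MonoidalClosed.curry (u n)) := by
    have h₁ := (hP F hF _ _ hlim).of_map_eq (m := F.unop.map) (h₁ := F.unop.map_id)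
      (h₂ := F.unop.map_comp) fun j k => (Category.id_comp _).symm
    exact (congrArg (IsWeightedLimit ψ F.unop (F.unop.obj (op c))) (funext hu)).mp h₁
  have key {g : X ⟶ (homTo c ⟶[V] F.unop)} {b : X ⟶ F.unop.obj (op c)}
      (hg : ∀ n : Nᵒᵖ, g ▷ (op c ⟶[V] n) ≫ evF (homTo c) F.unop n = b ▷ _ ≫ act F.unop (op c) n)
      (n : Nᵒᵖ) : preU i g ▷ _ ≫ evF ψ F.unop n = b ▷ _ ≫ u n := by
    rw [preU_evF, hi']
    exact (congrArg (X ◁ η n ≫ ·) (hg n)).trans (whisker_exchange_assoc b (η n) _)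
  -- Continuity of `F` makes `F c` the limit `{ψ, F}`, so `f` corresponds to an element `b` of `F
  -- c`, and Yoneda turns `b` into a map from the representable.
  obtain ⟨b, hb, hb'⟩ := hlimF.exists_unique_gr (whiskerRight_evF_isGr (F := ψ) (G := F.unop) f)
  obtain ⟨g, hg⟩ := exists_yoneda_lift F.unop b
  refine ⟨g, (postU_op' (J := EnrichedFunctor V Nᵒᵖ V) i g).trans ?_, fun g' hg' => ?_⟩
  · exact evF_ext fun n => (key hg n).trans (hb n)
  · have h₁ := eval_yoneda (j := op c) (G := F.unop) g'
    refine evF_ext fun n => (h₁ n).trans (Eq.trans ?_ (hg n).symm)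
    rw [hb' _ fun n => ((key h₁ n).symm.trans ?_)]
    rw [← (postU_op' (J := EnrichedFunctor V Nᵒᵖ V) i g').symm.trans hg']

end Representables

/-! ### `Φ(A)` as a `Φ`-cocomplete category, and reflections of flat colimits. -/

namespace WeightClass

variable [MonoidalClosed V] [HasLimits V] [HasColimits V] {Φ : WeightClass V}

/-- The inclusion of `Φ(A)` preserves `Φ`-colimits. -/
theorem hasPreserves_inclusion (A : Type (max u w)) [EnrichedCategory V A] [IsSmall V A]
    {K : Type (max u w)} [EnrichedCategory V K] [IsSmall V K] {φ : EnrichedFunctor V Kᵒᵖ V}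
    (hφ : Φ K φ) : HasPreserves (opFunctor (inclusion V (Φ.Free A))) φ := fun T => by
  obtain ⟨c, η, hη⟩ := exists_isWeightedColimit φ
    (unopFunctor (T.comp V (opFunctor (inclusion V (Φ.Free A)))))
  -- The colimit is formed among all presheaves and stays in `Φ(A)` by closure; the fully faithful
  -- inclusion then reflects it.
  have hc : Φ.Free A c := Closure.colimit K φ hφ
    (unopFunctor (T.comp V (opFunctor (inclusion V (Φ.Free A)))))
    (fun k => (T.obj (op k)).unop.2) η hη
  have h : IsWeightedLimit φ (T.comp V (opFunctor (inclusion V (Φ.Free A))))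
      ((opFunctor (inclusion V (Φ.Free A))).obj (op ⟨c, hc⟩))
      (fun j => η j ≫ (opFunctor (inclusion V (Φ.Free A))).map (op ⟨c, hc⟩) (T.obj j)) := by
    have e : (fun j => η j ≫ (opFunctor (inclusion V (Φ.Free A))).map (op ⟨c, hc⟩) (T.obj j)) = η :=
      funext fun j => Category.comp_id (η j)
    exact (congrArg (IsWeightedLimit φ (T.comp V (opFunctor (inclusion V (Φ.Free A)))) (op c)) e).mpr
      (isWeightedColimit_iff_op.1 hη)
  exact ⟨op ⟨c, hc⟩, η, h.reflect fun _ _ => inferInstanceAs (IsIso (𝟙 _)), h⟩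

theorem isCocomplete_free (A : Type (max u w)) [EnrichedCategory V A] [IsSmall V A] :
    Φ.IsCocomplete (FullSub (Φ.Free A)) := fun _ _ _ _ hφ S =>
  (hasPreserves_opFunctor_iff.1 (hasPreserves_inclusion A hφ) S).1

/-- The inclusion preserves `Φ`-colimits, and a representable turns them into limits in `V`. -/
theorem isContinuous_homTo_inclusion (A : Type (max u w)) [EnrichedCategory V A] [IsSmall V A]
    (F : EnrichedFunctor V Aᵒᵖ V) :
    Φ.IsContinuous ((opFunctor (inclusion V (Φ.Free A))).comp V (homTo F)) := fun _ _ _ _ hφ T =>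
  PreservesWeightedLimit.comp ((hasPreserves_iff.1 (hasPreserves_inclusion A hφ)) T).2
    (preservesWeightedLimit_of_homFrom _ _ _)

/-- Every presheaf on `A` is a colimit of the inclusion of `Φ(A)`. -/
theorem isWeightedColimit_inclusion (A : Type (max u w)) [EnrichedCategory V A] [IsSmall V A]
    (F : EnrichedFunctor V Aᵒᵖ V) :
    IsWeightedColimit ((opFunctor (inclusion V (Φ.Free A))).comp V (homTo F))
      (inclusion V (Φ.Free A)) F (fun m => 𝟙 (m.unop.1 ⟶[V] F)) :=
  isWeightedColimit_density (inclusion V (Φ.Free A)) (fun _ _ => inferInstanceAs (IsIso (𝟙 _)))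
    (fun j => ⟨⟨homTo j.unop, Closure.of ⟨_, rfl⟩⟩, eId V j, isRep_homFrom j⟩) F

/-- If every presheaf on a `Φ`-cocomplete `N` lies in the closure of `Φ(N)` under flat colimits,
then the `Φ`-continuous ones lie in the closure of the representables. -/
theorem free_flat_of_isContinuous (hsat : Φ.IsSaturated) {N : Type (max u w)}
    [EnrichedCategory V N] [IsSmall V N] (hN : Φ.IsCocomplete N) {F : EnrichedFunctor V Nᵒᵖ V}
    (hF : Φ.flat.Closure (Φ.Free N) F) (hcont : Φ.IsContinuous F) : Φ.flat.Free N F := by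
  have hfree {G : EnrichedFunctor V Nᵒᵖ V} (hG : Φ.flat.Free N G) : Φ.IsContinuous G :=
    (flat_of_free hG).isContinuous
  -- A reflection among presheaves is phrased as a coreflection in the opposite category, where the
  -- results on limits apply.
  have main : ∃ (G : (EnrichedFunctor V Nᵒᵖ V)ᵒᵖ) (i : 𝟙_ V ⟶ (G ⟶[V] op F)),
      Φ.flat.Free N G.unop ∧ IsCoreflection (fun G => Φ.IsContinuous G.unop) (op F) G i := by
    -- The stages of the closure need not be continuous, so the induction must not carry this
    -- hypothesis.
    clear hcont
    induction hF with
    | @of ψ hψ =>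
      -- Saturation makes `ψ` itself a member of `Φ`: hence `ψ * id` exists in `N`, and continuous
      -- presheaves preserve it.
      have hψ' := hsat.of_free hψ
      obtain ⟨c, η, hη⟩ := hN N ψ hψ' (EnrichedFunctor.id V N)
      have hc : Φ.flat.Free N (homTo c) := Closure.of ⟨c, rfl⟩
      obtain ⟨i, hi⟩ := exists_isCoreflection_homTo (P := fun G => Φ.IsContinuous G.unop) hη
        (fun G hG => hG N ψ hψ' _) (hfree hc)
      exact ⟨_, i, hc, hi⟩
    | iso e _ ih =>
      obtain ⟨G, i, hG, hi⟩ := ih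
      exact ⟨G, _, hG, hi.of_iso (areIso_iff.1 e).some.symm.op⟩
    | colimit K χ hχ S _ η hη ih =>
      choose G i hG hi using fun k : Kᵒᵖ => ih k.unop
      obtain ⟨T', i', hT', hi', hn⟩ := exists_coreflection_functor (opFunctor S) hi
      -- The colimit of the reflections is taken among all presheaves. As a flat colimit of members
      -- of `Φ⁺(N)` it lies in `Φ⁺(N)`, so it is continuous without further reflection.
      obtain ⟨c, η', hη'⟩ := exists_isWeightedColimit χ (unopFunctor T')
      have hc : Φ.flat.Free N c := Closure.colimit K χ hχ _ (fun k => by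
        have := hG (op k)
        rw [← hT'] at this
        exact this) η' hη'
      obtain ⟨j, hj⟩ := (isWeightedColimit_iff_op.1 hη).exists_isCoreflection hi' hn
        (isWeightedColimit_iff_op.1 hη') (hfree hc)
      exact ⟨op c, j, hc, hj⟩
  obtain ⟨G, i, hG, hi⟩ := main
  obtain ⟨e⟩ := hi.exists_eIso hcont
  exact Closure.iso (areIso_iff.2 ⟨e.unop.symm⟩) hG

end WeightClass

end VCat

end

theorem mainTheorem11 (V : Type u) [Category.{w} V] [MonoidalCategory V] [SymmetricCategory V]
    [MonoidalClosed V] [HasLimits V] [HasColimits V]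
    (Φ : WeightClass V) (hsat : Φ.IsSaturated) (hsmall : Φ.IsLocallySmall) :
    List.TFAE [
      -- (i) `Φ-Conts[Nᵒᵖ, V] = Φ⁺(N)` for every small `Φ`-cocomplete `N`
      ∀ (N : Type (max u w)) [EnrichedCategory V N] [IsSmall V N], Φ.IsCocomplete N →
        ∀ F : EnrichedFunctor V Nᵒᵖ V, Φ.IsContinuous F ↔ Φ.flat.Free N F,
      -- (ii) every presheaf on a small `A` is a `Φ⁺`-colimit of a diagram in `Φ(A)`
      ∀ (A : Type (max u w)) [EnrichedCategory V A] [IsSmall V A] (F : EnrichedFunctor V Aᵒᵖ V),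
        ∃ (L : Type (max u w)) (_ : EnrichedCategory V L) (_ : IsSmall V L)
          (φ : EnrichedFunctor V Lᵒᵖ V) (S : EnrichedFunctor V L (EnrichedFunctor V Aᵒᵖ V)),
          Φ.flat L φ ∧ (∀ l, Φ.Free A (S.obj l)) ∧ ∃ η, IsWeightedColimit φ S F η,
      -- (iii) `Φ⁺{Φ(A)} = [Aᵒᵖ, V]` for every small `A`
      ∀ (A : Type (max u w)) [EnrichedCategory V A] [IsSmall V A] (F : EnrichedFunctor V Aᵒᵖ V),
        Φ.flat.Closure (Φ.Free A) F] := by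
  -- Here (i) is applied to `N = Φ(A)`, small by local smallness, and to the weight of the density
  -- presentation of `F`.
  tfae_have 1 → 2 := fun h A _ _ F =>
    have := hsmall A
    ⟨VCat.FullSub (Φ.Free A), inferInstance, hsmall A, _, VCat.inclusion V (Φ.Free A),
      WeightClass.flat_of_free ((h _ (WeightClass.isCocomplete_free A) _).1
        (WeightClass.isContinuous_homTo_inclusion A F)),
      fun l => l.2, _, WeightClass.isWeightedColimit_inclusion A F⟩
  tfae_have 2 → 3 := fun h A _ _ F => by
    obtain ⟨L, _, _, φ, S, hφ, hS, η, hη⟩ := h A F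
    exact .colimit L φ hφ S (fun l => .of (hS l)) η hη
  tfae_have 3 → 1 := fun h N _ _ hN F =>
    ⟨WeightClass.free_flat_of_isContinuous hsat hN (h N F),
      fun hF => (WeightClass.flat_of_free hF).isContinuous⟩
  tfae_finish
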